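/- For each $n\ge 1$ consider a first-come first-served queue with $n$ servers. Service times are i.i.d., independent of the arrivals, with the law of a random variable $S$ that does not depend on $n$, takes values in $\{1,\dots,K\}$, has $\mathbb P[S=K]>0$ and $\operatorname{Var}S>0$, and whose possible values have greatest common divisor $1$; put $1/\mu=\mathbb E S$. Customers arrive to the $n$th system according to a stationary renewal process with interarrival time $\tau_n\ge 0$, $0<\mathbb E\tau_n<\infty$, rate $\lambda_n=1/\mathbb E\tau_n\to\infty$ and coefficient of variation $c_{a,n}\to c_a\in[0,\infty)$. Let $A^n$ be the number of arrivals in a time interval $(t-1,t]$ and $a^n$ the backward recurrence time of the arrival process at time $t-1$; suprema over $a$ are over the possible values of $a^n$, and the conditional law given $a^n=a$ is the one under which the next arrival occurs after a time distributed as $\tau_n-a$ given $\tau_n>a$, followed by independent interarrival times distributed as $\tau_n$. Assume that, as $n\to\infty$, $$\sup_{a}\Big|\mathbb P\Big[\tfrac{A^n-\lambda_n}{\sqrt{\lambda_n}}\le x\,\Big|\,a^n=a\Big]-\mathbb P[A\le x]\Big|\to 0$$ for every continuity point $x$ of the distribution function of $A$, where $A$ is normal with mean $0$ and variance $c_a^2$,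 that $$\sup_a \mathbb E\Big[\tfrac{A^n-\lambda_n}{\sqrt{\lambda_n}}\,\Big|\,a^n=a\Big]\to 0,\qquad \limsup_{n\to\infty}\sup_a\mathbb E\Big[\Big(\tfrac{A^n-\lambda_n}{\sqrt{\lambda_n}}\Big)^2\,\Big|\,a^n=a\Big]<\infty,$$ and that $\sqrt n\,(1-\lambda_n/(n\mu))\to\beta$ for some $\beta>0$. For all sufficiently large $n$, let the $n$th system be in a stationary regime: the joint law of the number $Q^n_t$ of customers awaiting service at time $t$ and of the numbers $L^n_{t,k}$, $1\le k\le K$, of customers in service with remaining service time in $(k-1,k]$ does not depend on $t\ge 0$; let $Q^n$ have the law of $Q^n_t$ in this regime. Suppose that there are finite constants $c$ and $C$ such that for every $\theta>0$ $$\limsup_{n\to\infty}\ \sup_{a}\ \mathbb E\Big[e^{\theta|A^n-\lambda_n|/\sqrt n}\,\Big|\,a^n=a\Big]\le C e^{c\theta^2}.$$ Then there exists $\theta>0$ such that $$\limsup_{n\to\infty}\mathbb E\, e^{\theta Q^n/\sqrt n}<\infty .$$ -/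

import Mathlib

open MeasureTheory ProbabilityTheory Filter Topology Set
open scoped NNReal ENNReal

namespace QEDQueue

noncomputable section

/-! ### Service times -/

/-- A lattice service-time law: `p i = P[S = i]`, supported in `{1, …, K}` with `K` the largest
possible value, the largest common divisor of the possible values is `1`, and the variance is
positive (the service times are not deterministic). -/
structure IsServiceLaw (p : PMF ℕ) (K : ℕ) : Prop where
  zero : p 0 = 0
  top_ne : p K ≠ 0
  above : ∀ i, K < i → p i = 0
  gcd_eq_one : ∀ d : ℕ, (∀ i, p i ≠ 0 → d ∣ i) → d = 1
  variance_pos : 0 < Var[fun k : ℕ => (k : ℝ); p.toMeasure]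

/-- The mean service time `E S = 1 / μ`. -/
def meanService (p : PMF ℕ) : ℝ := ∫ k : ℕ, (k : ℝ) ∂p.toMeasure

/-! ### Renewal arrivals -/

/-- `ν` is the law of a nonnegative interarrival time with finite positive mean. -/
structure IsInterarrivalLaw (ν : Measure ℝ) : Prop where
  nonneg : ν (Iio 0) = 0
  integrable : Integrable (fun x => x) ν
  mean_pos : 0 < ∫ x, x ∂ν

/-- The arrival rate `λ = 1 / E τ`. -/
def rate (ν : Measure ℝ) : ℝ := (∫ x, x ∂ν)⁻¹

/-- The coefficient of variation (standard deviation over mean) of the interarrival times; it is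
`∞` if the second moment is infinite. -/
def coeffVar (ν : Measure ℝ) : ℝ≥0∞ :=
  (evariance (fun x => x) ν) ^ (1 / 2 : ℝ) * ENNReal.ofReal (rate ν)

/-- The possible values of the backward recurrence time (age) of the arrival process. -/
def ages (ν : Measure ℝ) : Set ℝ := {a | 0 ≤ a ∧ 0 < ν (Ioi a)}

/-- The law of the backward recurrence time of the stationary renewal process: it has density
`P[τ > a] / E τ` on `[0, ∞)`. -/
def equilibriumAge (ν : Measure ℝ) : Measure ℝ :=
  (volume.restrict (Ici 0)).withDensity fun a => ENNReal.ofReal (rate ν) * ν (Ioi a)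

/-- The law of the time until the next arrival when the backward recurrence time is `a`,
i.e. the law of `τ - a` given `τ > a`. -/
def residualLaw (ν : Measure ℝ) (a : ℝ) : Measure ℝ :=
  (ProbabilityTheory.cond ν (Ioi a)).map fun x => x - a

/-- The conditional law of the future of the arrival process given that the backward recurrence
time is `a`: the time until the first arrival, and the interarrival times that follow it. -/
def futureLaw (ν : Measure ℝ) [IsProbabilityMeasure ν] (a : ℝ) : Measure (ℝ × (ℕ → ℝ)) :=
  (residualLaw ν a).prod (Measure.infinitePi fun _ : ℕ => ν)

/-- The number of arrivals during the next unit of time. -/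
def unitCount (w : ℝ × (ℕ → ℝ)) : ℕ :=
  {k : ℕ | w.1 + ∑ i ∈ Finset.range k, w.2 i ≤ 1}.ncard

/-- The number of arrivals during the next unit of time, centered by the mean and divided
by `s`. -/
def centeredCount (ν : Measure ℝ) (s : ℝ) (w : ℝ × (ℕ → ℝ)) : ℝ :=
  ((unitCount w : ℝ) - rate ν) / s

/-- Asymptotic conditions on the arrival counts in a unit time interval, uniformly in the
backward recurrence time at its beginning: convergence in distribution to a centered Gaussian
law with variance `ca ^ 2` (at the continuity points of that law), the condition on the means, and
bounded second moments. -/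
structure ArrivalConditions (ν : ℕ → Measure ℝ) [∀ n, IsProbabilityMeasure (ν n)]
    (ca : ℝ≥0) : Prop where
  rate_tendsto : Tendsto (fun n => rate (ν n)) atTop atTop
  coeffVar_tendsto : Tendsto (fun n => coeffVar (ν n)) atTop (𝓝 (ca : ℝ≥0∞))
  distr : ∀ x : ℝ, gaussianReal 0 (ca ^ 2) {x} = 0 →
    Tendsto (fun n => ⨆ a : ages (ν n), ENNReal.ofReal
        |(futureLaw (ν n) a).real {w | centeredCount (ν n) (√(rate (ν n))) w ≤ x}
          - (gaussianReal 0 (ca ^ 2)).real (Iic x)|) atTop (𝓝 0)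
  mean : Tendsto (fun n => ⨆ a : ages (ν n),
      ∫ w, centeredCount (ν n) (√(rate (ν n))) w ∂(futureLaw (ν n) a)) atTop (𝓝 0)
  second : limsup (fun n => ⨆ a : ages (ν n),
      ∫⁻ w, ENNReal.ofReal (centeredCount (ν n) (√(rate (ν n))) w ^ 2)
        ∂(futureLaw (ν n) a)) atTop < ∞

/-- The uniform conditional exponential moment bound on the arrival counts, centered by `λ_n` and
scaled by `√n`. -/
def ArrivalExpMoments (ν : ℕ → Measure ℝ) [∀ n, IsProbabilityMeasure (ν n)] : Prop :=
  ∃ c C : ℝ, ∀ θ : ℝ, 0 < θ →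
    limsup (fun n : ℕ => ⨆ a : ages (ν n),
      ∫⁻ w, ENNReal.ofReal (Real.exp (θ * |centeredCount (ν n) (√(n : ℝ)) w|))
        ∂(futureLaw (ν n) a)) atTop ≤ ENNReal.ofReal (C * Real.exp (c * θ ^ 2))

/-! ### The first-come first-served queue with `n` servers -/

/-- The random input of the queue with `n` servers from time `0` on. -/
structure Input (n : ℕ) (Ω : Type*) where
  /-- The number of customers that are waiting at time `0`. -/
  q₀ : Ω → ℕ
  /-- The remaining service times at time `0` in the `n` servers (`0` for an idle server). -/
  r : Ω → Fin n → ℝ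
  /-- The backward recurrence time of the arrival process at time `0`. -/
  age : Ω → ℝ
  /-- The time of the first arrival after time `0`. -/
  first : Ω → ℝ
  /-- The interarrival times after the first arrival. -/
  gap : ℕ → Ω → ℝ
  /-- The service times of the customers: first those that are waiting at time `0`, then those
  that arrive later, in the order of arrival. -/
  service : ℕ → Ω → ℕ

/-- The time at which customer `j` is first present: `0` for the `q` customers that are waiting at
time `0`, the time of arrival for the others. -/
def arrivalTime (q : ℕ) (first : ℝ) (gap : ℕ → ℝ) (j : ℕ) : ℝ :=
  if j < q then 0 else first + ∑ i ∈ Finset.range (j - q), gap i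

/-- The time at which customer `j` enters service under the first-come first-served discipline:
the first time, not before its arrival, when fewer than `n` of the customers with precedence
(those in service at time `0`, and the customers `i < j`) are still in the system. -/
def startTime (n : ℕ) (r : Fin n → ℝ) (arr : ℕ → ℝ) (s : ℕ → ℕ) (j : ℕ) : ℝ :=
  sInf {t : ℝ | arr j ≤ t ∧
    {i : Fin n | t < r i}.ncard + {i : Fin j | t < startTime n r arr s i + s i}.ncard < n}
termination_by j
decreasing_by exact i.2

namespace Input

variable {n : ℕ} {Ω : Type*}

/-- The arrival time of customer `j`. -/
def arr (D : Input n Ω) (ω : Ω) (j : ℕ) : ℝ :=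
  arrivalTime (D.q₀ ω) (D.first ω) (fun i => D.gap i ω) j

/-- The time at which customer `j` enters service. -/
def start (D : Input n Ω) (ω : Ω) (j : ℕ) : ℝ :=
  startTime n (D.r ω) (D.arr ω) (fun i => D.service i ω) j

/-- `Q_t`: the number of customers that await service at time `t`. -/
def queueLength (D : Input n Ω) (t : ℝ) (ω : Ω) : ℕ :=
  {j : ℕ | D.arr ω j ≤ t ∧ t < D.start ω j}.ncard

/-- `L_{t,k+1}`: the number of customers in service at time `t` with remaining service time in
`(k, k + 1]`. -/
def inService (D : Input n Ω) (t : ℝ) (ω : Ω) (k : ℕ) : ℕ :=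
  {i : Fin n | D.r ω i - t ∈ Ioc (k : ℝ) (k + 1)}.ncard +
    {j : ℕ | D.start ω j ≤ t ∧
      D.start ω j + D.service j ω - t ∈ Ioc (k : ℝ) (k + 1)}.ncard

/-- `(Q_t, (L_{t,1}, …, L_{t,K}))`. -/
def state (D : Input n Ω) (K : ℕ) (t : ℝ) (ω : Ω) : ℕ × (Fin K → ℕ) :=
  (D.queueLength t ω, fun k => D.inService t ω k)

/-- The state at time `0`. -/
def init (D : Input n Ω) (ω : Ω) : ℕ × (Fin n → ℝ) × ℝ := (D.q₀ ω, D.r ω, D.age ω)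

end Input

/-- `D` is a stationary version of the queue with `n` servers, interarrival law `ν` and service
law `p`: arrivals form a stationary renewal process, service times are i.i.d. and independent of
the arrivals and of the state at time `0`, and the law of `(Q_t, L_t)` does not depend on
`t ≥ 0`. -/
structure IsStationaryQueue {n : ℕ} {Ω : Type*} [MeasurableSpace Ω] (P : Measure Ω)
    (ν : Measure ℝ) (p : PMF ℕ) (K : ℕ) (D : Input n Ω) : Prop where
  measurable_init : Measurable D.init
  measurable_first : Measurable D.first
  measurable_gap : ∀ i, Measurable (D.gap i)
  measurable_service : ∀ j, Measurable (D.service j)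
  /-- Remaining service times lie in `[0, K]`. -/
  residual_mem : ∀ᵐ ω ∂P, ∀ i, D.r ω i ∈ Icc (0 : ℝ) K
  /-- No server idles while a customer is waiting. -/
  nonidling : ∀ᵐ ω ∂P, 0 < D.q₀ ω → ∀ i, 0 < D.r ω i
  law_age : P.map D.age = equilibriumAge ν
  /-- Given the state at time `0`, the first arrival occurs according to the residual law that
  belongs to the age. -/
  law_first : ∀ B : Set (ℕ × (Fin n → ℝ) × ℝ), MeasurableSet B → ∀ C : Set ℝ, MeasurableSet C →
    P (D.init ⁻¹' B ∩ D.first ⁻¹' C) = ∫⁻ ω in D.init ⁻¹' B, residualLaw ν (D.age ω) C ∂P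
  law_gap : ∀ i, P.map (D.gap i) = ν
  law_service : ∀ j, P.map (D.service j) = p.toMeasure
  indep_gap : iIndepFun D.gap P
  indep_service : iIndepFun D.service P
  indep_gap_service : IndepFun (fun ω i => D.gap i ω) (fun ω j => D.service j ω) P
  indep_init : IndepFun (fun ω => (D.init ω, D.first ω))
    (fun ω => ((fun i => D.gap i ω : ℕ → ℝ), (fun j => D.service j ω : ℕ → ℕ))) P
  stationary : ∀ t : ℝ, 0 ≤ t → IdentDistrib (D.state K t) (D.state K 0) P P

end

end QEDQueue

/-!
The queue is observed at integer times. Since service times are integers, in one unit of time every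
residual service time moves down by one class and each customer that enters service joins the class
of its service time. Centering the queue length, the numbers in service per class and the arrivals
by their values at full load, and dividing by `√n`, gives a path `(q, l)` with
`q' = q + a - b` and `l'_k = l_{k+1} + p_{k+1} b + ξ_k` (`ScaledPath`), where `a` are the net
arrivals, `b` the entries into service and `ξ` the fluctuations of the service times; no server
idles while customers wait, so that `∑ l ≤ 0` and `q ∑ l = 0`.

*The service profile contracts.* Without noise, a step of the profile `l` deviates from that of a
residual-time Markov chain by the *loss*, the difference between entries and departures, and each
unit of loss lowers `‖l‖₁` by at least one unit. Because the possible service times have greatest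
common divisor `1`, the chain satisfies a Doeblin condition (`exists_doeblin`), which contracts the part
of `l` with total mass zero; and a deficit of total mass can be repaired only through loss, or else
servers idle for `K` units of time and the old profile is forgotten. Balancing these effects,
`‖l‖₁` decreases by a factor after `N` steps, up to the noise (`ScaledPath.exists_contraction`). In
the stationary regime the law of `‖l‖₁` is the same before and after these steps, so the exponential
moments of the noise bound those of `‖l‖₁` uniformly in `n` (`IsStationaryQueue.expMoment_l1_le`).

*The queue is bounded by the workload.* The workload `m q + ∑ (k + 1) l_k` changes by the net input
as long as all servers are busy. Going back to the last time `τ` at which the queue was empty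
bounds `m q_t` by multiples of `‖l_τ‖₁` and `‖l_t‖₁` plus the net input over `[τ, t)`
(`ScaledPath.exists_queue_le`).

*The net input has negative drift.* The age of the arrival process is the only memory between
successive units of time, so a bound on the moment generating function of the net arrivals that is
uniform in the age is submultiplicative (`lintegral_exp_count_le_pow`); the spare capacity `β`
makes it smaller than `1` near `0` (`ArrivalConditions.exists_mgf_bound`). The time at which a
customer enters service depends only on the past, so the service times of the customers entering
service form exponential supermartingales by Hoeffding's lemma, and at most `n` customers enter per
unit of time (`IsStationaryQueue.lintegral_exp_serviceSum_le`). The latter contribute only at second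
order in the exponent.

*Conclusion.* Hölder's inequality separates the terms of the workload bound, and the resulting
exponential moments decay geometrically in `t - τ`, hence sum over `τ`. A truncation together with
stationarity removes the contribution of the initial queue (`IsStationaryQueue.expMoment_queue_le`).
-/

namespace QEDQueue

/-! ### Counting the terms of a monotone sequence -/

/-- The number of terms of the sequence `f` that are at most `t`. -/
noncomputable def countLE (f : ℕ → ℝ) (t : ℝ) : ℕ := {j : ℕ | f j ≤ t}.ncard

section countLE

variable {f : ℕ → ℝ}

lemma finite_setOf_le (hlim : Tendsto f atTop atTop) (t : ℝ) : {j : ℕ | f j ≤ t}.Finite := by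
  obtain ⟨N, hN⟩ := (hlim.eventually (eventually_gt_atTop t)).exists_forall_of_atTop
  refine (Set.finite_Iio N).subset fun j hj => ?_
  by_contra h
  exact absurd (hN j (not_lt.1 h)) (not_lt.2 hj)

lemma le_iff_lt_countLE (hmono : Monotone f) (hlim : Tendsto f atTop atTop) (t : ℝ) (j : ℕ) :
    f j ≤ t ↔ j < countLE f t := by
  have hfin := finite_setOf_le hlim t
  constructor
  · intro h
    have hsub : Set.Iio (j + 1) ⊆ {j : ℕ | f j ≤ t} := fun i hi =>
      (hmono (Nat.lt_succ_iff.1 hi)).trans h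
    have := Set.ncard_le_ncard hsub hfin
    simp only [Set.ncard_Iio_nat] at this
    exact this
  · intro h
    by_contra h'
    have hsub : {j : ℕ | f j ≤ t} ⊆ Set.Iio j := fun i hi => by
      by_contra hij
      exact h' ((hmono (not_lt.1 hij)).trans hi)
    have := Set.ncard_le_ncard hsub (Set.finite_Iio j)
    simp only [Set.ncard_Iio_nat] at this
    exact absurd h (not_lt.2 this)

lemma countLE_mono (hlim : Tendsto f atTop atTop) : Monotone (countLE f) :=
  fun _ t hst => Set.ncard_le_ncard (fun _ hj => le_trans hj hst) (finite_setOf_le hlim t)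

end countLE

lemma ncard_fin_setOf (j : ℕ) (q : ℕ → Prop) [DecidablePred q] :
    {i : Fin j | q i}.ncard = ((Finset.range j).filter q).card := by
  rw [← Set.ncard_image_of_injective _ Fin.val_injective, ← Set.ncard_coe_finset]
  congr 1
  ext i
  simp only [Set.mem_image, Set.mem_ofPred_eq, Finset.coe_filter, Finset.mem_range]
  exact ⟨fun ⟨x, hx, hxi⟩ => hxi ▸ ⟨x.2, hx⟩, fun ⟨h, hq⟩ => ⟨⟨i, h⟩, hq, rfl⟩⟩

/-- Exactly one of the intervals `(k, k + 1]` with `k < K` contains a given `x ∈ (0, K]`. -/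
lemma sum_ite_mem_Ioc {K : ℕ} {x : ℝ} (hx : x ≤ K) :
    ∑ k ∈ Finset.range K, (if x ∈ Ioc (k : ℝ) (k + 1) then 1 else 0) = if 0 < x then 1 else 0 := by
  classical
  split_ifs with h0
  · have hc : 0 < ⌈x⌉₊ := Nat.ceil_pos.2 h0
    have hmem : ⌈x⌉₊ - 1 ∈ Finset.range K := by
      have : ⌈x⌉₊ ≤ K := Nat.ceil_le.2 hx
      simp only [Finset.mem_range]; omega
    rw [Finset.sum_eq_single_of_mem _ hmem]
    · have h1 : ((⌈x⌉₊ - 1 : ℕ) : ℝ) = (⌈x⌉₊ : ℝ) - 1 := by push_cast [Nat.cast_sub hc]; ring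
      rw [if_pos]
      rw [h1]
      exact ⟨by linarith [Nat.ceil_lt_add_one h0.le], by linarith [Nat.le_ceil x]⟩
    · intro b _ hb
      rw [if_neg]
      rintro ⟨h1, h2⟩
      apply hb
      have : ⌈x⌉₊ = b + 1 := by
        rw [Nat.ceil_eq_iff (by omega)]
        simpa using ⟨h1, h2⟩
      omega
  · refine Finset.sum_eq_zero fun k _ => if_neg fun h => h0 ?_
    exact lt_of_le_of_lt (Nat.cast_nonneg k) h.1

/-! ### Sample paths of the queue -/

section Dynamics

variable {n : ℕ} {r : Fin n → ℝ} {arr : ℕ → ℝ} {s : ℕ → ℕ}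

/-- Since the number of customers with precedence that are still present decreases in time and is
right-continuous, the infimum that defines the start of service is attained. -/
lemma startTime_le_iff (hn : 0 < n) (j : ℕ) (t : ℝ) :
    startTime n r arr s j ≤ t ↔ arr j ≤ t ∧
      {i : Fin n | t < r i}.ncard +
        ((Finset.range j).filter fun i => t < startTime n r arr s i + s i).card < n := by
  classical
  set S := startTime n r arr s with hS
  rw [← ncard_fin_setOf]
  set A : Set ℝ := {t : ℝ | arr j ≤ t ∧
    {i : Fin n | t < r i}.ncard + {i : Fin j | t < S i + s i}.ncard < n} with hA
  have hSj : S j = sInf A := by rw [hS, startTime]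
  have hbdd : BddBelow A := ⟨arr j, fun t ht => ht.1⟩
  have hcard : ∀ {t t' : ℝ}, ({i : Fin n | t < r i} ⊆ {i : Fin n | t' < r i}) →
      ({i : Fin j | t < S i + s i} ⊆ {i : Fin j | t' < S i + s i}) →
      {i : Fin n | t < r i}.ncard + {i : Fin j | t < S i + s i}.ncard ≤
      {i : Fin n | t' < r i}.ncard + {i : Fin j | t' < S i + s i}.ncard := fun h1 h2 =>
    add_le_add (Set.ncard_le_ncard h1 (Set.toFinite _)) (Set.ncard_le_ncard h2 (Set.toFinite _))
  have hup : ∀ t ∈ A, ∀ t', t ≤ t' → t' ∈ A := fun t ht t' htt' =>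
    ⟨ht.1.trans htt', lt_of_le_of_lt (hcard (fun i hi => lt_of_le_of_lt htt' hi)
      (fun i hi => lt_of_le_of_lt htt' hi)) ht.2⟩
  -- After all residual and service times of the preceding customers, every server is free.
  have hne : A.Nonempty := by
    have h : ∀ᶠ t : ℝ in atTop, arr j ≤ t ∧ (∀ i : Fin n, r i ≤ t) ∧
        (∀ i : Fin j, S i + s i ≤ t) :=
      (eventually_ge_atTop _).and ((eventually_all.2 fun i => eventually_ge_atTop _).and
        (eventually_all.2 fun i => eventually_ge_atTop _))
    obtain ⟨t, h1, h2, h3⟩ := h.exists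
    refine ⟨t, h1, ?_⟩
    have e1 : {i : Fin n | t < r i} = ∅ := by ext i; simpa using h2 i
    have e2 : {i : Fin j | t < S i + s i} = ∅ := by ext i; simpa using h3 i
    rw [e1, e2]; simpa using hn
  -- Each indicator `t < x` is constant just to the right of `sInf A`.
  have hmem : sInf A ∈ A := by
    refine ⟨le_csInf hne fun t ht => ht.1, ?_⟩
    have h : ∀ᶠ t in 𝓝 (sInf A), (∀ i : Fin n, sInf A < r i → t < r i) ∧
        (∀ i : Fin j, sInf A < S i + s i → t < S i + s i) := by
      refine (eventually_all.2 fun i => ?_).and (eventually_all.2 fun i => ?_)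
      · by_cases h : sInf A < r i
        · filter_upwards [eventually_lt_nhds h] with t ht _ using ht
        · exact Eventually.of_forall fun t h' => absurd h' h
      · by_cases h : sInf A < S i + s i
        · filter_upwards [eventually_lt_nhds h] with t ht _ using ht
        · exact Eventually.of_forall fun t h' => absurd h' h
    obtain ⟨δ, hδ, hball⟩ := Metric.eventually_nhds_iff.1 h
    obtain ⟨t, htA, ht⟩ := exists_lt_of_csInf_lt hne (lt_add_of_pos_right (sInf A) hδ)
    have hle := csInf_le hbdd htA
    obtain ⟨h1, h2⟩ := hball (y := t) (by rw [Real.dist_eq, abs_of_nonneg] <;> linarith)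
    exact lt_of_le_of_lt (hcard (fun i hi => h1 i hi) (fun i hi => h2 i hi)) htA.2
  rw [hSj]
  exact ⟨fun h => hup _ hmem _ h, fun h => csInf_le hbdd h⟩

lemma arr_le_startTime (hn : 0 < n) (j : ℕ) : arr j ≤ startTime n r arr s j :=
  ((startTime_le_iff hn j _).1 le_rfl).1

lemma monotone_startTime (hn : 0 < n) (harr : Monotone arr) : Monotone (startTime n r arr s) := by
  refine monotone_nat_of_le_succ fun j => ?_
  obtain ⟨h1, h2⟩ := (startTime_le_iff (r := r) (arr := arr) (s := s) hn (j + 1) _).1 le_rfl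
  refine (startTime_le_iff hn j _).2 ⟨(harr j.le_succ).trans h1, lt_of_le_of_lt ?_ h2⟩
  gcongr
  exact j.le_succ

lemma tendsto_startTime (hn : 0 < n) (hlim : Tendsto arr atTop atTop) :
    Tendsto (startTime n r arr s) atTop atTop :=
  tendsto_atTop_mono (arr_le_startTime hn) hlim

/-- The number of customers in service at time `t` whose remaining service time lies in
`(k, k + 1]`, for the sample path with the given residual times, arrivals and service times. -/
noncomputable def pathInService (n : ℕ) (r : Fin n → ℝ) (arr : ℕ → ℝ) (s : ℕ → ℕ) (t : ℝ) (k : ℕ) :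
    ℕ :=
  {i : Fin n | r i - t ∈ Ioc (k : ℝ) (k + 1)}.ncard +
    {j : ℕ | startTime n r arr s j ≤ t ∧
      startTime n r arr s j + s j - t ∈ Ioc (k : ℝ) (k + 1)}.ncard

/-- The number of customers that await service at time `t` on a sample path. -/
noncomputable def pathQueue (n : ℕ) (r : Fin n → ℝ) (arr : ℕ → ℝ) (s : ℕ → ℕ) (t : ℝ) : ℕ :=
  {j : ℕ | arr j ≤ t ∧ t < startTime n r arr s j}.ncard

/-- The number of customers that have entered service by time `t` on a sample path. -/
noncomputable def pathStarted (n : ℕ) (r : Fin n → ℝ) (arr : ℕ → ℝ) (s : ℕ → ℕ) (t : ℝ) : ℕ :=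
  countLE (startTime n r arr s) t

lemma pathStarted_le (hn : 0 < n) (hlim : Tendsto arr atTop atTop) (t : ℝ) :
    pathStarted n r arr s t ≤ countLE arr t :=
  Set.ncard_le_ncard (fun j hj => (arr_le_startTime hn j).trans hj) (finite_setOf_le hlim t)

lemma pathQueue_add_started (hn : 0 < n) (harr : Monotone arr) (hlim : Tendsto arr atTop atTop)
    (t : ℝ) : pathQueue n r arr s t + pathStarted n r arr s t = countLE arr t := by
  have hle := pathStarted_le (r := r) (s := s) hn hlim t
  have : {j : ℕ | arr j ≤ t ∧ t < startTime n r arr s j} =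
      Set.Ico (pathStarted n r arr s t) (countLE arr t) := by
    ext j
    have h1 := le_iff_lt_countLE harr hlim t j
    have h2 := le_iff_lt_countLE (monotone_startTime (r := r) (s := s) hn harr)
      (tendsto_startTime hn hlim) t j
    simp only [Set.mem_ofPred_eq, Set.mem_Ico, h1, ← not_le, h2, pathStarted]
    omega
  rw [pathQueue, this, ← Finset.coe_Ico, Set.ncard_coe_finset, Nat.card_Ico]
  omega

lemma pathInService_eq (hn : 0 < n) (harr : Monotone arr) (hlim : Tendsto arr atTop atTop)
    (t : ℝ) (k : ℕ) :
    pathInService n r arr s t k = (Finset.univ.filter fun i => r i - t ∈ Ioc (k : ℝ) (k + 1)).card +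
      ((Finset.range (pathStarted n r arr s t)).filter fun j =>
        startTime n r arr s j + s j - t ∈ Ioc (k : ℝ) (k + 1)).card := by
  classical
  rw [pathInService]
  congr 1
  · rw [← Set.ncard_coe_finset]; congr 1; ext i; simp
  · rw [← Set.ncard_coe_finset]; congr 1; ext j
    have h2 := le_iff_lt_countLE (monotone_startTime (r := r) (s := s) hn harr)
      (tendsto_startTime hn hlim) t j
    simp only [Set.mem_ofPred_eq, Finset.coe_filter, Finset.mem_range, pathStarted, h2]

lemma residual_le {K : ℕ} (hs : ∀ j, s j ≤ K) {t : ℝ} {j : ℕ} (hj : startTime n r arr s j ≤ t) :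
    startTime n r arr s j + s j - t ≤ K := by
  have : (s j : ℝ) ≤ K := by exact_mod_cast hs j
  linarith

lemma pathInService_eq_zero {K : ℕ} (hr : ∀ i, r i ≤ K)
    (hs : ∀ j, s j ≤ K) {t : ℝ} (ht : 0 ≤ t) {k : ℕ} (hk : K ≤ k) :
    pathInService n r arr s t k = 0 := by
  have hk' : (K : ℝ) ≤ k := by exact_mod_cast hk
  have e1 : {i : Fin n | r i - t ∈ Ioc (k : ℝ) (k + 1)} = ∅ := by
    ext i
    simp only [Set.mem_ofPred_eq, Set.mem_empty_iff_false, iff_false]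
    exact fun h => by linarith [h.1, hr i]
  have e2 : {j : ℕ | startTime n r arr s j ≤ t ∧
      startTime n r arr s j + s j - t ∈ Ioc (k : ℝ) (k + 1)} = ∅ := by
    ext j
    simp only [Set.mem_ofPred_eq, Set.mem_empty_iff_false, iff_false]
    exact fun h => by linarith [h.2.1, residual_le hs h.1]
  simp only [pathInService, e1, e2, Set.ncard_empty, add_zero]

/-- The number of busy servers at time `t`. -/
lemma sum_pathInService (hn : 0 < n) (harr : Monotone arr) (hlim : Tendsto arr atTop atTop)
    {K : ℕ} (hr : ∀ i, r i ≤ K) (hs : ∀ j, s j ≤ K) {t : ℝ} (ht : 0 ≤ t) :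
    ∑ k ∈ Finset.range K, pathInService n r arr s t k = {i : Fin n | t < r i}.ncard +
      ((Finset.range (pathStarted n r arr s t)).filter fun i =>
        t < startTime n r arr s i + s i).card := by
  classical
  have e1 : {i : Fin n | t < r i}.ncard = (Finset.univ.filter fun i => t < r i).card := by
    rw [← Set.ncard_coe_finset]; congr 1; ext i; simp
  simp only [pathInService_eq hn harr hlim, Finset.sum_add_distrib, e1]
  congr 1
  · simp only [Finset.card_filter]
    rw [Finset.sum_comm]
    refine Finset.sum_congr rfl fun i _ => ?_
    rw [sum_ite_mem_Ioc (by linarith [hr i])]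
    simp only [sub_pos]
  · simp only [Finset.card_filter]
    rw [Finset.sum_comm]
    refine Finset.sum_congr rfl fun j hj => ?_
    have h2 := (le_iff_lt_countLE (monotone_startTime (r := r) (s := s) hn harr)
      (tendsto_startTime hn hlim) t j).2 (Finset.mem_range.1 hj)
    rw [sum_ite_mem_Ioc (residual_le hs h2)]
    simp only [sub_pos]

lemma sum_pathInService_le (hn : 0 < n) (harr : Monotone arr) (hlim : Tendsto arr atTop atTop)
    {K : ℕ} (hr : ∀ i, r i ≤ K) (hs : ∀ j, s j ≤ K) {t : ℝ} (ht : 0 ≤ t) :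
    ∑ k ∈ Finset.range K, pathInService n r arr s t k ≤ n := by
  classical
  rw [sum_pathInService hn harr hlim hr hs ht]
  rcases Nat.eq_zero_or_pos (pathStarted n r arr s t) with h | h
  · rw [h]
    simpa using (Set.ncard_le_ncard (Set.subset_univ {i : Fin n | t < r i})).trans_eq
      (by simp [Set.ncard_univ])
  · obtain ⟨j, hj⟩ := Nat.exists_eq_succ_of_ne_zero h.ne'
    have h2 := (le_iff_lt_countLE (monotone_startTime (r := r) (s := s) hn harr)
      (tendsto_startTime hn hlim) t j).2 (by rw [pathStarted] at hj; omega)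
    have h3 := ((startTime_le_iff hn j t).1 h2).2
    rw [hj, Nat.succ_eq_add_one, Finset.range_add_one, Finset.filter_insert]
    split_ifs
    · rw [Finset.card_insert_of_notMem (by simp)]; omega
    · omega

/-- All servers are busy while customers wait. -/
lemma sum_pathInService_eq (hn : 0 < n) (harr : Monotone arr) (hlim : Tendsto arr atTop atTop)
    {K : ℕ} (hr : ∀ i, r i ≤ K) (hs : ∀ j, s j ≤ K) {t : ℝ} (ht : 0 ≤ t)
    (hq : 0 < pathQueue n r arr s t) :
    ∑ k ∈ Finset.range K, pathInService n r arr s t k = n := by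
  refine le_antisymm (sum_pathInService_le hn harr hlim hr hs ht) ?_
  rw [sum_pathInService hn harr hlim hr hs ht]
  have h1 := pathQueue_add_started (r := r) (s := s) hn harr hlim t
  by_contra h
  have h2 := (startTime_le_iff (r := r) (arr := arr) (s := s) hn (pathStarted n r arr s t) t).2
    ⟨(le_iff_lt_countLE harr hlim t _).2 (by omega), not_le.1 h⟩
  exact lt_irrefl _ ((le_iff_lt_countLE (monotone_startTime (r := r) (s := s) hn harr)
      (tendsto_startTime hn hlim) t _).1 h2)

/-- After one unit of time each residual time has moved down by one class, and every customer that
has entered service in between is still in service. -/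
lemma pathInService_succ (hn : 0 < n) (harr : Monotone arr) (hlim : Tendsto arr atTop atTop)
    (t : ℝ) (k : ℕ) :
    pathInService n r arr s (t + 1) k = pathInService n r arr s t (k + 1) +
      ((Finset.Ico (pathStarted n r arr s t) (pathStarted n r arr s (t + 1))).filter fun j =>
        s j = k + 1).card := by
  classical
  have hle : pathStarted n r arr s t ≤ pathStarted n r arr s (t + 1) :=
    countLE_mono (tendsto_startTime hn hlim) (by linarith)
  have key : ∀ x : ℝ, x - (t + 1) ∈ Ioc (k : ℝ) (k + 1) ↔
      x - t ∈ Ioc ((k + 1 : ℕ) : ℝ) ((k + 1 : ℕ) + 1) := by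
    intro x
    push_cast
    constructor <;> rintro ⟨h1, h2⟩ <;> constructor <;> linarith
  rw [pathInService_eq hn harr hlim, pathInService_eq hn harr hlim, add_assoc]
  simp only [← key]
  congr 1
  rw [Finset.range_eq_Ico, Finset.range_eq_Ico, ← Finset.Ico_union_Ico_eq_Ico (Nat.zero_le _) hle,
    Finset.filter_union, Finset.card_union_of_disjoint
      (Finset.disjoint_filter_filter (Finset.Ico_disjoint_Ico_consecutive _ _ _))]
  congr 2
  refine Finset.filter_congr fun j hj => ?_
  rw [Finset.mem_Ico] at hj
  have hiff := fun u => le_iff_lt_countLE (monotone_startTime (r := r) (s := s) hn harr)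
    (tendsto_startTime hn hlim) u j
  have h1 : t < startTime n r arr s j := by
    rw [← not_le, hiff]; exact not_lt.2 hj.1
  have h2 : startTime n r arr s j ≤ t + 1 := (hiff _).2 hj.2
  constructor
  · rintro ⟨h3, h4⟩
    have a1 : (k : ℝ) < s j := by linarith
    have a2 : (s j : ℝ) < k + 2 := by linarith
    have a1' : k < s j := by exact_mod_cast a1
    have a2' : s j < k + 2 := by exact_mod_cast a2
    omega
  · intro h
    rw [h]
    push_cast
    constructor <;> linarith

/-- At most `n` customers enter service in a unit of time. -/
lemma pathStarted_succ_le (hn : 0 < n) (harr : Monotone arr) (hlim : Tendsto arr atTop atTop)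
    {K : ℕ} (hr : ∀ i, r i ≤ K) (hs1 : ∀ j, 1 ≤ s j) (hs : ∀ j, s j ≤ K) {t : ℝ} (ht : 0 ≤ t) :
    pathStarted n r arr s (t + 1) ≤ pathStarted n r arr s t + n := by
  classical
  have h := sum_pathInService_le (t := t + 1) hn harr hlim hr hs (by linarith)
  simp only [pathInService_succ hn harr hlim t, Finset.sum_add_distrib] at h
  have h2 : (Finset.Ico (pathStarted n r arr s t) (pathStarted n r arr s (t + 1))).card =
      ∑ k ∈ Finset.range K, ((Finset.Ico (pathStarted n r arr s t)
        (pathStarted n r arr s (t + 1))).filter fun j => s j = k + 1).card := by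
    rw [Finset.card_eq_sum_card_fiberwise (f := fun j => s j - 1) (t := Finset.range K)]
    · refine Finset.sum_congr rfl fun k _ => ?_
      congr 1
      refine Finset.filter_congr fun j _ => ?_
      have := hs1 j
      omega
    · intro j _
      have := hs1 j
      have := hs j
      simp only [Finset.coe_range, Set.mem_Iio]
      omega
  rw [Nat.card_Ico] at h2
  omega

end Dynamics

/-! ### The residual-time chain -/

/-- The properties of a service law `k ↦ pr k` on `{1, …, K}` on which the contraction rests. -/
structure LatticeWeights (pr : ℕ → ℝ) (K : ℕ) : Prop where
  nonneg : ∀ k, 0 ≤ pr k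
  zero : pr 0 = 0
  above : ∀ k, K < k → pr k = 0
  sum_eq_one : ∑ k ∈ Finset.range K, pr (k + 1) = 1
  gcd_eq_one : ∀ d : ℕ, (∀ i, pr i ≠ 0 → d ∣ i) → d = 1

/-- The `ℓ¹` norm of the first `K` coordinates. -/
def l1 (K : ℕ) (v : ℕ → ℝ) : ℝ := ∑ k ∈ Finset.range K, |v k|

lemma l1_nonneg (K : ℕ) (v : ℕ → ℝ) : 0 ≤ l1 K v := Finset.sum_nonneg fun _ _ => abs_nonneg _

lemma abs_sum_le_l1 (K : ℕ) (v : ℕ → ℝ) : |∑ k ∈ Finset.range K, v k| ≤ l1 K v :=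
  Finset.abs_sum_le_sum_abs _ _

lemma l1_add_le (K : ℕ) (v w : ℕ → ℝ) : l1 K (v + w) ≤ l1 K v + l1 K w := by
  rw [l1, l1, l1, ← Finset.sum_add_distrib]
  exact Finset.sum_le_sum fun k _ => abs_add_le _ _

/-- The transition operator, acting on (signed) measures, of the residual service time of a server
that is always busy: residual class `k + 1` becomes `k`, and a server of class `0` takes a new
customer. Residual classes are counted from `0`. -/
def residualStep (pr : ℕ → ℝ) : (ℕ → ℝ) →ₗ[ℝ] (ℕ → ℝ) where
  toFun v := fun k => v (k + 1) + pr (k + 1) * v 0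
  map_add' v w := by ext k; simp only [Pi.add_apply]; ring
  map_smul' c v := by ext k; simp only [Pi.smul_apply, smul_eq_mul, RingHom.id_apply]; ring

lemma residualStep_apply (pr v : ℕ → ℝ) (k : ℕ) :
    residualStep pr v k = v (k + 1) + pr (k + 1) * v 0 := rfl

lemma sum_range_shift {K : ℕ} {v : ℕ → ℝ} (hv : v K = 0) :
    ∑ k ∈ Finset.range K, v (k + 1) = ∑ k ∈ Finset.range K, v k - v 0 := by
  have h1 := Finset.sum_range_succ v K
  have h2 := Finset.sum_range_succ' v K
  linarith

section Residual

variable {pr : ℕ → ℝ} {K : ℕ}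

lemma residualStep_eq_zero (hpr : LatticeWeights pr K) {v : ℕ → ℝ} (hv : ∀ k, K ≤ k → v k = 0)
    (k : ℕ) (hk : K ≤ k) :
    residualStep pr v k = 0 := by
  rw [residualStep_apply, hv _ (by omega), hpr.above _ (by omega)]; ring

lemma sum_residualStep (hpr : LatticeWeights pr K) {v : ℕ → ℝ} (hv : ∀ k, K ≤ k → v k = 0) :
    ∑ k ∈ Finset.range K, residualStep pr v k = ∑ k ∈ Finset.range K, v k := by
  simp only [residualStep_apply, Finset.sum_add_distrib, ← Finset.sum_mul, hpr.sum_eq_one,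
    sum_range_shift (hv K le_rfl)]
  ring

lemma l1_residualStep_le (hpr : LatticeWeights pr K) {v : ℕ → ℝ} (hv : ∀ k, K ≤ k → v k = 0) :
    l1 K (residualStep pr v) ≤ l1 K v := by
  have h : ∀ k ∈ Finset.range K, |residualStep pr v k| ≤ |v (k + 1)| + pr (k + 1) * |v 0| := by
    intro k _
    rw [residualStep_apply]
    refine (abs_add_le _ _).trans_eq ?_
    rw [abs_mul, abs_of_nonneg (hpr.nonneg _)]
  refine (Finset.sum_le_sum h).trans_eq ?_
  rw [Finset.sum_add_distrib, ← Finset.sum_mul, hpr.sum_eq_one,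
    sum_range_shift (v := fun k => |v k|) (by simp [hv K le_rfl]), l1]
  ring

lemma pow_residualStep_eq_zero (hpr : LatticeWeights pr K) {v : ℕ → ℝ} (hv : ∀ k, K ≤ k → v k = 0)
    (N : ℕ) :
    ∀ k, K ≤ k → (residualStep pr ^ N) v k = 0 := by
  induction N with
  | zero => simpa using hv
  | succ N ih =>
    rw [pow_succ']
    exact fun k hk => residualStep_eq_zero hpr ih k hk

lemma sum_pow_residualStep (hpr : LatticeWeights pr K) {v : ℕ → ℝ} (hv : ∀ k, K ≤ k → v k = 0)
    (N : ℕ) :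
    ∑ k ∈ Finset.range K, (residualStep pr ^ N) v k = ∑ k ∈ Finset.range K, v k := by
  induction N with
  | zero => simp
  | succ N ih =>
    rw [pow_succ', Module.End.mul_apply, sum_residualStep hpr (pow_residualStep_eq_zero hpr hv N), ih]

lemma pow_residualStep_nonneg (hpr : LatticeWeights pr K) {v : ℕ → ℝ} (hv : ∀ k, 0 ≤ v k) (N : ℕ) :
    ∀ k, 0 ≤ (residualStep pr ^ N) v k := by
  induction N with
  | zero => simpa using hv
  | succ N ih =>
    rw [pow_succ']
    exact fun k => add_nonneg (ih _) (mul_nonneg (hpr.nonneg _) (ih _))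

/-- The probability that the residual-time chain started from class `0` is in class `0` at
time `N`. -/
def renewalMass (pr : ℕ → ℝ) (N : ℕ) : ℝ := (residualStep pr ^ N) (Pi.single 0 1) 0

lemma single_nonneg (j : ℕ) (k : ℕ) : 0 ≤ (Pi.single j 1 : ℕ → ℝ) k := by
  by_cases h : k = j
  · subst h; simp
  · simp [h]

lemma mul_renewalMass_le (hpr : LatticeWeights pr K) {v : ℕ → ℝ} (hv : ∀ k, 0 ≤ v k) (N : ℕ) :
    v 0 * renewalMass pr N ≤ (residualStep pr ^ N) v 0 := by
  have h : ∀ k, 0 ≤ (v - v 0 • (Pi.single 0 1 : ℕ → ℝ)) k := by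
    intro k
    rcases Nat.eq_zero_or_pos k with rfl | hk
    · simp
    · simp [Pi.single_eq_of_ne hk.ne', hv k]
  have := pow_residualStep_nonneg hpr h N 0
  rw [map_sub, map_smul] at this
  simpa [renewalMass] using this

lemma le_pow_residualStep (hpr : LatticeWeights pr K) {v : ℕ → ℝ} (hv : ∀ k, 0 ≤ v k) (i : ℕ) :
    v i ≤ (residualStep pr ^ i) v 0 := by
  induction i generalizing v with
  | zero => simp
  | succ i ih =>
    have h0 : ∀ k, 0 ≤ residualStep pr v k := by
      simpa using pow_residualStep_nonneg hpr hv 1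
    rw [pow_succ, Module.End.mul_apply]
    refine le_trans ?_ (ih h0)
    rw [residualStep_apply]
    have := mul_nonneg (hpr.nonneg (i + 1)) (hv 0)
    linarith

/-- Doeblin's condition: since the possible service times have greatest common divisor `1`, at some
time `N` every class leads to class `0` with probability bounded below. -/
lemma exists_doeblin (hpr : LatticeWeights pr K) : ∃ N : ℕ, K ≤ N ∧ ∃ ε : ℝ, 0 < ε ∧ ε ≤ 1 ∧
    ∀ j < K, ε ≤ (residualStep pr ^ N) (Pi.single j 1) 0 := by
  -- The renewal times of positive probability form a numerical semigroup, which contains all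
  -- large integers.
  let G : AddSubmonoid ℕ :=
    { carrier := {N | 0 < renewalMass pr N}
      zero_mem' := by simp [renewalMass]
      add_mem' := by
        intro a b ha hb
        have := mul_renewalMass_le hpr (pow_residualStep_nonneg hpr (single_nonneg 0) b) a
        rw [← Module.End.mul_apply, ← pow_add] at this
        exact lt_of_lt_of_le (mul_pos hb ha) this }
  have hG : AddSubmonoid.closure {i | pr i ≠ 0} ≤ G := by
    rw [AddSubmonoid.closure_le]
    intro i hi
    obtain _ | i := i
    · exact absurd hpr.zero hi
    · change 0 < renewalMass pr (i + 1)
      have h0 := pow_residualStep_nonneg hpr (single_nonneg 0) 1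
      have := le_pow_residualStep hpr h0 i
      rw [pow_one, residualStep_apply, ← Module.End.mul_apply, ← pow_succ] at this
      refine lt_of_lt_of_le ?_ this
      simpa using lt_of_le_of_ne (hpr.nonneg _) (Ne.symm hi)
  have hgcd : Nat.setGcd {i | pr i ≠ 0} = 1 :=
    hpr.gcd_eq_one _ fun i hi => Nat.setGcd_dvd_of_mem hi
  obtain ⟨N₀, hN₀⟩ := Nat.exists_mem_closure_of_ge {i | pr i ≠ 0}
  have hpos : ∀ N ≥ N₀, 0 < renewalMass pr N := fun N hN => hG (hN₀ N hN (by simp [hgcd]))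
  have hK : 0 < K := by
    rcases Nat.eq_zero_or_pos K with h | h
    · have := hpr.sum_eq_one; simp [h] at this
    · exact h
  -- Class `j` descends to class `0` in `j` steps, which leaves at least `N₀` steps for a renewal.
  have hj : ∀ j < K, 0 < (residualStep pr ^ (N₀ + K)) (Pi.single j 1) 0 := by
    intro j hj
    have h1 := le_pow_residualStep hpr (single_nonneg j) j
    have h2 := mul_renewalMass_le hpr (pow_residualStep_nonneg hpr (single_nonneg j) j)
      (N₀ + K - j)
    rw [← Module.End.mul_apply, ← pow_add, Nat.sub_add_cancel (by omega)] at h2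
    rw [Pi.single_eq_same] at h1
    exact lt_of_lt_of_le (mul_pos (by linarith) (hpos _ (by omega))) h2
  obtain ⟨j₀, hj₀, hmin⟩ := Finset.exists_min_image (Finset.range K)
    (fun j => (residualStep pr ^ (N₀ + K)) (Pi.single j 1) 0) ⟨0, by simpa using hK⟩
  refine ⟨N₀ + K, by omega, min 1 ((residualStep pr ^ (N₀ + K)) (Pi.single j₀ 1) 0),
    lt_min one_pos (hj _ (Finset.mem_range.1 hj₀)), min_le_left _ _, fun j hj => ?_⟩
  exact (min_le_right _ _).trans (hmin j (Finset.mem_range.2 hj))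

/-- Doeblin's condition contracts the part of a signed measure that has total mass zero. -/
lemma l1_pow_residualStep_le (hpr : LatticeWeights pr K) {N : ℕ} {ε : ℝ} (hε : 0 < ε)
    (hN : ∀ j < K, ε ≤ (residualStep pr ^ N) (Pi.single j 1) 0)
    {v : ℕ → ℝ} (hv : ∀ k, K ≤ k → v k = 0) :
    l1 K ((residualStep pr ^ N) v) ≤ (1 - ε) * l1 K v + ε * |∑ k ∈ Finset.range K, v k| := by
  classical
  set c : ℕ → ℕ → ℝ := fun j => (residualStep pr ^ N) (Pi.single j 1) with hc
  have hdec : v = ∑ j ∈ Finset.range K, v j • (Pi.single j 1 : ℕ → ℝ) := by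
    ext k
    simp only [Finset.sum_apply, Pi.smul_apply, smul_eq_mul, Pi.single_apply, mul_ite, mul_one,
      mul_zero, Finset.sum_ite_eq, Finset.mem_range]
    split_ifs with h
    · rfl
    · exact hv k (not_lt.1 h)
  have happ : ∀ k, (residualStep pr ^ N) v k = ∑ j ∈ Finset.range K, v j * c j k := by
    intro k
    conv_lhs => rw [hdec]
    simp [map_sum, Finset.sum_apply, hc]
  have hcnn : ∀ j k, 0 ≤ c j k := fun j => pow_residualStep_nonneg hpr (single_nonneg j) N
  have hcsum : ∀ j < K, ∑ k ∈ Finset.range K, c j k = 1 := by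
    intro j hj
    rw [hc]
    dsimp only
    rw [sum_pow_residualStep hpr]
    · simp [Pi.single_apply, hj]
    · intro k hk
      rw [Pi.single_eq_of_ne (by omega)]
  -- Subtracting the common part `ε δ₀` of all rows leaves a nonnegative kernel of mass `1 - ε`.
  have hbound : ∀ k ∈ Finset.range K, |(residualStep pr ^ N) v k| ≤
      ∑ j ∈ Finset.range K, |v j| * (c j k - if k = 0 then ε else 0) +
        (if k = 0 then ε else 0) * |∑ j ∈ Finset.range K, v j| := by
    intro k _
    set e : ℝ := if k = 0 then ε else 0 with he
    have he0 : 0 ≤ e := by rw [he]; split_ifs <;> linarith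
    have h1 : (residualStep pr ^ N) v k = ∑ j ∈ Finset.range K, v j * (c j k - e) +
        e * ∑ j ∈ Finset.range K, v j := by
      rw [happ, Finset.mul_sum, ← Finset.sum_add_distrib]
      exact Finset.sum_congr rfl fun j _ => by ring
    rw [h1]
    refine (abs_add_le _ _).trans (add_le_add ((Finset.abs_sum_le_sum_abs _ _).trans_eq
      (Finset.sum_congr rfl fun j hj => ?_)) (by rw [abs_mul, abs_of_nonneg he0]))
    rw [abs_mul]
    congr 1
    refine abs_of_nonneg ?_
    rw [he]
    split_ifs with h
    · subst h; linarith [hN j (Finset.mem_range.1 hj)]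
    · linarith [hcnn j k]
  by_cases hK : K = 0
  · subst hK; simp [l1]
  have hK' : 0 < K := Nat.pos_of_ne_zero hK
  have he : ∑ k ∈ Finset.range K, (if k = 0 then ε else 0) = ε := by
    simp [hK']
  refine (Finset.sum_le_sum hbound).trans_eq ?_
  rw [Finset.sum_add_distrib, ← Finset.sum_mul, he, Finset.sum_comm]
  congr 1
  simp only [← Finset.mul_sum, Finset.sum_sub_distrib, he]
  rw [l1, Finset.mul_sum]
  refine Finset.sum_congr rfl fun j hj => ?_
  rw [hcsum j (Finset.mem_range.1 hj)]
  ring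

end Residual

/-! ### Contraction of the scaled service profile -/

/-- A path of the queue at integer times, centered and scaled: `q` is the queue length, `l t k` the
deviation of the number of customers with residual time in `(k, k + 1]`, `a` the deviation of the
number of arrivals, `b` that of the number of customers entering service, and `ξ t k` the deviation
of the number of those among them whose service time is `k + 1`. -/
structure ScaledPath (K : ℕ) (pr : ℕ → ℝ) (q : ℕ → ℝ) (l : ℕ → ℕ → ℝ) (a b : ℕ → ℝ)
    (ξ : ℕ → ℕ → ℝ) : Prop where
  q_nonneg : ∀ t, 0 ≤ q t
  sum_nonpos : ∀ t, ∑ k ∈ Finset.range K, l t k ≤ 0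
  compl : ∀ t, q t = 0 ∨ ∑ k ∈ Finset.range K, l t k = 0
  q_succ : ∀ t, q (t + 1) = q t + a t - b t
  l_succ : ∀ t k, l (t + 1) k = l t (k + 1) + pr (k + 1) * b t + ξ t k
  l_above : ∀ t k, K ≤ k → l t k = 0
  sum_noise : ∀ t, ∑ k ∈ Finset.range K, ξ t k = 0

namespace ScaledPath

variable {K : ℕ} {pr q : ℕ → ℝ} {l : ℕ → ℕ → ℝ} {a b : ℕ → ℝ} {ξ : ℕ → ℕ → ℝ}

lemma sum_succ (h : ScaledPath K pr q l a b ξ) (hpr : LatticeWeights pr K) (t : ℕ) :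
    ∑ k ∈ Finset.range K, l (t + 1) k = ∑ k ∈ Finset.range K, l t k - l t 0 + b t := by
  simp only [h.l_succ, Finset.sum_add_distrib, ← Finset.sum_mul, hpr.sum_eq_one, h.sum_noise,
    sum_range_shift (h.l_above t K le_rfl)]
  ring

/-- The loss of total mass in one step of the noiseless dynamics: the difference between the
deviation of the departures and that of the entries into service. -/
def loss (K : ℕ) (q : ℕ → ℝ) (l : ℕ → ℕ → ℝ) (t : ℕ) : ℝ :=
  |l t 0 - min (q t) (l t 0 - ∑ k ∈ Finset.range K, l t k)|

/-- The size of the noise in one step. -/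
def err (K : ℕ) (a : ℕ → ℝ) (ξ : ℕ → ℕ → ℝ) (t : ℕ) : ℝ := |a t| + l1 K (ξ t)

lemma err_nonneg (t : ℕ) : 0 ≤ err K a ξ t := add_nonneg (abs_nonneg _) (l1_nonneg _ _)

lemma loss_nonneg (t : ℕ) : 0 ≤ loss K q l t := abs_nonneg _

/-- The noiseless number of entries has the sign of the departures and is smaller in size. -/
lemma loss_eq (h : ScaledPath K pr q l a b ξ) (t : ℕ) :
    loss K q l t = |l t 0| - |min (q t) (l t 0 - ∑ k ∈ Finset.range K, l t k)| := by
  have h1 := h.q_nonneg t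
  have h2 := h.sum_nonpos t
  rw [loss]
  rcases h.compl t with h3 | h3
  · rw [h3]
    rcases le_total 0 (l t 0 - ∑ k ∈ Finset.range K, l t k) with h4 | h4
    · rw [min_eq_left h4]; simp
    · rw [min_eq_right h4, abs_of_nonpos h4, abs_of_nonpos (by linarith : l t 0 ≤ 0),
        abs_of_nonpos (by linarith)]
      ring
  · rw [h3, sub_zero]
    rcases le_total (q t) (l t 0) with h4 | h4
    · rw [min_eq_left h4, abs_of_nonneg h1, abs_of_nonneg (h1.trans h4),
        abs_of_nonneg (by linarith)]
    · rw [min_eq_right h4]; simp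

lemma b_eq (h : ScaledPath K pr q l a b ξ) (hpr : LatticeWeights pr K) (t : ℕ) :
    b t = min (q t + a t) (l t 0 - ∑ k ∈ Finset.range K, l t k) := by
  have h1 := h.q_nonneg (t + 1)
  have h2 := h.sum_nonpos (t + 1)
  have h3 := h.q_succ t
  have h4 := h.sum_succ hpr t
  refine le_antisymm (le_min (by linarith) (by linarith)) ?_
  rcases h.compl (t + 1) with h5 | h5
  · exact (min_le_left _ _).trans (by linarith)
  · exact (min_le_right _ _).trans (by linarith)

lemma abs_b_sub_le (h : ScaledPath K pr q l a b ξ) (hpr : LatticeWeights pr K) (t : ℕ) :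
    |b t - min (q t) (l t 0 - ∑ k ∈ Finset.range K, l t k)| ≤ |a t| := by
  rw [h.b_eq hpr]
  refine (abs_min_sub_min_le_max _ _ _ _).trans ?_
  simp

lemma abs_b_sub_departure_le (h : ScaledPath K pr q l a b ξ) (hpr : LatticeWeights pr K) (t : ℕ) :
    |b t - l t 0| ≤ loss K q l t + |a t| := by
  have h1 := h.abs_b_sub_le hpr t
  have h2 := abs_sub_le (b t) (min (q t) (l t 0 - ∑ k ∈ Finset.range K, l t k)) (l t 0)
  rw [loss, abs_sub_comm (l t 0)]
  linarith

lemma l1_succ_le (h : ScaledPath K pr q l a b ξ) (hpr : LatticeWeights pr K) (t : ℕ) :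
    l1 K (l (t + 1)) ≤ l1 K (l t) - loss K q l t + err K a ξ t := by
  have h1 := h.abs_b_sub_le hpr t
  have h2 := abs_sub_abs_le_abs_sub (b t) (min (q t) (l t 0 - ∑ k ∈ Finset.range K, l t k))
  have h3 : ∀ k ∈ Finset.range K, |l (t + 1) k| ≤ |l t (k + 1)| + pr (k + 1) * |b t| + |ξ t k| := by
    intro k _
    rw [h.l_succ]
    refine (abs_add_three _ _ _).trans_eq ?_
    rw [abs_mul, abs_of_nonneg (hpr.nonneg _)]
  have h4 : l1 K (l (t + 1)) ≤ l1 K (l t) - |l t 0| + |b t| + l1 K (ξ t) := by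
    refine (Finset.sum_le_sum h3).trans_eq ?_
    rw [Finset.sum_add_distrib, Finset.sum_add_distrib, ← Finset.sum_mul, hpr.sum_eq_one,
      sum_range_shift (v := fun k => |l t k|) (by simp [h.l_above t K le_rfl]), l1, l1, one_mul]
  rw [h.loss_eq, err]
  linarith

lemma l1_sub_residualStep_le (h : ScaledPath K pr q l a b ξ) (hpr : LatticeWeights pr K) (t : ℕ) :
    l1 K (l (t + 1) - residualStep pr (l t)) ≤ loss K q l t + err K a ξ t := by
  have h1 := h.abs_b_sub_departure_le hpr t
  have h3 : ∀ k ∈ Finset.range K, |(l (t + 1) - residualStep pr (l t)) k| ≤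
      pr (k + 1) * |b t - l t 0| + |ξ t k| := by
    intro k _
    rw [Pi.sub_apply, h.l_succ, residualStep_apply]
    have : l t (k + 1) + pr (k + 1) * b t + ξ t k - (l t (k + 1) + pr (k + 1) * l t 0) =
      pr (k + 1) * (b t - l t 0) + ξ t k := by ring
    rw [this]
    refine (abs_add_le _ _).trans_eq ?_
    rw [abs_mul, abs_of_nonneg (hpr.nonneg _)]
  have h4 : l1 K (l (t + 1) - residualStep pr (l t)) ≤ |b t - l t 0| + l1 K (ξ t) := by
    refine (Finset.sum_le_sum h3).trans_eq ?_
    rw [Finset.sum_add_distrib, ← Finset.sum_mul, hpr.sum_eq_one, one_mul, l1]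
  rw [err]
  linarith

lemma l1_le (h : ScaledPath K pr q l a b ξ) (hpr : LatticeWeights pr K) (t N : ℕ) :
    l1 K (l (t + N)) ≤ l1 K (l t) - ∑ i ∈ Finset.range N, loss K q l (t + i) +
      ∑ i ∈ Finset.range N, err K a ξ (t + i) := by
  induction N with
  | zero => simp
  | succ N ih =>
    rw [Finset.sum_range_succ, Finset.sum_range_succ, ← add_assoc]
    linarith [h.l1_succ_le hpr (t + N)]

lemma l1_sub_pow_residualStep_le (h : ScaledPath K pr q l a b ξ) (hpr : LatticeWeights pr K)
    (t N : ℕ) : l1 K (l (t + N) - (residualStep pr ^ N) (l t)) ≤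
      ∑ i ∈ Finset.range N, loss K q l (t + i) + ∑ i ∈ Finset.range N, err K a ξ (t + i) := by
  induction N with
  | zero => simp [l1]
  | succ N ih =>
    have hz : ∀ k, K ≤ k → (l (t + N) - (residualStep pr ^ N) (l t)) k = 0 := by
      intro k hk
      rw [Pi.sub_apply, h.l_above _ _ hk, pow_residualStep_eq_zero hpr (h.l_above t) N k hk,
        sub_zero]
    have e : l (t + (N + 1)) - (residualStep pr ^ (N + 1)) (l t) =
        (l (t + N + 1) - residualStep pr (l (t + N))) +
          residualStep pr (l (t + N) - (residualStep pr ^ N) (l t)) := by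
      rw [map_sub, pow_succ', Module.End.mul_apply, ← add_assoc]
      abel
    rw [e, Finset.sum_range_succ, Finset.sum_range_succ]
    linarith [l1_add_le K (l (t + N + 1) - residualStep pr (l (t + N)))
      (residualStep pr (l (t + N) - (residualStep pr ^ N) (l t))),
      h.l1_sub_residualStep_le hpr (t + N), l1_residualStep_le hpr hz]

/-- A deficit of busy servers disappears only through loss or noise. -/
lemma abs_sum_le (h : ScaledPath K pr q l a b ξ) (hpr : LatticeWeights pr K) (t N : ℕ) :
    |∑ k ∈ Finset.range K, l t k| ≤ |∑ k ∈ Finset.range K, l (t + N) k| +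
      ∑ i ∈ Finset.range N, loss K q l (t + i) + ∑ i ∈ Finset.range N, err K a ξ (t + i) := by
  induction N with
  | zero => simp
  | succ N ih =>
    have h1 := h.abs_b_sub_departure_le hpr (t + N)
    have h2 := h.sum_succ hpr (t + N)
    have h3 : |∑ k ∈ Finset.range K, l (t + N) k| ≤ |∑ k ∈ Finset.range K, l (t + N + 1) k| +
        |b (t + N) - l (t + N) 0| := by
      have : ∑ k ∈ Finset.range K, l (t + N) k = ∑ k ∈ Finset.range K, l (t + N + 1) k -
        (b (t + N) - l (t + N) 0) := by linarith
      rw [this]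
      exact abs_sub _ _
    have h4 : |a (t + N)| ≤ err K a ξ (t + N) := le_add_of_nonneg_right (l1_nonneg _ _)
    rw [Finset.sum_range_succ, Finset.sum_range_succ, ← add_assoc t N 1]
    linarith

/-- While some servers idle, the service profile is merely shifted. -/
lemma sum_abs_sub_shift_le (h : ScaledPath K pr q l a b ξ) (hpr : LatticeWeights pr K) (t N : ℕ)
    (hneg : ∀ i ≤ N, ∑ k ∈ Finset.range K, l (t + i) k ≠ 0) :
    ∑ k ∈ Finset.range K, |l (t + N) k - l t (k + N)| ≤
      ∑ i ∈ Finset.range N, err K a ξ (t + i) := by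
  induction N with
  | zero => simp
  | succ N ih =>
    have ih := ih fun i hi => hneg i (by omega)
    have hq : q (t + N) = 0 := (h.compl _).resolve_right (hneg N (by omega))
    have hq' : q (t + N + 1) = 0 := (h.compl _).resolve_right (hneg (N + 1) le_rfl)
    have hb : b (t + N) = a (t + N) := by linarith [h.q_succ (t + N)]
    have h3 : ∀ k ∈ Finset.range K, |l (t + (N + 1)) k - l t (k + (N + 1))| ≤
        |l (t + N) (k + 1) - l t (k + 1 + N)| + pr (k + 1) * |a (t + N)| + |ξ (t + N) k| := by
      intro k _
      rw [← add_assoc, h.l_succ, hb, add_right_comm k 1 N, ← add_assoc k N 1]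
      have : l (t + N) (k + 1) + pr (k + 1) * a (t + N) + ξ (t + N) k - l t (k + N + 1) =
        (l (t + N) (k + 1) - l t (k + N + 1)) + pr (k + 1) * a (t + N) + ξ (t + N) k := by ring
      rw [this]
      refine (abs_add_three _ _ _).trans_eq ?_
      rw [abs_mul, abs_of_nonneg (hpr.nonneg _)]
    refine (Finset.sum_le_sum h3).trans ?_
    rw [Finset.sum_add_distrib, Finset.sum_add_distrib, ← Finset.sum_mul, hpr.sum_eq_one, one_mul,
      sum_range_shift (v := fun k => |l (t + N) k - l t (k + N)|)
        (by simp [h.l_above _ K le_rfl, h.l_above t (K + N) (by omega)]),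
      Finset.sum_range_succ, err, l1]
    linarith [abs_nonneg (l (t + N) 0 - l t (0 + N))]

/-- Contraction of the service profile up to noise. With `D` the total loss, `‖l_N‖` is at most
`‖l_0‖ - D` and at most `(1 - ε) ‖l_0‖ + ε |∑ l_0| + D`, and `|∑ l_0|` is at most `D` unless servers
idle throughout, in which case `l_0` is forgotten. -/
lemma exists_contraction (hpr : LatticeWeights pr K) : ∃ N : ℕ, ∃ δ : ℝ, 0 < δ ∧ δ < 1 ∧
    ∀ {q : ℕ → ℝ} {l : ℕ → ℕ → ℝ} {a b : ℕ → ℝ} {ξ : ℕ → ℕ → ℝ}, ScaledPath K pr q l a b ξ →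
      ∀ t, l1 K (l (t + N)) ≤ (1 - δ) * l1 K (l t) +
        2 * ∑ i ∈ Finset.range N, err K a ξ (t + i) := by
  obtain ⟨N, hKN, ε, hε, hε1, hN⟩ := exists_doeblin hpr
  refine ⟨N, ε / (2 + ε), by positivity, by rw [div_lt_one] <;> linarith, fun {q l a b ξ} h t => ?_⟩
  set E := ∑ i ∈ Finset.range N, err K a ξ (t + i) with hE
  set D := ∑ i ∈ Finset.range N, loss K q l (t + i) with hD
  have hE0 : 0 ≤ E := Finset.sum_nonneg fun i _ => err_nonneg _
  have h1 := h.l1_le hpr t N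
  rw [← hE, ← hD] at h1
  have hn0 := l1_nonneg K (l t)
  have hδ : ε / (2 + ε) < 1 := by rw [div_lt_one] <;> linarith
  -- Whether all servers are busy at one of the times `t, …, t + K`.
  by_cases hc : ∃ i ≤ K, ∑ k ∈ Finset.range K, l (t + i) k = 0
  · obtain ⟨i, hi, hi0⟩ := hc
    have h2 := h.abs_sum_le hpr t i
    rw [hi0, abs_zero, zero_add] at h2
    have hsub : Finset.range i ⊆ Finset.range N := Finset.range_subset_range.2 (by omega)
    have h3 : |∑ k ∈ Finset.range K, l t k| ≤ D + E := h2.trans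
      (add_le_add (Finset.sum_le_sum_of_subset_of_nonneg hsub fun i _ _ => loss_nonneg _)
        (Finset.sum_le_sum_of_subset_of_nonneg hsub fun i _ _ => err_nonneg _))
    have h4 := h.l1_sub_pow_residualStep_le hpr t N
    rw [← hE, ← hD] at h4
    have h5 := l1_pow_residualStep_le hpr hε hN (h.l_above t)
    have h6 := l1_add_le K (l (t + N) - (residualStep pr ^ N) (l t)) ((residualStep pr ^ N) (l t))
    rw [sub_add_cancel] at h6
    have h7 : l1 K (l (t + N)) ≤ (1 - ε) * l1 K (l t) + ε * (D + E) + (D + E) := by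
      have := mul_le_mul_of_nonneg_left h3 hε.le
      linarith
    -- The combination of `h1` and `h7` in which the total loss cancels; it gives `δ = ε / (2 + ε)`.
    have h8 : (2 + ε) * l1 K (l (t + N)) ≤ 2 * l1 K (l t) + (2 + 2 * ε) * E := by
      have := mul_le_mul_of_nonneg_left h1 (by linarith : 0 ≤ 1 + ε)
      linarith
    have h9 : 1 - ε / (2 + ε) = 2 / (2 + ε) := by field_simp; ring
    rw [h9, div_mul_eq_mul_div, ← sub_le_iff_le_add, le_div_iff₀ (by linarith)]
    have := mul_nonneg hε.le hE0
    linarith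
  · push Not at hc
    have h2 := h.sum_abs_sub_shift_le hpr t K hc
    have h3 : l1 K (l (t + K)) ≤ ∑ i ∈ Finset.range K, err K a ξ (t + i) := by
      refine le_trans (le_of_eq (Finset.sum_congr rfl fun k _ => ?_)) h2
      rw [h.l_above t (k + K) (by omega), sub_zero]
    have h4 := h.l1_le hpr (t + K) (N - K)
    have h5 : 0 ≤ ∑ i ∈ Finset.range (N - K), loss K q l (t + K + i) :=
      Finset.sum_nonneg fun i _ => loss_nonneg _
    have h6 : E = ∑ i ∈ Finset.range K, err K a ξ (t + i) +
        ∑ i ∈ Finset.range (N - K), err K a ξ (t + K + i) := by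
      rw [hE]
      conv_lhs => rw [← Nat.add_sub_cancel' hKN, Finset.sum_range_add]
      simp only [add_assoc]
    have h7 : t + K + (N - K) = t + N := by omega
    rw [h7] at h4
    have := mul_nonneg (by linarith : 0 ≤ 1 - ε / (2 + ε)) hn0
    linarith

/-! ### The workload bound on the queue -/

/-- The workload `m q + ∑ (k + 1) l_k` increases by `m a + ζ` and by the number of idle servers. -/
lemma workload_succ (h : ScaledPath K pr q l a b ξ) {m : ℝ}
    (hm : ∑ k ∈ Finset.range K, ((k : ℝ) + 1) * pr (k + 1) = m) (t : ℕ) :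
    m * q (t + 1) + ∑ k ∈ Finset.range K, ((k : ℝ) + 1) * l (t + 1) k =
      m * q t + ∑ k ∈ Finset.range K, ((k : ℝ) + 1) * l t k + m * a t
        - ∑ k ∈ Finset.range K, l t k + ∑ k ∈ Finset.range K, ((k : ℝ) + 1) * ξ t k := by
  have h1 : ∑ k ∈ Finset.range K, ((k : ℝ) + 1) * l (t + 1) k =
      ∑ k ∈ Finset.range K, ((k : ℝ) + 1) * l t (k + 1) + m * b t +
        ∑ k ∈ Finset.range K, ((k : ℝ) + 1) * ξ t k := by
    rw [← hm, Finset.sum_mul, ← Finset.sum_add_distrib, ← Finset.sum_add_distrib]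
    exact Finset.sum_congr rfl fun k _ => by rw [h.l_succ]; ring
  have h2 : ∑ k ∈ Finset.range K, ((k : ℝ) + 1) * l t (k + 1) =
      ∑ k ∈ Finset.range K, (k : ℝ) * l t k := by
    have := sum_range_shift (K := K) (v := fun k => (k : ℝ) * l t k) (by simp [h.l_above t K le_rfl])
    simpa using this
  have h3 : ∑ k ∈ Finset.range K, ((k : ℝ) + 1) * l t k =
      ∑ k ∈ Finset.range K, (k : ℝ) * l t k + ∑ k ∈ Finset.range K, l t k := by
    rw [← Finset.sum_add_distrib]
    exact Finset.sum_congr rfl fun k _ => by ring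
  rw [h1, h2, h3, h.q_succ]
  ring

lemma abs_weighted_sum_le (K : ℕ) (v : ℕ → ℝ) :
    |∑ k ∈ Finset.range K, ((k : ℝ) + 1) * v k| ≤ K * l1 K v := by
  rw [l1, Finset.mul_sum]
  refine (Finset.abs_sum_le_sum_abs _ _).trans (Finset.sum_le_sum fun k hk => ?_)
  rw [abs_mul, abs_of_nonneg (by positivity)]
  gcongr
  exact_mod_cast Finset.mem_range.1 hk

/-- The increment of the workload over `[τ, t)` that is due to arrivals and to service times. -/
def netInput (K : ℕ) (m : ℝ) (a : ℕ → ℝ) (ξ : ℕ → ℕ → ℝ) (τ t : ℕ) : ℝ :=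
  ∑ i ∈ Finset.Ico τ t, (m * a i + ∑ k ∈ Finset.range K, ((k : ℝ) + 1) * ξ i k)

/-- Going back to the last time `τ` at which the queue was empty, or to time `0`. -/
lemma exists_queue_le (h : ScaledPath K pr q l a b ξ) {m : ℝ}
    (hm : ∑ k ∈ Finset.range K, ((k : ℝ) + 1) * pr (k + 1) = m) (t : ℕ) :
    (∃ τ ≤ t, m * q t ≤ (K + 1) * l1 K (l τ) + K * l1 K (l t) + netInput K m a ξ τ t) ∨
      m * q t ≤ m * q 0 + (K + 1) * l1 K (l 0) + K * l1 K (l t) + netInput K m a ξ 0 t := by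
  have hw : ∀ s, |∑ k ∈ Finset.range K, ((k : ℝ) + 1) * l s k| ≤ K * l1 K (l s) := fun s =>
    abs_weighted_sum_le K (l s)
  have hsum : ∀ s, |∑ k ∈ Finset.range K, l s k| ≤ l1 K (l s) := fun s => abs_sum_le_l1 K (l s)
  -- The workload identity over an interval on which only the first time may see idle servers.
  have key : ∀ τ u, τ ≤ u → (∀ s, τ < s → s ≤ u → q s ≠ 0) →
      m * q u + ∑ k ∈ Finset.range K, ((k : ℝ) + 1) * l u k ≤
        m * q τ + ∑ k ∈ Finset.range K, ((k : ℝ) + 1) * l τ k + |∑ k ∈ Finset.range K, l τ k|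
          + netInput K m a ξ τ u := by
    intro τ u hu
    induction u, hu using Nat.le_induction with
    | base => intro _; simp [netInput]
    | succ u hu ih =>
      intro hpos
      have ih := ih fun s h1 h2 => hpos s h1 (by omega)
      have h1 := h.workload_succ hm u
      have h2 : netInput K m a ξ τ (u + 1) = netInput K m a ξ τ u +
          (m * a u + ∑ k ∈ Finset.range K, ((k : ℝ) + 1) * ξ u k) :=
        Finset.sum_Ico_succ_top hu _
      rcases hu.eq_or_lt with rfl | hlt
      · have h3 := neg_abs_le (∑ k ∈ Finset.range K, l τ k)
        have h4 : netInput K m a ξ τ τ = 0 := by simp [netInput]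
        linarith
      · have h3 := (h.compl u).resolve_left (hpos u hlt (by omega))
        linarith
  have fin : ∀ τ ≤ t, (∀ s, τ < s → s ≤ t → q s ≠ 0) → m * q t ≤ m * q τ + (K + 1) * l1 K (l τ) +
      K * l1 K (l t) + netInput K m a ξ τ t := by
    intro τ hτ hpos
    have h1 := key τ t hτ hpos
    linarith [le_abs_self (∑ k ∈ Finset.range K, ((k : ℝ) + 1) * l τ k), hw τ, hsum τ,
      neg_abs_le (∑ k ∈ Finset.range K, ((k : ℝ) + 1) * l t k), hw t]
  by_cases hz : ∃ τ, τ ≤ t ∧ q τ = 0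
  · left
    classical
    obtain ⟨τ₁, h₁, h₁'⟩ := hz
    set τ := Nat.findGreatest (fun s => q s = 0) t with hτ
    have hτ0 : q τ = 0 := Nat.findGreatest_spec (P := fun s => q s = 0) h₁ h₁'
    refine ⟨τ, Nat.findGreatest_le _, ?_⟩
    have := fin τ (Nat.findGreatest_le _) fun s h1 h2 =>
      Nat.findGreatest_is_greatest (P := fun s => q s = 0) h1 h2
    rw [hτ0] at this
    linarith
  · right
    push Not at hz
    exact fin 0 (Nat.zero_le _) fun s _ h2 => hz s h2

end ScaledPath

/-! ### The renewal arrival process -/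

/-- The time of arrival `k` when the first arrival and the following gaps are given by `w`. -/
noncomputable def epoch (w : ℝ × (ℕ → ℝ)) (k : ℕ) : ℝ := w.1 + ∑ i ∈ Finset.range k, w.2 i

/-- The arrivals after the first one. -/
def nextArrival (w : ℝ × (ℕ → ℝ)) : ℝ × (ℕ → ℝ) := (w.1 + w.2 0, fun i => w.2 (i + 1))

lemma epoch_zero (w : ℝ × (ℕ → ℝ)) : epoch w 0 = w.1 := by simp [epoch]

lemma epoch_nextArrival (w : ℝ × (ℕ → ℝ)) (k : ℕ) : epoch (nextArrival w) k = epoch w (k + 1) := by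
  rw [epoch, epoch, Finset.sum_range_succ', nextArrival]
  ring

lemma epoch_iterate_nextArrival (w : ℝ × (ℕ → ℝ)) (j k : ℕ) :
    epoch (nextArrival^[j] w) k = epoch w (j + k) := by
  induction j generalizing k with
  | zero => simp
  | succ j ih =>
    rw [Function.iterate_succ_apply', epoch_nextArrival, ih, add_right_comm, add_assoc]

lemma measurable_epoch (k : ℕ) : Measurable fun w => epoch w k := by
  unfold epoch
  fun_prop

lemma measurable_nextArrival : Measurable nextArrival := by
  unfold nextArrival
  fun_prop

lemma measurable_countLE {Ω : Type*} [MeasurableSpace Ω] {f : Ω → ℕ → ℝ}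
    (hf : ∀ k, Measurable fun ω => f ω k) (t : ℝ) : Measurable fun ω => countLE (f ω) t := by
  unfold countLE
  refine measurable_ncard.comp ?_
  exact measurable_set_iff.2 fun k =>
    measurableSet_setOfPred.1 (measurableSet_le (hf k) measurable_const)

section Shift

variable (ν : Measure ℝ) [IsProbabilityMeasure ν]

lemma measurePreserving_cons :
    MeasurePreserving (fun z : ℝ × (ℕ → ℝ) => (fun n => Nat.casesOn n z.1 z.2 : ℕ → ℝ))
      (ν.prod (Measure.infinitePi fun _ : ℕ => ν)) (Measure.infinitePi fun _ : ℕ => ν) := by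
  have hm : Measurable fun z : ℝ × (ℕ → ℝ) => (fun n => Nat.casesOn n z.1 z.2 : ℕ → ℝ) := by
    refine measurable_pi_iff.2 fun n => ?_
    cases n with
    | zero => exact measurable_fst
    | succ n => exact (measurable_pi_apply n).comp measurable_snd
  refine ⟨hm, Measure.eq_infinitePi _ fun s t ht => ?_⟩
  classical
  rw [Measure.map_apply hm (MeasurableSet.pi s.countable_toSet fun i _ => ht i)]
  set s' : Finset ℕ := s.preimage Nat.succ (Nat.succ_injective.injOn) with hs'
  have e : (fun z : ℝ × (ℕ → ℝ) => (fun n => Nat.casesOn n z.1 z.2 : ℕ → ℝ)) ⁻¹' (Set.pi s t) =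
      (if 0 ∈ s then t 0 else univ) ×ˢ Set.pi s' fun i => t (i + 1) := by
    ext z
    simp only [Set.mem_preimage, Set.mem_pi, Finset.mem_coe, Set.mem_prod, hs',
      Finset.mem_preimage, Nat.succ_eq_add_one]
    constructor
    · intro h
      refine ⟨?_, fun i hi => h _ hi⟩
      split_ifs with h0
      · exact h 0 h0
      · trivial
    · rintro ⟨h0, h1⟩ i hi
      cases i with
      | zero => rwa [if_pos hi] at h0
      | succ i => exact h1 i hi
  rw [e, Measure.prod_prod, Measure.infinitePi_pi _ fun i _ => ht (i + 1)]
  have e2 : s.erase 0 = s'.image Nat.succ := by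
    ext i
    simp only [hs', Finset.mem_erase, Finset.mem_image, Finset.mem_preimage]
    cases i with
    | zero => simp
    | succ i => simp
  have e3 : ∏ i ∈ s', ν (t (i + 1)) = ∏ i ∈ s.erase 0, ν (t i) := by
    rw [e2, Finset.prod_image (fun _ _ _ _ h => Nat.succ_injective h)]
  rw [e3]
  split_ifs with h0
  · exact Finset.mul_prod_erase s (fun i => ν (t i)) h0
  · rw [measure_univ, one_mul, Finset.erase_eq_of_notMem h0]

lemma lintegral_infinitePi_cons {Φ : ℝ × (ℕ → ℝ) → ℝ≥0∞} (hΦ : Measurable Φ) :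
    ∫⁻ v, Φ (v 0, fun i => v (i + 1)) ∂(Measure.infinitePi fun _ : ℕ => ν) =
      ∫⁻ z, Φ z ∂(ν.prod (Measure.infinitePi fun _ : ℕ => ν)) := by
  rw [← (measurePreserving_cons ν).lintegral_comp
    (f := fun v : ℕ → ℝ => Φ (v 0, fun i => v (i + 1))) (hΦ.comp (by fun_prop))]
  rfl

lemma lintegral_map_add_prod {F : ℝ × (ℕ → ℝ) → ℝ≥0∞} (hF : Measurable F) (x : ℝ) :
    ∫⁻ w, F w ∂((ν.map fun y => x + y).prod (Measure.infinitePi fun _ : ℕ => ν)) =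
      ∫⁻ z, F (x + z.1, z.2) ∂(ν.prod (Measure.infinitePi fun _ : ℕ => ν)) := by
  have hF' : Measurable fun z : ℝ × (ℕ → ℝ) => F (x + z.1, z.2) := hF.comp (by fun_prop)
  rw [lintegral_prod _ hF.aemeasurable, lintegral_map hF.lintegral_prod_right' (by fun_prop),
    lintegral_prod _ hF'.aemeasurable]

end Shift

lemma lintegral_residualLaw {ν : Measure ℝ} {Φ : ℝ → ℝ≥0∞} (hΦ : Measurable Φ) (a : ℝ) :
    ∫⁻ x, Φ x ∂(residualLaw ν a) = (ν (Ioi a))⁻¹ * ∫⁻ x in Ioi a, Φ (x - a) ∂ν := by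
  rw [residualLaw, lintegral_map hΦ (by fun_prop), ProbabilityTheory.cond, lintegral_smul_measure,
    smul_eq_mul]

section Residual

variable {ν : Measure ℝ} [IsProbabilityMeasure ν]

/-- The excess over `s` of an interarrival time larger than `s` has the law `residualLaw ν s`. -/
lemma setLIntegral_excess_le {Φ : ℝ → ℝ≥0∞} (hΦ : Measurable Φ) {c : ℝ≥0∞}
    (hc : ∀ a ∈ ages ν, ∫⁻ x, Φ x ∂(residualLaw ν a) ≤ c) {s : ℝ} (hs : 0 ≤ s) :
    ∫⁻ x in Ioi s, Φ (x - s) ∂ν ≤ c * ν (Ioi s) := by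
  rcases eq_or_ne (ν (Ioi s)) 0 with h0 | h0
  · rw [Measure.restrict_eq_zero.2 h0]; simp
  · have := hc s ⟨hs, pos_iff_ne_zero.2 h0⟩
    rw [lintegral_residualLaw hΦ] at this
    calc ∫⁻ x in Ioi s, Φ (x - s) ∂ν
        = ((ν (Ioi s))⁻¹ * ∫⁻ x in Ioi s, Φ (x - s) ∂ν) * ν (Ioi s) := by
          rw [mul_comm _ (ν (Ioi s)), ← mul_assoc, ENNReal.mul_inv_cancel h0 (measure_ne_top _ _),
            one_mul]
      _ ≤ c * ν (Ioi s) := by gcongr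

/-- The time of the first arrival is memoryless relative to `residualLaw ν`: if it exceeds `t`, then
the excess has one of the laws `residualLaw ν a`. -/
def ExcessBound (ν ρ : Measure ℝ) (t : ℝ) : Prop :=
  ∀ (Φ : ℝ → ℝ≥0∞) (c : ℝ≥0∞), Measurable Φ →
    (∀ a ∈ ages ν, ∫⁻ x, Φ x ∂(residualLaw ν a) ≤ c) →
    ∫⁻ x in Ioi t, Φ (x - t) ∂ρ ≤ c * ρ (Ioi t)

lemma excessBound_map_add {y t : ℝ} (hy : y ≤ t) : ExcessBound ν (ν.map fun x => y + x) t := by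
  intro Φ c hΦ hc
  have hpre : (fun x => y + x) ⁻¹' Ioi t = Ioi (t - y) := by
    ext x; simp only [Set.mem_preimage, Set.mem_Ioi]; constructor <;> intro h <;> linarith
  rw [setLIntegral_map measurableSet_Ioi (by fun_prop) (by fun_prop),
    Measure.map_apply (by fun_prop) measurableSet_Ioi, hpre]
  refine le_trans (le_of_eq ?_) (setLIntegral_excess_le hΦ hc (sub_nonneg.2 hy))
  exact lintegral_congr fun x => by congr 1; ring

lemma excessBound_residualLaw {a t : ℝ} (ha : a ∈ ages ν) (ht : 0 ≤ t) :
    ExcessBound ν (residualLaw ν a) t := by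
  intro Φ c hΦ hc
  have key : ∀ Φ : ℝ → ℝ≥0∞, Measurable Φ → ∫⁻ x in Ioi t, Φ (x - t) ∂(residualLaw ν a) =
      (ν (Ioi a))⁻¹ * ∫⁻ x in Ioi (a + t), Φ (x - (a + t)) ∂ν := by
    intro Φ hΦ
    have hm : Measurable fun x => Φ (x - t) := hΦ.comp (by fun_prop)
    rw [← lintegral_indicator measurableSet_Ioi,
      lintegral_residualLaw (hm.indicator measurableSet_Ioi),
      ← lintegral_indicator measurableSet_Ioi, ← lintegral_indicator measurableSet_Ioi]
    congr 1
    refine lintegral_congr fun x => ?_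
    simp only [Set.indicator_apply, Set.mem_Ioi]
    by_cases h : a + t < x
    · rw [if_pos h, if_pos (by linarith), if_pos (by linarith)]
      congr 1; ring
    · rw [if_neg h]
      split_ifs with h1 h2
      · exact absurd (by linarith) h
      · rfl
      · rfl
  have h1 : residualLaw ν a (Ioi t) = (ν (Ioi a))⁻¹ * ν (Ioi (a + t)) := by
    have := key (fun _ => 1) measurable_const
    simpa using this
  rw [key Φ hΦ, h1, mul_left_comm]
  gcongr
  exact setLIntegral_excess_le hΦ hc (add_nonneg ha.1 ht)

/-- On the event that exactly `j` arrivals occur by time `t`, the value of `Ψ` at the future of the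
arrival process seen at time `t`; zero elsewhere. -/
noncomputable def futureAfter (Ψ : ℝ × (ℕ → ℝ) → ℝ≥0∞) (t : ℝ) : ℕ → ℝ × (ℕ → ℝ) → ℝ≥0∞
  | 0, w => {w : ℝ × (ℕ → ℝ) | t < w.1}.indicator (fun w => Ψ (w.1 - t, w.2)) w
  | j + 1, w => {w : ℝ × (ℕ → ℝ) | w.1 ≤ t}.indicator
      (fun w => futureAfter Ψ t j (nextArrival w)) w

lemma measurable_futureAfter {Ψ : ℝ × (ℕ → ℝ) → ℝ≥0∞} (hΨ : Measurable Ψ) (t : ℝ) (j : ℕ) :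
    Measurable (futureAfter Ψ t j) := by
  induction j with
  | zero =>
    change Measurable fun w => _
    simp only [futureAfter]
    exact Measurable.indicator (by fun_prop) (measurableSet_lt measurable_const measurable_fst)
  | succ j ih =>
    change Measurable fun w => _
    simp only [futureAfter]
    exact Measurable.indicator (ih.comp measurable_nextArrival)
      (measurableSet_le measurable_fst measurable_const)

/-- Conditioning on the first arrival. -/
lemma lintegral_futureAfter_succ {Ψ : ℝ × (ℕ → ℝ) → ℝ≥0∞} (hΨ : Measurable Ψ) (t : ℝ) (j : ℕ)
    (ρ : Measure ℝ) :
    ∫⁻ w, futureAfter Ψ t (j + 1) w ∂(ρ.prod (Measure.infinitePi fun _ : ℕ => ν)) =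
      ∫⁻ x in Iic t, ∫⁻ w, futureAfter Ψ t j w
        ∂((ν.map fun y => x + y).prod (Measure.infinitePi fun _ : ℕ => ν)) ∂ρ := by
  have hm := measurable_futureAfter hΨ t
  rw [lintegral_prod _ (hm _).aemeasurable, ← lintegral_indicator measurableSet_Iic]
  refine lintegral_congr fun x => ?_
  by_cases hx : x ≤ t
  · rw [Set.indicator_of_mem (show x ∈ Iic t from hx)]
    have h1 : ∀ v : ℕ → ℝ, futureAfter Ψ t (j + 1) (x, v) =
        futureAfter Ψ t j (x + v 0, fun i => v (i + 1)) := fun v => by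
      rw [futureAfter, Set.indicator_of_mem (by exact hx)]; rfl
    simp only [h1]
    rw [lintegral_infinitePi_cons ν (Φ := fun z => futureAfter Ψ t j (x + z.1, z.2))
      ((hm j).comp (by fun_prop)), lintegral_map_add_prod ν (hm j)]
  · rw [Set.indicator_of_notMem (show x ∉ Iic t from hx)]
    have h1 : ∀ v : ℕ → ℝ, futureAfter Ψ t (j + 1) (x, v) = 0 := fun v => by
      rw [futureAfter, Set.indicator_of_notMem (by exact hx)]
    simp [h1]

/-- The strong Markov step: whatever the number `j` of arrivals by time `t`, the next arrival after
`t` follows some `residualLaw ν a`, so that a bound uniform in `a` applies. By induction on `j`,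
the law of the current first arrival being generalized. -/
lemma lintegral_futureAfter_le {Ψ : ℝ × (ℕ → ℝ) → ℝ≥0∞} (hΨ : Measurable Ψ) {c : ℝ≥0∞}
    (hc : ∀ a ∈ ages ν, ∫⁻ w, Ψ w ∂(futureLaw ν a) ≤ c) {t : ℝ} (j : ℕ) (ρ : Measure ℝ)
    (hρ : ExcessBound ν ρ t) :
    ∫⁻ w, futureAfter Ψ t j w ∂(ρ.prod (Measure.infinitePi fun _ : ℕ => ν)) ≤
      c * ∫⁻ w, futureAfter (fun _ => 1) t j w ∂(ρ.prod (Measure.infinitePi fun _ : ℕ => ν)) := by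
  induction j generalizing ρ with
  | zero =>
    have key : ∀ Ψ : ℝ × (ℕ → ℝ) → ℝ≥0∞, Measurable Ψ →
        ∫⁻ w, futureAfter Ψ t 0 w ∂(ρ.prod (Measure.infinitePi fun _ : ℕ => ν)) =
        ∫⁻ x in Ioi t, ∫⁻ v, Ψ (x - t, v) ∂(Measure.infinitePi fun _ : ℕ => ν) ∂ρ := by
      intro Ψ hΨ
      rw [lintegral_prod _ (measurable_futureAfter hΨ t 0).aemeasurable,
        ← lintegral_indicator measurableSet_Ioi]
      refine lintegral_congr fun x => ?_
      simp only [futureAfter, Set.indicator_apply, Set.mem_ofPred_eq, Set.mem_Ioi]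
      split_ifs <;> simp
    rw [key Ψ hΨ, key _ measurable_const]
    simp only [lintegral_const, measure_univ, one_mul, mul_one, Measure.restrict_apply_univ]
    refine hρ (fun x => ∫⁻ v, Ψ (x, v) ∂(Measure.infinitePi fun _ : ℕ => ν)) c
      hΨ.lintegral_prod_right' fun a ha => ?_
    have := hc a ha
    rwa [futureLaw, lintegral_prod _ hΨ.aemeasurable] at this
  | succ j ih =>
    rw [lintegral_futureAfter_succ hΨ, lintegral_futureAfter_succ measurable_const]
    calc _ ≤ ∫⁻ x in Iic t, c * ∫⁻ w, futureAfter (fun _ => 1) t j w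
        ∂((ν.map fun y => x + y).prod (Measure.infinitePi fun _ : ℕ => ν)) ∂ρ :=
          setLIntegral_mono' measurableSet_Iic fun x hx => ih _ (excessBound_map_add hx)
      _ = _ := by
        refine lintegral_const_mul _ ?_
        have hm := measurable_futureAfter (Ψ := fun _ => 1) measurable_const t j
        simp only [lintegral_map_add_prod ν hm]
        exact (hm.comp (show Measurable fun u : ℝ × (ℝ × (ℕ → ℝ)) => (u.1 + u.2.1, u.2.2) by
          fun_prop)).lintegral_prod_right'

/-- The arrival epochs increase to infinity. -/
def IsRegularPath (w : ℝ × (ℕ → ℝ)) : Prop :=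
  Monotone (epoch w) ∧ Tendsto (epoch w) atTop atTop

lemma futureAfter_eq {w : ℝ × (ℕ → ℝ)} (hw : IsRegularPath w) (Ψ : ℝ × (ℕ → ℝ) → ℝ≥0∞) (t : ℝ)
    (j : ℕ) : futureAfter Ψ t j w = if j = countLE (epoch w) t then
      Ψ ((nextArrival^[j] w).1 - t, (nextArrival^[j] w).2) else 0 := by
  induction j generalizing w with
  | zero =>
    have h := le_iff_lt_countLE hw.1 hw.2 t 0
    rw [epoch_zero] at h
    simp only [futureAfter, Set.indicator_apply, Set.mem_ofPred_eq, Function.iterate_zero, id]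
    refine if_congr ?_ rfl rfl
    rw [← not_le, h]; omega
  | succ j ih =>
    have hw' : IsRegularPath (nextArrival w) := by
      have e : epoch (nextArrival w) = fun k => epoch w (k + 1) := funext (epoch_nextArrival w)
      rw [IsRegularPath, e]
      exact ⟨fun a b hab => hw.1 (by omega), hw.2.comp (tendsto_add_atTop_nat 1)⟩
    have h0 := le_iff_lt_countLE hw.1 hw.2 t 0
    rw [epoch_zero] at h0
    have hcount : w.1 ≤ t → countLE (epoch w) t = countLE (epoch (nextArrival w)) t + 1 := by
      intro hle
      have h1 := fun k => le_iff_lt_countLE hw.1 hw.2 t k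
      have h2 := fun k => le_iff_lt_countLE hw'.1 hw'.2 t k
      simp only [epoch_nextArrival, h1] at h2
      have a1 := h2 (countLE (epoch (nextArrival w)) t)
      have a2 := h2 (countLE (epoch w) t - 1)
      have a3 := h0.1 hle
      omega
    simp only [futureAfter, Set.indicator_apply, Set.mem_ofPred_eq, Function.iterate_succ_apply]
    rw [ih hw']
    by_cases hle : w.1 ≤ t
    · rw [if_pos hle, hcount hle]
      simp
    · rw [if_neg hle, if_neg]
      rw [h0] at hle
      omega

lemma countLE_future {w : ℝ × (ℕ → ℝ)} (hw : IsRegularPath w) (t T : ℝ) :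
    countLE (epoch ((nextArrival^[countLE (epoch w) t] w).1 - t,
      (nextArrival^[countLE (epoch w) t] w).2)) T =
      countLE (epoch w) (t + T) - countLE (epoch w) t := by
  set N := countLE (epoch w) t
  have h1 : {k | epoch ((nextArrival^[N] w).1 - t, (nextArrival^[N] w).2) k ≤ T} =
      Set.Iio (countLE (epoch w) (t + T) - N) := by
    ext k
    have h2 : epoch ((nextArrival^[N] w).1 - t, (nextArrival^[N] w).2) k =
        epoch w (N + k) - t := by
      rw [← epoch_iterate_nextArrival, epoch, epoch]; ring
    have h3 := le_iff_lt_countLE hw.1 hw.2 (t + T) (N + k)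
    rw [Set.mem_ofPred_eq, h2, sub_le_iff_le_add', h3, Set.mem_Iio]
    omega
  rw [countLE, h1, Set.ncard_Iio_nat]

lemma ae_isRegularPath_prod (hν : IsInterarrivalLaw ν) (ρ : Measure ℝ) [SFinite ρ] :
    ∀ᵐ w ∂(ρ.prod (Measure.infinitePi fun _ : ℕ => ν)), IsRegularPath w := by
  have hmp : ∀ i : ℕ, MeasurePreserving (fun v : ℕ → ℝ => v i)
      (Measure.infinitePi fun _ : ℕ => ν) ν := fun i =>
    measurePreserving_eval_infinitePi (fun _ : ℕ => ν) i
  have h1 : ∀ᵐ v ∂(Measure.infinitePi fun _ : ℕ => ν), ∀ i, 0 ≤ v i := by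
    refine ae_all_iff.2 fun i => ?_
    have : ∀ᵐ x ∂ν, 0 ≤ x := by
      have := measure_eq_zero_iff_ae_notMem.1 hν.nonneg
      filter_upwards [this] with x hx
      simpa using hx
    exact (hmp i).quasiMeasurePreserving.ae this
  have hind : iIndepFun (fun (i : ℕ) (v : ℕ → ℝ) => v i) (Measure.infinitePi fun _ : ℕ => ν) :=
    iIndepFun_infinitePi (X := fun _ x => x) (fun _ => measurable_id)
  have hident : ∀ i : ℕ, IdentDistrib (fun v : ℕ → ℝ => v i) (fun v => v 0)
      (Measure.infinitePi fun _ : ℕ => ν) (Measure.infinitePi fun _ : ℕ => ν) := fun i =>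
    ⟨(measurable_pi_apply i).aemeasurable, (measurable_pi_apply 0).aemeasurable, by
      rw [(hmp i).map_eq, (hmp 0).map_eq]⟩
  have hint : Integrable (fun v : ℕ → ℝ => v 0) (Measure.infinitePi fun _ : ℕ => ν) :=
    (hmp 0).integrable_comp_of_integrable hν.integrable
  have hmean : ∫ v : ℕ → ℝ, v 0 ∂(Measure.infinitePi fun _ : ℕ => ν) = ∫ x, x ∂ν := by
    have := integral_map (hmp 0).measurable.aemeasurable (f := fun x : ℝ => x)
      (by rw [(hmp 0).map_eq]; exact hν.integrable.1)
    rw [(hmp 0).map_eq] at this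
    exact this.symm
  have h2 := strong_law_ae_real (fun (i : ℕ) (v : ℕ → ℝ) => v i) hint
    (fun i j hij => hind.indepFun hij) hident
  rw [hmean] at h2
  have h3 : ∀ᵐ v ∂(Measure.infinitePi fun _ : ℕ => ν),
      (∀ i, 0 ≤ v i) ∧ Tendsto (fun k => ∑ i ∈ Finset.range k, v i) atTop atTop := by
    filter_upwards [h1, h2] with v hv hv2
    refine ⟨hv, ?_⟩
    have := hv2.pos_mul_atTop hν.mean_pos (tendsto_natCast_atTop_atTop (R := ℝ))
    refine this.congr' ?_
    filter_upwards [eventually_gt_atTop 0] with k hk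
    have : (k : ℝ) ≠ 0 := by positivity
    field_simp
  have h4 : ∀ᵐ w ∂(ρ.prod (Measure.infinitePi fun _ : ℕ => ν)), (∀ i, 0 ≤ w.2 i) ∧
      Tendsto (fun k => ∑ i ∈ Finset.range k, w.2 i) atTop atTop :=
    Measure.quasiMeasurePreserving_snd.ae h3
  filter_upwards [h4] with w hw
  refine ⟨monotone_nat_of_le_succ fun k => ?_, ?_⟩
  · rw [epoch, epoch, Finset.sum_range_succ]
    linarith [hw.1 k]
  · exact tendsto_atTop_add_const_left _ _ hw.2

/-- The Markov property of the arrival counts: a bound on the expectation of a function of the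
number of arrivals in an interval of length `T` that is uniform in the age holds conditionally on
the number of arrivals before that interval. -/
lemma lintegral_count_mul_count_le (hν : IsInterarrivalLaw ν) {a : ℝ} (ha : a ∈ ages ν) {t : ℝ}
    (ht : 0 ≤ t) (T : ℝ) (f g : ℕ → ℝ≥0∞) {c : ℝ≥0∞}
    (hc : ∀ a ∈ ages ν, ∫⁻ w, g (countLE (epoch w) T) ∂(futureLaw ν a) ≤ c) :
    ∫⁻ w, f (countLE (epoch w) t) * g (countLE (epoch w) (t + T) - countLE (epoch w) t)
      ∂(futureLaw ν a) ≤ c * ∫⁻ w, f (countLE (epoch w) t) ∂(futureLaw ν a) := by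
  have hgood : ∀ᵐ w ∂(futureLaw ν a), IsRegularPath w := by
    have : SFinite (residualLaw ν a) := by unfold residualLaw; infer_instance
    exact ae_isRegularPath_prod hν (residualLaw ν a)
  have key : ∀ g : ℕ → ℝ≥0∞, ∫⁻ w, f (countLE (epoch w) t) *
      g (countLE (epoch w) (t + T) - countLE (epoch w) t) ∂(futureLaw ν a) =
      ∑' j, f j * ∫⁻ w, futureAfter (fun w => g (countLE (epoch w) T)) t j w ∂(futureLaw ν a) := by
    intro g
    have hm : Measurable fun w => g (countLE (epoch w) T) :=
      (Measurable.of_discrete (f := g)).comp (measurable_countLE measurable_epoch T)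
    have h1 : ∀ j, f j * ∫⁻ w, futureAfter (fun w => g (countLE (epoch w) T)) t j w
        ∂(futureLaw ν a) = ∫⁻ w, f j * futureAfter (fun w => g (countLE (epoch w) T)) t j w
        ∂(futureLaw ν a) := fun j => (lintegral_const_mul _ (measurable_futureAfter hm t j)).symm
    simp only [h1]
    rw [← lintegral_tsum fun j => ((measurable_futureAfter hm t j).const_mul _).aemeasurable]
    refine lintegral_congr_ae ?_
    filter_upwards [hgood] with w hw
    simp only [futureAfter_eq hw]
    rw [tsum_eq_single (countLE (epoch w) t) (fun j hj => by rw [if_neg hj, mul_zero]), if_pos rfl,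
      countLE_future hw]
  have key1 := key fun _ => 1
  simp only [mul_one] at key1
  rw [key g, key1, ← ENNReal.tsum_mul_left]
  refine ENNReal.tsum_le_tsum fun j => ?_
  rw [mul_left_comm]
  gcongr
  exact lintegral_futureAfter_le ((Measurable.of_discrete (f := g)).comp
    (measurable_countLE measurable_epoch T)) hc j _ (excessBound_residualLaw ha ht)

end Residual

/-! ### Arrivals over several units of time -/

section Arrivals

variable {ν : Measure ℝ} [IsProbabilityMeasure ν]

lemma isProbabilityMeasure_residualLaw {a : ℝ} (ha : a ∈ ages ν) :
    IsProbabilityMeasure (residualLaw ν a) := by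
  have := cond_isProbabilityMeasure (μ := ν) ha.2.ne'
  exact Measure.isProbabilityMeasure_map (by fun_prop)

lemma isProbabilityMeasure_futureLaw {a : ℝ} (ha : a ∈ ages ν) :
    IsProbabilityMeasure (futureLaw ν a) := by
  have := isProbabilityMeasure_residualLaw ha
  unfold futureLaw; infer_instance

omit [IsProbabilityMeasure ν] in
lemma residualLaw_Iic_zero (a : ℝ) : residualLaw ν a (Iic 0) = 0 := by
  rw [← lintegral_indicator_one measurableSet_Iic,
    lintegral_residualLaw (measurable_one.indicator measurableSet_Iic)]
  refine mul_eq_zero_of_right _ ?_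
  rw [setLIntegral_congr_fun (g := fun _ => 0) measurableSet_Ioi fun x hx => ?_]
  · simp
  · exact Set.indicator_of_notMem (by simpa using hx) _

lemma ae_futureLaw (hν : IsInterarrivalLaw ν) (a : ℝ) :
    ∀ᵐ w ∂(futureLaw ν a), IsRegularPath w ∧ 0 < w.1 := by
  have : SFinite (residualLaw ν a) := by unfold residualLaw; infer_instance
  refine (ae_isRegularPath_prod hν (residualLaw ν a)).and ?_
  have h : ∀ᵐ x ∂(residualLaw ν a), 0 < x := by
    have := measure_eq_zero_iff_ae_notMem.1 (residualLaw_Iic_zero (ν := ν) a)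
    filter_upwards [this] with x hx
    simpa using hx
  exact Measure.quasiMeasurePreserving_fst.ae h

/-- Submultiplicativity of exponential moments of the arrival counts over successive time units. -/
lemma lintegral_exp_count_le_pow (hν : IsInterarrivalLaw ν) (s x : ℝ) {c : ℝ≥0∞}
    (hc : ∀ a ∈ ages ν, ∫⁻ w, ENNReal.ofReal (Real.exp (s * (unitCount w - x))) ∂(futureLaw ν a)
      ≤ c) (T : ℕ) {a : ℝ} (ha : a ∈ ages ν) :
    ∫⁻ w, ENNReal.ofReal (Real.exp (s * (countLE (epoch w) T - T * x))) ∂(futureLaw ν a)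
      ≤ c ^ T := by
  induction T with
  | zero =>
    have := isProbabilityMeasure_futureLaw ha
    refine (lintegral_mono_ae (g := fun _ => 1) ?_).trans (by simp)
    filter_upwards [ae_futureLaw hν a] with w hw
    have h0 : countLE (epoch w) 0 = 0 := by
      have := (le_iff_lt_countLE hw.1.1 hw.1.2 0 0).not.1
        (by rw [epoch_zero]; exact not_le.2 hw.2)
      omega
    simp [h0]
  | succ T ih =>
    have h := lintegral_count_mul_count_le hν ha (Nat.cast_nonneg T) 1
      (fun k => ENNReal.ofReal (Real.exp (s * (k - T * x))))
      (fun k => ENNReal.ofReal (Real.exp (s * (k - x)))) hc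
    calc _ = ∫⁻ w, ENNReal.ofReal (Real.exp (s * (countLE (epoch w) T - T * x))) *
          ENNReal.ofReal (Real.exp (s * ((countLE (epoch w) (T + 1) - countLE (epoch w) T : ℕ) - x)))
          ∂(futureLaw ν a) := by
          refine lintegral_congr_ae ?_
          filter_upwards [ae_futureLaw hν a] with w hw
          have hle : countLE (epoch w) T ≤ countLE (epoch w) (T + 1) :=
            countLE_mono hw.1.2 (by linarith)
          rw [← ENNReal.ofReal_mul (Real.exp_pos _).le, ← Real.exp_add, Nat.cast_sub hle]
          congr 2
          push_cast
          ring
      _ ≤ c * ∫⁻ w, ENNReal.ofReal (Real.exp (s * (countLE (epoch w) T - T * x)))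
          ∂(futureLaw ν a) := h
      _ ≤ c ^ (T + 1) := by rw [pow_succ']; gcongr

lemma measurable_residualLaw : Measurable (residualLaw ν) := by
  refine Measure.measurable_of_measurable_coe _ fun C hC => ?_
  have h : ∀ a, residualLaw ν a C =
      (ν (Ioi a))⁻¹ * ∫⁻ x, {z : ℝ × ℝ | z.1 < z.2 ∧ z.2 - z.1 ∈ C}.indicator 1 (a, x) ∂ν := by
    intro a
    rw [← lintegral_indicator_one hC, lintegral_residualLaw (measurable_one.indicator hC),
      ← lintegral_indicator measurableSet_Ioi]
    congr 1
    refine lintegral_congr fun x => ?_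
    simp only [Set.indicator_apply, Set.mem_Ioi]
    by_cases h1 : a < x <;> by_cases h2 : x - a ∈ C <;> simp [h1, h2]
  simp only [h]
  have hanti : Antitone fun a => ν (Ioi a) := fun a b hab => measure_mono (Ioi_subset_Ioi hab)
  refine hanti.measurable.inv.mul (Measurable.lintegral_prod_right' (measurable_one.indicator ?_))
  have hm : Measurable fun z : ℝ × ℝ => z.2 - z.1 := by fun_prop
  exact (measurableSet_lt measurable_fst measurable_snd).inter (hm hC)

end Arrivals

section Queue

variable {n : ℕ} {Ω : Type*} [MeasurableSpace Ω] {P : Measure Ω} [IsProbabilityMeasure P]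
  {ν : Measure ℝ} [IsProbabilityMeasure ν] {p : PMF ℕ} {K : ℕ} {D : Input n Ω}

/-- The arrival process of the queue: the time of the first arrival, and the following gaps. -/
def Input.arrivals (D : Input n Ω) (ω : Ω) : ℝ × (ℕ → ℝ) := (D.first ω, fun i => D.gap i ω)

omit [IsProbabilityMeasure P] [IsProbabilityMeasure ν] in
lemma IsStationaryQueue.measurable_arrivals (hD : IsStationaryQueue P ν p K D) :
    Measurable D.arrivals :=
  hD.measurable_first.prodMk (measurable_pi_iff.2 hD.measurable_gap)

omit [IsProbabilityMeasure P] [IsProbabilityMeasure ν] in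
lemma IsStationaryQueue.ae_age_mem (hD : IsStationaryQueue P ν p K D) :
    ∀ᵐ ω ∂P, D.age ω ∈ ages ν := by
  have hanti : Antitone fun a => ν (Ioi a) := fun a b hab => measure_mono (Ioi_subset_Ioi hab)
  have hmeas : MeasurableSet (ages ν) :=
    (measurableSet_le measurable_const measurable_id).inter
      (measurableSet_lt measurable_const hanti.measurable)
  have hage : Measurable D.age := measurable_snd.comp (measurable_snd.comp hD.measurable_init)
  have h0 : ∀ᵐ a ∂(equilibriumAge ν), a ∈ ages ν := by
    have hm : Measurable fun a => ENNReal.ofReal (rate ν) * ν (Ioi a) :=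
      measurable_const.mul hanti.measurable
    rw [equilibriumAge, ae_withDensity_iff hm, ae_restrict_iff' measurableSet_Ici]
    refine Eventually.of_forall fun a ha hne => ⟨ha, pos_iff_ne_zero.2 fun h => hne ?_⟩
    rw [h, mul_zero]
  rw [← hD.law_age] at h0
  exact ae_of_ae_map hage.aemeasurable h0

omit [IsProbabilityMeasure ν] in
lemma IsStationaryQueue.map_arrivals (hD : IsStationaryQueue P ν p K D) :
    P.map D.arrivals = (P.map D.first).prod (Measure.infinitePi fun _ : ℕ => ν) := by
  have hgap : Measurable fun ω i => D.gap i ω := measurable_pi_iff.2 hD.measurable_gap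
  have hgaps : P.map (fun ω i => D.gap i ω) = Measure.infinitePi fun _ : ℕ => ν := by
    rw [hD.indep_gap.map_fun_eq_infinitePi_map hD.measurable_gap]
    simp only [hD.law_gap]
  have hind : IndepFun D.first (fun ω i => D.gap i ω) P :=
    hD.indep_init.comp (φ := Prod.snd) (ψ := Prod.fst) measurable_snd measurable_fst
  rw [← hgaps]
  exact (indepFun_iff_map_prod_eq_prod_map_map hD.measurable_first.aemeasurable
    hgap.aemeasurable).1 hind

/-- The arrivals after time `0` are a mixture of the laws `futureLaw ν a`. -/
lemma IsStationaryQueue.lintegral_arrivals_le (hD : IsStationaryQueue P ν p K D)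
    {Ψ : ℝ × (ℕ → ℝ) → ℝ≥0∞} (hΨ : Measurable Ψ) {c : ℝ≥0∞}
    (hc : ∀ a ∈ ages ν, ∫⁻ w, Ψ w ∂(futureLaw ν a) ≤ c) :
    ∫⁻ ω, Ψ (D.arrivals ω) ∂P ≤ c := by
  have hage : Measurable D.age := measurable_snd.comp (measurable_snd.comp hD.measurable_init)
  have hres : Measurable fun ω => residualLaw ν (D.age ω) := measurable_residualLaw.comp hage
  have hfirst : P.map D.first = P.bind fun ω => residualLaw ν (D.age ω) := by
    ext C hC
    have := hD.law_first univ .univ C hC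
    rw [Measure.map_apply hD.measurable_first hC,
      Measure.bind_apply hC hres.aemeasurable]
    simpa using this
  have : IsProbabilityMeasure (P.map D.first) :=
    Measure.isProbabilityMeasure_map hD.measurable_first.aemeasurable
  rw [← lintegral_map hΨ hD.measurable_arrivals, hD.map_arrivals, lintegral_prod _ hΨ.aemeasurable,
    hfirst, Measure.lintegral_bind hres.aemeasurable
      hΨ.lintegral_prod_right'.aemeasurable]
  refine (lintegral_mono_ae (g := fun _ => c) ?_).trans (by simp)
  filter_upwards [hD.ae_age_mem] with ω hω
  have := hc _ hω
  rwa [futureLaw, lintegral_prod _ hΨ.aemeasurable] at this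

lemma IsStationaryQueue.ae_arrivals (hD : IsStationaryQueue P ν p K D)
    (hν : IsInterarrivalLaw ν) : ∀ᵐ ω ∂P, IsRegularPath (D.arrivals ω) ∧ 0 < D.first ω := by
  have : IsProbabilityMeasure (P.map D.first) :=
    Measure.isProbabilityMeasure_map hD.measurable_first.aemeasurable
  refine Eventually.and (ae_of_ae_map hD.measurable_arrivals.aemeasurable
    (p := IsRegularPath) ?_) ?_
  · rw [hD.map_arrivals]
    exact ae_isRegularPath_prod hν _
  · have hm₀ : Measurable fun w : ℝ × (ℕ → ℝ) => (Iic (0 : ℝ)).indicator (1 : ℝ → ℝ≥0∞) w.1 :=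
      (measurable_one.indicator measurableSet_Iic).comp measurable_fst
    have h := hD.lintegral_arrivals_le (c := 0) hm₀ fun a ha => by
        rw [futureLaw, lintegral_prod _ hm₀.aemeasurable]
        simp only [lintegral_const, measure_univ, mul_one]
        rw [lintegral_indicator_one measurableSet_Iic, residualLaw_Iic_zero]
    have hm : Measurable fun ω => (Iic (0 : ℝ)).indicator (1 : ℝ → ℝ≥0∞) (D.arrivals ω).1 :=
      hm₀.comp hD.measurable_arrivals
    have h' := (lintegral_eq_zero_iff hm).1 (le_antisymm h (zero_le))
    filter_upwards [h'] with ω hω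
    by_contra hneg
    have : (D.arrivals ω).1 ∈ Iic (0 : ℝ) := not_lt.1 hneg
    simp [Set.indicator_of_mem this] at hω

/-- A bound on a function of the number of arrivals in an interval of length `T` that is uniform in
the age holds for the queue, for each interval of that length. -/
lemma IsStationaryQueue.lintegral_count_le (hD : IsStationaryQueue P ν p K D)
    (hν : IsInterarrivalLaw ν) (g : ℕ → ℝ≥0∞) (T : ℝ) {c : ℝ≥0∞}
    (hc : ∀ a ∈ ages ν, ∫⁻ w, g (countLE (epoch w) T) ∂(futureLaw ν a) ≤ c) {u : ℝ} (hu : 0 ≤ u) :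
    ∫⁻ ω, g (countLE (epoch (D.arrivals ω)) (u + T) - countLE (epoch (D.arrivals ω)) u) ∂P ≤ c := by
  have hm : Measurable fun w => g (countLE (epoch w) (u + T) - countLE (epoch w) u) :=
    (Measurable.of_discrete (f := g)).comp ((measurable_countLE measurable_epoch _).sub
      (measurable_countLE measurable_epoch _))
  refine hD.lintegral_arrivals_le hm fun a ha => ?_
  have := isProbabilityMeasure_futureLaw ha
  simpa using lintegral_count_mul_count_le hν ha hu T (fun _ => 1) g hc

end Queue

/-! ### Exponential moments of the arrival counts -/

lemma exp_le_quadratic (y : ℝ) : Real.exp y ≤ 1 + y + y ^ 2 * Real.exp |y| := by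
  have h := Complex.norm_exp_sub_sum_le_norm_mul_exp (y : ℂ) 2
  have e : Complex.exp y - ∑ m ∈ Finset.range 2, (y : ℂ) ^ m / (m.factorial : ℂ) =
      ((Real.exp y - (1 + y) : ℝ) : ℂ) := by
    simp [Finset.sum_range_succ]
  rw [e, Complex.norm_real, Complex.norm_real, Real.norm_eq_abs, Real.norm_eq_abs, sq_abs] at h
  linarith [le_abs_self (Real.exp y - (1 + y))]

section Moments

variable {α : Type*} [MeasurableSpace α] {μ : Measure α} [IsProbabilityMeasure μ] {X : α → ℝ}

omit [IsProbabilityMeasure μ] in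
lemma integrable_exp_abs (hX : Measurable X) {s : ℝ} {M : ℝ≥0}
    (hM : ∫⁻ w, ENNReal.ofReal (Real.exp (s * |X w|)) ∂μ ≤ M) :
    Integrable (fun w => Real.exp (s * |X w|)) μ ∧ ∫ w, Real.exp (s * |X w|) ∂μ ≤ M := by
  have hm : AEStronglyMeasurable (fun w => Real.exp (s * |X w|)) μ := by
    have : Measurable fun w => Real.exp (s * |X w|) := by fun_prop
    exact this.aestronglyMeasurable
  have hnn : 0 ≤ᵐ[μ] fun w => Real.exp (s * |X w|) := ae_of_all _ fun w => (Real.exp_pos _).le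
  refine ⟨⟨hm, ?_⟩, ?_⟩
  · rw [hasFiniteIntegral_iff_ofReal hnn]
    exact hM.trans_lt ENNReal.coe_lt_top
  · rw [integral_eq_lintegral_of_nonneg_ae hnn hm]
    exact ENNReal.toReal_le_coe_of_le_coe hM

omit [IsProbabilityMeasure μ] in
lemma integrable_of_exp_abs (hX : Measurable X) {s : ℝ} (hs : 1 ≤ s) {M : ℝ≥0}
    (hM : ∫⁻ w, ENNReal.ofReal (Real.exp (s * |X w|)) ∂μ ≤ M) :
    Integrable X μ ∧ ∫ w, X w ∂μ ≤ M := by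
  obtain ⟨h1, h2⟩ := integrable_exp_abs hX hM
  have hle : ∀ w, |X w| ≤ Real.exp (s * |X w|) := fun w => by
    nlinarith [Real.add_one_le_exp (s * |X w|), abs_nonneg (X w)]
  have hint : Integrable X μ := h1.mono' hX.aestronglyMeasurable (ae_of_all _ hle)
  exact ⟨hint, (integral_mono hint h1 fun w => (le_abs_self _).trans (hle w)).trans h2⟩

/-- A second order bound on the moment generating function near `0`. -/
lemma lintegral_exp_mul_le (hX : Measurable X) {M : ℝ≥0}
    (hM : ∫⁻ w, ENNReal.ofReal (Real.exp (2 * |X w|)) ∂μ ≤ M) {ε : ℝ}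
    (hε : ∫ w, X w ∂μ ≤ ε) {θ : ℝ} (hθ : 0 < θ) (hθ1 : θ ≤ 1) :
    ∫⁻ w, ENNReal.ofReal (Real.exp (θ * X w)) ∂μ ≤
      ENNReal.ofReal (Real.exp (θ * ε + 2 * M * θ ^ 2)) := by
  obtain ⟨h1, h2⟩ := integrable_exp_abs hX hM
  obtain ⟨h3, -⟩ := integrable_of_exp_abs hX one_le_two hM
  have hpt : ∀ w, Real.exp (θ * X w) ≤ 1 + θ * X w + 2 * θ ^ 2 * Real.exp (2 * |X w|) := by
    intro w
    have a1 := exp_le_quadratic (θ * X w)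
    have a2 : X w ^ 2 ≤ 2 * Real.exp |X w| := by
      have := Real.quadratic_le_exp_of_nonneg (abs_nonneg (X w))
      rw [sq_abs] at this
      linarith [abs_nonneg (X w)]
    have a3 : Real.exp |θ * X w| ≤ Real.exp |X w| := by
      rw [abs_mul, abs_of_pos hθ]
      exact Real.exp_le_exp.2 (mul_le_of_le_one_left (abs_nonneg _) hθ1)
    have a4 : Real.exp (2 * |X w|) = Real.exp |X w| * Real.exp |X w| := by
      rw [← Real.exp_add]; ring_nf
    have a5 : (θ * X w) ^ 2 * Real.exp |θ * X w| ≤ θ ^ 2 * (2 * Real.exp |X w|) *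
        Real.exp |X w| := by
      rw [mul_pow]; gcongr
    rw [a4]
    linarith
  have hint0 : Integrable (fun w => 1 + θ * X w) μ := (integrable_const 1).add (h3.const_mul θ)
  have hint : Integrable (fun w => 1 + θ * X w + 2 * θ ^ 2 * Real.exp (2 * |X w|)) μ :=
    hint0.add (h1.const_mul _)
  have hval : ∫ w, (1 + θ * X w + 2 * θ ^ 2 * Real.exp (2 * |X w|)) ∂μ ≤
      Real.exp (θ * ε + 2 * M * θ ^ 2) := by
    rw [integral_add hint0 (h1.const_mul _),
      integral_add (integrable_const 1) (h3.const_mul θ), integral_const_mul, integral_const_mul]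
    simp only [integral_const, probReal_univ, smul_eq_mul, mul_one]
    have b1 := mul_le_mul_of_nonneg_left hε hθ.le
    have b2 := mul_le_mul_of_nonneg_left h2 (by positivity : 0 ≤ 2 * θ ^ 2)
    linarith [Real.add_one_le_exp (θ * ε + 2 * M * θ ^ 2)]
  calc _ ≤ ∫⁻ w, ENNReal.ofReal (1 + θ * X w + 2 * θ ^ 2 * Real.exp (2 * |X w|)) ∂μ :=
        lintegral_mono fun w => ENNReal.ofReal_le_ofReal (hpt w)
    _ = ENNReal.ofReal (∫ w, (1 + θ * X w + 2 * θ ^ 2 * Real.exp (2 * |X w|)) ∂μ) :=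
        (ofReal_integral_eq_lintegral_ofReal hint
          (ae_of_all _ fun w => (Real.exp_pos _).le.trans (hpt w))).symm
    _ ≤ _ := ENNReal.ofReal_le_ofReal hval

end Moments

lemma measurable_unitCount : Measurable unitCount := measurable_countLE measurable_epoch 1

lemma measurable_centeredCount (ν : Measure ℝ) (s : ℝ) : Measurable (centeredCount ν s) := by
  have : Measurable fun w => (unitCount w : ℝ) :=
    (Measurable.of_discrete (f := fun k : ℕ => (k : ℝ))).comp measurable_unitCount
  exact (this.sub_const _).div_const _

section HalfinWhitt

variable {ν : ℕ → Measure ℝ} [∀ n, IsProbabilityMeasure (ν n)]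

lemma ArrivalExpMoments.exists_bound (hexp : ArrivalExpMoments ν) {θ : ℝ} (hθ : 0 < θ) :
    ∃ M : ℝ≥0, ∀ᶠ n : ℕ in atTop, ∀ a ∈ ages (ν n),
      ∫⁻ w, ENNReal.ofReal (Real.exp (θ * |centeredCount (ν n) (√(n : ℝ)) w|))
        ∂(futureLaw (ν n) a) ≤ M := by
  obtain ⟨c, C, h⟩ := hexp
  have h1 := (h θ hθ).trans_lt (ENNReal.lt_add_right ENNReal.ofReal_ne_top one_ne_zero)
  refine ⟨(ENNReal.ofReal (C * Real.exp (c * θ ^ 2)) + 1).toNNReal, ?_⟩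
  filter_upwards [eventually_lt_of_limsup_lt h1] with n hn a ha
  rw [ENNReal.coe_toNNReal (by finiteness)]
  exact (le_iSup (fun a : ages (ν n) => ∫⁻ w, ENNReal.ofReal
    (Real.exp (θ * |centeredCount (ν n) (√(n : ℝ)) w|)) ∂(futureLaw (ν n) a)) ⟨a, ha⟩).trans hn.le

omit [∀ n, IsProbabilityMeasure (ν n)] in
lemma tendsto_rate_div {m β : ℝ} (hm : 0 < m)
    (hHW : Tendsto (fun n : ℕ => √(n : ℝ) * (1 - rate (ν n) * m / n)) atTop (𝓝 β)) :
    Tendsto (fun n : ℕ => rate (ν n) / n) atTop (𝓝 m⁻¹) := by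
  have h1 : Tendsto (fun n : ℕ => (√(n : ℝ))⁻¹) atTop (𝓝 0) :=
    tendsto_inv_atTop_zero.comp (Real.tendsto_sqrt_atTop.comp tendsto_natCast_atTop_atTop)
  have h2 := (h1.mul hHW).const_sub 1 |>.mul_const m⁻¹
  rw [zero_mul, sub_zero, one_mul] at h2
  refine h2.congr' ?_
  filter_upwards [eventually_gt_atTop 0] with n hn
  have : √(n : ℝ) ≠ 0 := by positivity
  have hn' : (n : ℝ) ≠ 0 := by positivity
  field_simp
  ring

lemma ArrivalConditions.eventually_mean_le {ca : ℝ≥0} (hA : ArrivalConditions ν ca)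
    (hexp : ArrivalExpMoments ν) {m β : ℝ} (hm : 0 < m)
    (hHW : Tendsto (fun n : ℕ => √(n : ℝ) * (1 - rate (ν n) * m / n)) atTop (𝓝 β))
    {ε : ℝ} (hε : 0 < ε) : ∀ᶠ n : ℕ in atTop, ∀ a ∈ ages (ν n),
      ∫ w, centeredCount (ν n) (√(n : ℝ)) w ∂(futureLaw (ν n) a) ≤ ε := by
  obtain ⟨M, hM⟩ := hexp.exists_bound one_pos
  have hratio : ∀ᶠ n : ℕ in atTop, rate (ν n) / n < m⁻¹ + 1 :=
    (tendsto_rate_div hm hHW).eventually_lt_const (by linarith)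
  set R : ℝ := √(m⁻¹ + 1) with hR
  have hRpos : 0 < R := Real.sqrt_pos.2 (by positivity)
  have hmean := hA.mean.eventually_lt_const (show 0 < ε / R by positivity)
  filter_upwards [hM, hratio, hmean, eventually_gt_atTop 0,
    hA.rate_tendsto.eventually_gt_atTop 0] with n hMn hrn hmn hn hrate a ha
  have hn' : (0 : ℝ) < n := by exact_mod_cast hn
  have hsn : 0 < √(n : ℝ) := Real.sqrt_pos.2 hn'
  have hsr : 0 < √(rate (ν n)) := Real.sqrt_pos.2 hrate
  have hscale : ∀ w, centeredCount (ν n) (√(n : ℝ)) w =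
      √(rate (ν n)) / √(n : ℝ) * centeredCount (ν n) (√(rate (ν n))) w := by
    intro w
    rw [centeredCount, centeredCount]
    field_simp
  have hbdd : BddAbove (Set.range fun a : ages (ν n) =>
      ∫ w, centeredCount (ν n) (√(rate (ν n))) w ∂(futureLaw (ν n) a)) := by
    refine ⟨(√(rate (ν n)) / √(n : ℝ))⁻¹ * M, ?_⟩
    rintro _ ⟨⟨a, ha⟩, rfl⟩
    have := isProbabilityMeasure_futureLaw ha
    have h1 := (integrable_of_exp_abs (measurable_centeredCount _ _) le_rfl (hMn a ha)).2
    simp only [hscale, integral_const_mul] at h1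
    rw [← div_eq_inv_mul, le_div_iff₀ (by positivity), mul_comm]
    exact h1
  have h1 : ∫ w, centeredCount (ν n) (√(rate (ν n))) w ∂(futureLaw (ν n) a) ≤ ε / R :=
    (le_ciSup hbdd ⟨a, ha⟩).trans hmn.le
  have h2 : √(rate (ν n)) / √(n : ℝ) ≤ R := by
    rw [← Real.sqrt_div hrate.le]
    exact Real.sqrt_le_sqrt hrn.le
  simp only [hscale, integral_const_mul]
  calc _ ≤ √(rate (ν n)) / √(n : ℝ) * (ε / R) := by gcongr
    _ ≤ R * (ε / R) := by gcongr
    _ = ε := by field_simp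

/-- The number of arrivals in a unit of time, centered by the service capacity `n / m` and
divided by `√n`. -/
noncomputable def scaledNetCount (n : ℕ) (m : ℝ) (k : ℕ) : ℝ := ((k : ℝ) - n / m) / √(n : ℝ)

omit [∀ n, IsProbabilityMeasure (ν n)] in
lemma scaledNetCount_unitCount (n : ℕ) (m : ℝ) (w : ℝ × (ℕ → ℝ)) :
    scaledNetCount n m (unitCount w) = centeredCount (ν n) (√(n : ℝ)) w -
      (n / m - rate (ν n)) / √(n : ℝ) := by
  rw [scaledNetCount, centeredCount]; ring

omit [∀ n, IsProbabilityMeasure (ν n)] in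
lemma tendsto_capacity_gap {m β : ℝ} (hm : 0 < m)
    (hHW : Tendsto (fun n : ℕ => √(n : ℝ) * (1 - rate (ν n) * m / n)) atTop (𝓝 β)) :
    Tendsto (fun n : ℕ => ((n : ℝ) / m - rate (ν n)) / √(n : ℝ)) atTop (𝓝 (β / m)) := by
  refine (hHW.div_const m).congr' ?_
  filter_upwards [eventually_gt_atTop 0] with n hn
  have hn' : (0 : ℝ) < n := by exact_mod_cast hn
  have h1 : √(n : ℝ) ≠ 0 := by positivity
  have h2 : √(n : ℝ) ^ 2 = n := Real.sq_sqrt hn'.le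
  rw [div_eq_div_iff hm.ne' h1]
  field_simp
  rw [h2]

/-- The spare capacity makes the moment generating function of the net arrivals smaller than `1`
near `0`, uniformly in the age. -/
lemma ArrivalConditions.exists_mgf_bound {ca : ℝ≥0} (hA : ArrivalConditions ν ca)
    (hexp : ArrivalExpMoments ν) {m β : ℝ} (hm : 0 < m) (hβ : 0 < β)
    (hHW : Tendsto (fun n : ℕ => √(n : ℝ) * (1 - rate (ν n) * m / n)) atTop (𝓝 β)) :
    ∃ γ : ℝ, 0 < γ ∧ ∃ M : ℝ, 0 ≤ M ∧ ∀ θ : ℝ, 0 < θ → θ ≤ 1 → ∀ᶠ n : ℕ in atTop,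
      ∀ a ∈ ages (ν n), ∫⁻ w, ENNReal.ofReal (Real.exp (θ * scaledNetCount n m (unitCount w)))
        ∂(futureLaw (ν n) a) ≤ ENNReal.ofReal (Real.exp (-γ * θ + M * θ ^ 2)) := by
  obtain ⟨M, hM⟩ := hexp.exists_bound two_pos
  -- The scaled spare capacity tends to `β / m`. It eventually exceeds `2 γ`, and the conditional
  -- mean is eventually at most `γ`, which leaves a drift of `-γ`.
  set γ := β / m / 4 with hγ
  have hγ0 : 0 < γ := by positivity
  refine ⟨γ, hγ0, 2 * M, by positivity, fun θ hθ hθ1 => ?_⟩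
  filter_upwards [hM, hA.eventually_mean_le hexp hm hHW hγ0,
    (tendsto_capacity_gap hm hHW).eventually_const_lt (show 2 * γ < β / m by linarith)]
    with n hMn hmean hgap a ha
  have := isProbabilityMeasure_futureLaw ha
  have h1 := lintegral_exp_mul_le (measurable_centeredCount _ _) (hMn a ha) (hmean a ha) hθ hθ1
  simp only [scaledNetCount_unitCount (ν := ν)]
  set g := ((n : ℝ) / m - rate (ν n)) / √(n : ℝ)
  calc _ = ∫⁻ w, ENNReal.ofReal (Real.exp (-(θ * g))) *
        ENNReal.ofReal (Real.exp (θ * centeredCount (ν n) (√(n : ℝ)) w)) ∂(futureLaw (ν n) a) := by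
        refine lintegral_congr fun w => ?_
        rw [← ENNReal.ofReal_mul (Real.exp_pos _).le, ← Real.exp_add]
        congr 2; ring
    _ = ENNReal.ofReal (Real.exp (-(θ * g))) * ∫⁻ w, ENNReal.ofReal
        (Real.exp (θ * centeredCount (ν n) (√(n : ℝ)) w)) ∂(futureLaw (ν n) a) :=
        lintegral_const_mul' _ _ ENNReal.ofReal_ne_top
    _ ≤ ENNReal.ofReal (Real.exp (-(θ * g))) *
        ENNReal.ofReal (Real.exp (θ * γ + 2 * M * θ ^ 2)) := by gcongr
    _ ≤ _ := by
        rw [← ENNReal.ofReal_mul (Real.exp_pos _).le, ← Real.exp_add]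
        refine ENNReal.ofReal_le_ofReal (Real.exp_le_exp.2 ?_)
        have := mul_le_mul_of_nonneg_left hgap.le hθ.le
        linarith

lemma ArrivalExpMoments.exists_abs_bound (hexp : ArrivalExpMoments ν) {m β : ℝ} (hm : 0 < m)
    (hβ : 0 < β)
    (hHW : Tendsto (fun n : ℕ => √(n : ℝ) * (1 - rate (ν n) * m / n)) atTop (𝓝 β))
    {θ : ℝ} (hθ : 0 < θ) : ∃ M : ℝ≥0, ∀ᶠ n : ℕ in atTop, ∀ a ∈ ages (ν n),
      ∫⁻ w, ENNReal.ofReal (Real.exp (θ * |scaledNetCount n m (unitCount w)|))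
        ∂(futureLaw (ν n) a) ≤ M := by
  obtain ⟨M, hM⟩ := hexp.exists_bound hθ
  refine ⟨(Real.exp (θ * (β / m + 1))).toNNReal * M, ?_⟩
  have hlim := tendsto_capacity_gap hm hHW
  filter_upwards [hM, hlim.eventually_lt_const (show β / m < β / m + 1 by linarith),
    hlim.eventually_const_lt (show (0 : ℝ) < β / m by positivity)] with n hMn h1 h2 a ha
  simp only [scaledNetCount_unitCount (ν := ν)]
  set g := ((n : ℝ) / m - rate (ν n)) / √(n : ℝ)
  have hpt : ∀ w, ENNReal.ofReal (Real.exp (θ * |centeredCount (ν n) (√(n : ℝ)) w - g|)) ≤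
      ENNReal.ofReal (Real.exp (θ * (β / m + 1))) *
        ENNReal.ofReal (Real.exp (θ * |centeredCount (ν n) (√(n : ℝ)) w|)) := by
    intro w
    rw [← ENNReal.ofReal_mul (Real.exp_pos _).le, ← Real.exp_add, ← mul_add]
    refine ENNReal.ofReal_le_ofReal (Real.exp_le_exp.2 (mul_le_mul_of_nonneg_left ?_ hθ.le))
    have := abs_sub (centeredCount (ν n) (√(n : ℝ)) w) g
    rw [abs_of_pos h2] at this
    linarith
  refine (lintegral_mono hpt).trans ?_
  rw [lintegral_const_mul' _ _ ENNReal.ofReal_ne_top, ENNReal.coe_mul]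
  exact mul_le_mul' le_rfl (hMn a ha)

end HalfinWhitt

/-! ### Independence and exponential supermartingales -/

lemma IndepFun.prodMk_of_prodMk {Ω α β γ : Type*} [MeasurableSpace Ω] [MeasurableSpace α]
    [MeasurableSpace β] [MeasurableSpace γ] {P : Measure Ω} [IsProbabilityMeasure P]
    {X : Ω → α} {Y : Ω → β} {Z : Ω → γ} (hX : Measurable X) (hY : Measurable Y) (hZ : Measurable Z)
    (h : IndepFun X (fun ω => (Y ω, Z ω)) P) (h' : IndepFun Y Z P) :
    IndepFun (fun ω => (X ω, Y ω)) Z P := by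
  have hXY : IndepFun X Y P := h.comp (φ := id) (ψ := Prod.fst) measurable_id measurable_fst
  have := Measure.isProbabilityMeasure_map (μ := P) hX.aemeasurable
  have := Measure.isProbabilityMeasure_map (μ := P) hY.aemeasurable
  have := Measure.isProbabilityMeasure_map (μ := P) hZ.aemeasurable
  rw [indepFun_iff_map_prod_eq_prod_map_map hX.aemeasurable (hY.prodMk hZ).aemeasurable,
    (indepFun_iff_map_prod_eq_prod_map_map hY.aemeasurable hZ.aemeasurable).1 h',
    ← Measure.prodAssoc_prod] at h
  rw [indepFun_iff_map_prod_eq_prod_map_map (hX.prodMk hY).aemeasurable hZ.aemeasurable,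
    (indepFun_iff_map_prod_eq_prod_map_map hX.aemeasurable hY.aemeasurable).1 hXY]
  have h2 := congrArg (Measure.map (MeasurableEquiv.prodAssoc (α := α) (β := β) (γ := γ)).symm) h
  rw [Measure.map_map (MeasurableEquiv.measurable _) (hX.prodMk (hY.prodMk hZ)),
    Measure.map_map (MeasurableEquiv.measurable _) (MeasurableEquiv.measurable _),
    MeasurableEquiv.symm_comp_self, Measure.map_id] at h2
  exact h2

lemma measurable_indicator_add {Ω : Type*} [MeasurableSpace Ω] {H : Set Ω} {Z : Ω → ℝ≥0∞}
    (hH : MeasurableSet H) (hZ : Measurable Z) :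
    Measurable fun ω => H.indicator Z ω + Hᶜ.indicator 1 ω :=
  (hZ.indicator hH).add (measurable_one.indicator hH.compl)

/-- A product of factors with conditional expectation at most `1`, in which each factor is switched
on or off by the past, has expectation at most `1`. -/
lemma lintegral_prod_ite_le_one {Ω : Type*} {mΩ : MeasurableSpace Ω} {P : Measure Ω}
    [IsProbabilityMeasure P] (𝓕 : ℕ → MeasurableSpace Ω) (hmono : Monotone 𝓕)
    (hle : ∀ j, 𝓕 j ≤ mΩ) (H : ℕ → Set Ω) (hH : ∀ j, MeasurableSet[𝓕 j] (H j))
    (Z : ℕ → Ω → ℝ≥0∞) (hZ : ∀ j, Measurable[𝓕 (j + 1)] (Z j))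
    (hind : ∀ j, Indep (𝓕 j) (MeasurableSpace.comap (Z j) inferInstance) P)
    (hint : ∀ j, ∫⁻ ω, Z j ω ∂P ≤ 1) (M : ℕ) :
    ∫⁻ ω, ∏ j ∈ Finset.range M, ((H j).indicator (Z j) ω + (H j)ᶜ.indicator 1 ω) ∂P ≤ 1 := by
  have hmeas : ∀ M, Measurable[𝓕 M] fun ω =>
      ∏ j ∈ Finset.range M, ((H j).indicator (Z j) ω + (H j)ᶜ.indicator 1 ω) := by
    intro M
    refine @Finset.measurable_fun_prod _ _ _ _ _ _ (𝓕 M) _ _ fun j hj => ?_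
    rw [Finset.mem_range] at hj
    exact @measurable_indicator_add Ω (𝓕 M) _ _ (hmono hj.le _ (hH j))
      ((hZ j).mono (hmono hj) le_rfl)
  induction M with
  | zero => simp
  | succ M ih =>
    set F := fun ω => ∏ j ∈ Finset.range M, ((H j).indicator (Z j) ω + (H j)ᶜ.indicator 1 ω)
      with hF
    have hFm : Measurable[𝓕 M] F := hmeas M
    have hFH : Measurable[𝓕 M] ((H M).indicator F) :=
      hFm.indicator (m := 𝓕 M) (hH M)
    have hHM : MeasurableSet (H M) := hle M _ (hH M)
    have e : ∀ ω, ∏ j ∈ Finset.range (M + 1), ((H j).indicator (Z j) ω + (H j)ᶜ.indicator 1 ω) =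
        (H M).indicator F ω * Z M ω + (H M)ᶜ.indicator F ω := by
      intro ω
      rw [Finset.prod_range_succ]
      by_cases h : ω ∈ H M <;> simp [h, hF]
    have h1 := lintegral_mul_eq_lintegral_mul_lintegral_of_independent_measurableSpace (hle M)
      ((hZ M).mono (hle _) le_rfl).comap_le (hind M) hFH (comap_measurable (Z M))
    simp only [e]
    rw [lintegral_add_right _ ((hFm.mono (hle M) le_rfl).indicator hHM.compl)]
    rw [h1]
    calc _ ≤ (∫⁻ ω, (H M).indicator F ω ∂P) * 1 + ∫⁻ ω, (H M)ᶜ.indicator F ω ∂P := by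
          gcongr; exact hint M
      _ = ∫⁻ ω, F ω ∂P := by
          rw [mul_one, lintegral_indicator hHM, lintegral_indicator hHM.compl,
            lintegral_add_compl F hHM]
      _ ≤ 1 := ih

/-! ### The service times of the customers entering service -/

lemma measurable_startTime {Ω : Type*} [MeasurableSpace Ω] {n : ℕ} (hn : 0 < n)
    {r : Ω → Fin n → ℝ} {arr : Ω → ℕ → ℝ} {s : Ω → ℕ → ℕ} (hr : ∀ i, Measurable fun ω => r ω i)
    (harr : ∀ k, Measurable fun ω => arr ω k) (j : ℕ) (hs : ∀ i < j, Measurable fun ω => s ω i) :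
    Measurable fun ω => startTime n (r ω) (arr ω) (s ω) j := by
  classical
  induction j using Nat.strong_induction_on with
  | _ j ih =>
    refine measurable_of_Iic fun t => ?_
    have e : (fun ω => startTime n (r ω) (arr ω) (s ω) j) ⁻¹' Iic t = {ω | arr ω j ≤ t} ∩
        {ω | {i : Fin n | t < r ω i}.ncard + ((Finset.range j).filter fun i =>
          t < startTime n (r ω) (arr ω) (s ω) i + s ω i).card < n} := by
      ext ω
      exact startTime_le_iff hn j t
    rw [e]
    refine (measurableSet_le (harr j) measurable_const).inter
      (measurableSet_lt (Measurable.add ?_ ?_) measurable_const)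
    · refine measurable_ncard.comp (measurable_set_iff.2 fun i => ?_)
      exact measurableSet_setOfPred.1 (measurableSet_lt measurable_const (hr i))
    · simp only [Finset.card_filter]
      refine Finset.measurable_fun_sum _ fun i hi => Measurable.ite ?_ measurable_const
        measurable_const
      rw [Finset.mem_range] at hi
      have h1 := ih i hi fun k hk => hs k (hk.trans hi)
      have h2 : Measurable fun ω => (s ω i : ℝ) := measurable_from_nat.comp (hs i hi)
      exact measurableSet_lt measurable_const (h1.add h2)

section Queue

variable {n : ℕ} {Ω : Type*} [MeasurableSpace Ω] {P : Measure Ω} [IsProbabilityMeasure P]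
  {ν : Measure ℝ} {p : PMF ℕ} {K : ℕ} {D : Input n Ω}

/-- What is known before the service time of customer `j`: the initial state, all arrivals, and the
service times of the customers before `j`. -/
def Input.history (D : Input n Ω) (j : ℕ) (ω : Ω) :
    (((ℕ × (Fin n → ℝ) × ℝ) × ℝ) × (ℕ → ℝ)) × (Finset.range j → ℕ) :=
  (((D.init ω, D.first ω), fun i => D.gap i ω), fun i => D.service i ω)

omit [IsProbabilityMeasure P] in
lemma IsStationaryQueue.measurable_history (hD : IsStationaryQueue P ν p K D) (j : ℕ) :
    Measurable (D.history j) :=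
  ((hD.measurable_init.prodMk hD.measurable_first).prodMk
    (measurable_pi_iff.2 hD.measurable_gap)).prodMk
    (measurable_pi_iff.2 fun i => hD.measurable_service i)

lemma IsStationaryQueue.indepFun_history_service (hD : IsStationaryQueue P ν p K D) (j : ℕ) :
    IndepFun (D.history j) (D.service j) P := by
  have hIF := hD.measurable_init.prodMk hD.measurable_first
  have hgap : Measurable fun ω i => D.gap i ω := measurable_pi_iff.2 hD.measurable_gap
  have hser : Measurable fun ω i => D.service i ω := measurable_pi_iff.2 hD.measurable_service
  have h1 := IndepFun.prodMk_of_prodMk hIF hgap hser hD.indep_init hD.indep_gap_service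
  have h2 : IndepFun (fun ω => ((D.init ω, D.first ω), fun i => D.gap i ω))
      (fun ω => ((fun i : Finset.range j => D.service i ω), D.service j ω)) P :=
    h1.comp (φ := id) (ψ := fun s : ℕ → ℕ => ((fun i : Finset.range j => s i), s j))
      measurable_id (by fun_prop)
  have h3 : IndepFun (fun ω (i : Finset.range j) => D.service i ω) (D.service j) P := by
    have := hD.indep_service.indepFun_finset (Finset.range j) {j} (by simp) hD.measurable_service
    exact this.comp (φ := id) (ψ := fun f : (({j} : Finset ℕ) → ℕ) => f ⟨j, by simp⟩)
      measurable_id (measurable_pi_apply _)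
  exact IndepFun.prodMk_of_prodMk (hIF.prodMk hgap)
    (measurable_pi_iff.2 fun i => hD.measurable_service i) (hD.measurable_service j) h2 h3

omit [MeasurableSpace Ω] in
/-- Customer `j` enters service at a time that depends on the history before `j` only. -/
lemma measurable_start_history (hn : 0 < n) (j : ℕ) :
    Measurable[MeasurableSpace.comap (D.history j) inferInstance] fun ω => D.start ω j := by
  let m := MeasurableSpace.comap (D.history j) inferInstance
  have hh : Measurable[m] (D.history j) := comap_measurable _
  have hq : Measurable[m] D.q₀ :=
    (measurable_fst.comp (measurable_fst.comp (measurable_fst.comp measurable_fst))).comp hh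
  have hr : ∀ i, Measurable[m] fun ω => D.r ω i := fun i =>
    ((measurable_pi_apply i).comp (measurable_fst.comp (measurable_snd.comp (measurable_fst.comp
      (measurable_fst.comp measurable_fst))))).comp hh
  have hf : Measurable[m] D.first :=
    (measurable_snd.comp (measurable_fst.comp measurable_fst)).comp hh
  have hg : Measurable[m] fun ω i => D.gap i ω :=
    (measurable_snd.comp measurable_fst).comp hh
  have hs : ∀ i < j, Measurable[m] fun ω => D.service i ω := fun i hi =>
    ((measurable_pi_apply (⟨i, Finset.mem_range.2 hi⟩ : Finset.range j)).comp
      measurable_snd).comp hh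
  have harr : ∀ k, Measurable[m] fun ω => D.arr ω k := by
    intro k
    have h2 : Measurable fun z : ℕ × ℝ × (ℕ → ℝ) => arrivalTime z.1 z.2.1 z.2.2 k := by
      refine measurable_from_prod_countable_right fun q => ?_
      change Measurable fun z : ℝ × (ℕ → ℝ) => arrivalTime q z.1 z.2 k
      unfold arrivalTime
      split_ifs
      · exact measurable_const
      · fun_prop
    exact h2.comp (hq.prodMk (hf.prodMk hg))
  exact @measurable_startTime Ω m n hn D.r D.arr (fun ω i => D.service i ω) hr harr j hs

/-- The number of customers that have entered service by time `t`. -/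
noncomputable def Input.started (D : Input n Ω) (t : ℝ) (ω : Ω) : ℕ := countLE (D.start ω) t

omit [IsProbabilityMeasure P] in
lemma IsStationaryQueue.measurable_start (hD : IsStationaryQueue P ν p K D) (hn : 0 < n) (j : ℕ) :
    Measurable fun ω => D.start ω j :=
  (measurable_start_history hn j).mono (hD.measurable_history j).comap_le le_rfl

omit [IsProbabilityMeasure P] in
lemma IsStationaryQueue.measurable_started (hD : IsStationaryQueue P ν p K D) (hn : 0 < n) (t : ℝ) :
    Measurable (D.started t) :=
  measurable_countLE (hD.measurable_start hn) t

/-- The sum of `φ` over the service times of the customers that enter service in `(u, t]`. -/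
noncomputable def Input.serviceSum (D : Input n Ω) (φ : ℕ → ℝ) (u t : ℝ) (ω : Ω) : ℝ :=
  ∑ j ∈ Finset.Ico (D.started u ω) (D.started t ω), φ (D.service j ω)

omit [IsProbabilityMeasure P] in
lemma IsStationaryQueue.measurable_serviceSum (hD : IsStationaryQueue P ν p K D) (hn : 0 < n)
    (φ : ℕ → ℝ) (u t : ℝ) : Measurable (D.serviceSum φ u t) := by
  have h : Measurable fun z : (ℕ × ℕ) × Ω =>
      ∑ j ∈ Finset.Ico z.1.1 z.1.2, φ (D.service j z.2) :=
    measurable_from_prod_countable_right fun z => by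
      dsimp only
      exact Finset.measurable_fun_sum _ fun j _ =>
        (Measurable.of_discrete (f := φ)).comp (hD.measurable_service j)
  exact h.comp (((hD.measurable_started hn u).prodMk (hD.measurable_started hn t)).prodMk
    measurable_id)

omit [IsProbabilityMeasure P] in
/-- Hoeffding's lemma for a function of the service time. -/
lemma IsStationaryQueue.lintegral_exp_service_le (hD : IsStationaryQueue P ν p K D) {φ : ℕ → ℝ}
    {B : ℝ} (hB : ∀ k, |φ k| ≤ B) (hφ : ∫ k, φ k ∂p.toMeasure = 0) (s : ℝ) (j : ℕ) :
    ∫⁻ ω, ENNReal.ofReal (Real.exp (s * φ (D.service j ω) - B ^ 2 * s ^ 2 / 2)) ∂P ≤ 1 := by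
  have hm : Measurable fun k : ℕ => ENNReal.ofReal (Real.exp (s * φ k - B ^ 2 * s ^ 2 / 2)) :=
    Measurable.of_discrete
  rw [← lintegral_map (f := fun k : ℕ => ENNReal.ofReal (Real.exp (s * φ k - B ^ 2 * s ^ 2 / 2)))
    hm (hD.measurable_service j), hD.law_service]
  have hsub := hasSubgaussianMGF_of_mem_Icc_of_integral_eq_zero (μ := p.toMeasure) (X := φ)
    (a := -B) (b := B) Measurable.of_discrete.aemeasurable
    (ae_of_all _ fun k => abs_le.1 (hB k)) hφ
  have hB0 : 0 ≤ B := (abs_nonneg _).trans (hB 0)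
  have h1 := hsub.mgf_le s
  have h2 : (((‖B - -B‖₊ / 2) ^ 2 : ℝ≥0) : ℝ) = B ^ 2 := by
    push_cast
    rw [Real.norm_eq_abs, div_pow, sq_abs]; ring
  rw [h2] at h1
  have h3 : Integrable (fun k => Real.exp (s * φ k - B ^ 2 * s ^ 2 / 2)) p.toMeasure := by
    simp only [sub_eq_add_neg, Real.exp_add]
    exact (hsub.integrable_exp_mul s).mul_const _
  rw [← ofReal_integral_eq_lintegral_ofReal h3 (ae_of_all _ fun k => (Real.exp_pos _).le)]
  rw [← ENNReal.ofReal_one]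
  refine ENNReal.ofReal_le_ofReal ?_
  simp only [sub_eq_add_neg, Real.exp_add, integral_mul_const]
  rw [Real.exp_neg, ← div_eq_mul_inv, div_le_one (Real.exp_pos _)]
  exact h1

/-- Sample points at which the primitive data of the queue have no irregularities. -/
structure Input.IsRegular (D : Input n Ω) (K : ℕ) (ω : Ω) : Prop where
  path : IsRegularPath (D.arrivals ω)
  first_pos : 0 < D.first ω
  residual_le : ∀ i, D.r ω i ≤ K
  one_le_service : ∀ j, 1 ≤ D.service j ω
  service_le : ∀ j, D.service j ω ≤ K

lemma IsStationaryQueue.ae_isRegular [IsProbabilityMeasure ν] (hD : IsStationaryQueue P ν p K D)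
    (hν : IsInterarrivalLaw ν) (hp : IsServiceLaw p K) : ∀ᵐ ω ∂P, D.IsRegular K ω := by
  have hser : ∀ᵐ ω ∂P, ∀ j, 1 ≤ D.service j ω ∧ D.service j ω ≤ K := by
    refine ae_all_iff.2 fun j => ?_
    have h : ∀ᵐ k ∂p.toMeasure, 1 ≤ k ∧ k ≤ K := by
      rw [ae_iff, PMF.toMeasure_apply_eq_zero_iff p (MeasurableSet.of_discrete),
        Set.disjoint_left]
      intro k hk hk'
      rw [PMF.mem_support_iff] at hk
      refine hk' ⟨Nat.one_le_iff_ne_zero.2 fun h0 => hk (h0 ▸ hp.zero), ?_⟩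
      by_contra h
      exact hk (hp.above k (not_le.1 h))
    rw [← hD.law_service j] at h
    exact ae_of_ae_map (hD.measurable_service j).aemeasurable h
  filter_upwards [hD.ae_arrivals hν, hD.residual_mem, hser] with ω h1 h2 h3
  exact ⟨h1.1, h1.2, fun i => (h2 i).2, fun j => (h3 j).1, fun j => (h3 j).2⟩

omit [MeasurableSpace Ω] in
lemma Input.arr_eq (D : Input n Ω) (ω : Ω) (j : ℕ) :
    D.arr ω j = if j < D.q₀ ω then 0 else epoch (D.arrivals ω) (j - D.q₀ ω) := rfl

omit [MeasurableSpace Ω] in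
lemma Input.IsRegular.monotone_arr {ω : Ω} (h : D.IsRegular K ω) : Monotone (D.arr ω) := by
  intro i j hij
  have hpos : ∀ k, 0 ≤ epoch (D.arrivals ω) k := fun k =>
    le_trans (by rw [epoch_zero]; exact h.first_pos.le) (h.path.1 (Nat.zero_le k))
  rw [D.arr_eq, D.arr_eq]
  split_ifs with h1 h2
  · exact le_rfl
  · exact hpos _
  · omega
  · exact h.path.1 (by omega)

omit [MeasurableSpace Ω] in
lemma Input.IsRegular.tendsto_arr {ω : Ω} (h : D.IsRegular K ω) :
    Tendsto (D.arr ω) atTop atTop := by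
  have h1 := h.path.2.comp (tendsto_sub_atTop_nat (D.q₀ ω))
  refine h1.congr' ?_
  filter_upwards [eventually_ge_atTop (D.q₀ ω)] with j hj
  rw [D.arr_eq, if_neg (by omega)]
  rfl

omit [MeasurableSpace Ω] in
lemma Input.IsRegular.countLE_arr {ω : Ω} (h : D.IsRegular K ω) {t : ℝ} (ht : 0 ≤ t) :
    countLE (D.arr ω) t = D.q₀ ω + countLE (epoch (D.arrivals ω)) t := by
  have h1 := le_iff_lt_countLE h.monotone_arr h.tendsto_arr t
  have h2 := le_iff_lt_countLE h.path.1 h.path.2 t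
  have key : ∀ j, j < countLE (D.arr ω) t ↔ j < D.q₀ ω + countLE (epoch (D.arrivals ω)) t := by
    intro j
    rw [← h1, D.arr_eq]
    split_ifs with hj
    · exact ⟨fun _ => by omega, fun _ => ht⟩
    · rw [h2]; omega
  have a1 := key (countLE (D.arr ω) t)
  have a2 := key (D.q₀ ω + countLE (epoch (D.arrivals ω)) t)
  omega

omit [MeasurableSpace Ω] in
lemma Input.started_mono (D : Input n Ω) (hn : 0 < n) {ω : Ω} (h : D.IsRegular K ω) {u t : ℝ}
    (hut : u ≤ t) : D.started u ω ≤ D.started t ω :=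
  countLE_mono (tendsto_startTime hn h.tendsto_arr) hut

omit [MeasurableSpace Ω] in
lemma Input.IsRegular.started_add_le {ω : Ω} (h : D.IsRegular K ω) (hn : 0 < n) {u : ℝ}
    (hu : 0 ≤ u) (T : ℕ) : D.started (u + T) ω ≤ D.started u ω + n * T := by
  induction T with
  | zero => simp
  | succ T ih =>
    have := pathStarted_succ_le (t := u + T) hn h.monotone_arr h.tendsto_arr h.residual_le
      h.one_le_service h.service_le (by positivity)
    push_cast
    rw [← add_assoc, mul_add, mul_one]
    refine this.trans ?_
    change D.started (u + T) ω + n ≤ _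
    omega

/-- The service times of the customers that enter service in an interval of length `T` have
sub-Gaussian fluctuations: there are at most `n T` such customers, and each of them enters service
at a time that does not depend on its own service time. -/
lemma IsStationaryQueue.lintegral_exp_serviceSum_le [IsProbabilityMeasure ν]
    (hD : IsStationaryQueue P ν p K D) (hν : IsInterarrivalLaw ν) (hp : IsServiceLaw p K)
    (hn : 0 < n) {φ : ℕ → ℝ} {B : ℝ} (hB : ∀ k, |φ k| ≤ B) (hφ : ∫ k, φ k ∂p.toMeasure = 0)
    (s : ℝ) {u : ℝ} (hu : 0 ≤ u) (T : ℕ) :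
    ∫⁻ ω, ENNReal.ofReal (Real.exp (s * D.serviceSum φ u (u + T) ω)) ∂P ≤
      ENNReal.ofReal (Real.exp (B ^ 2 * s ^ 2 / 2 * (n * T))) := by
  set c : ℝ := B ^ 2 * s ^ 2 / 2 with hc
  have hc0 : 0 ≤ c := by positivity
  set 𝓕 : ℕ → MeasurableSpace Ω := fun j => MeasurableSpace.comap (D.history j) inferInstance
    with h𝓕
  have hmono : Monotone 𝓕 := by
    intro i j hij
    have e : D.history i = (fun z : (((ℕ × (Fin n → ℝ) × ℝ) × ℝ) × (ℕ → ℝ)) ×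
        (Finset.range j → ℕ) => (z.1, fun k : Finset.range i =>
          z.2 ⟨k, Finset.range_subset_range.2 hij k.2⟩)) ∘ D.history j := rfl
    simp only [h𝓕]
    rw [e, ← MeasurableSpace.comap_comp]
    exact MeasurableSpace.comap_mono (Measurable.comap_le (by fun_prop))
  -- Customer `j` enters service in `(u, u + T]`, an event of the history before `j`.
  set H : ℕ → Set Ω := fun j => {ω | u < D.start ω j ∧ D.start ω j ≤ u + T} with hH
  set Z : ℕ → Ω → ℝ≥0∞ := fun j ω => ENNReal.ofReal (Real.exp (s * φ (D.service j ω) - c)) with hZ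
  have hψ : Measurable fun k : ℕ => ENNReal.ofReal (Real.exp (s * φ k - c)) :=
    Measurable.of_discrete
  have hHm : ∀ j, MeasurableSet[𝓕 j] (H j) := fun j =>
    @MeasurableSet.inter _ (𝓕 j) _ _ (measurable_start_history hn j measurableSet_Ioi)
      (measurable_start_history hn j measurableSet_Iic)
  have hZm : ∀ j, Measurable[𝓕 (j + 1)] (Z j) := by
    intro j
    have h1 : Measurable[𝓕 (j + 1)] (D.service j) :=
      ((measurable_pi_apply (⟨j, by simp⟩ : Finset.range (j + 1))).comp measurable_snd).comp
        (comap_measurable (D.history (j + 1)))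
    exact hψ.comp h1
  have hind : ∀ j, Indep (𝓕 j) (MeasurableSpace.comap (Z j) inferInstance) P := fun j =>
    (hD.indepFun_history_service j).comp (φ := id) (ψ := fun k : ℕ =>
      ENNReal.ofReal (Real.exp (s * φ k - c))) measurable_id hψ
  have hmart := lintegral_prod_ite_le_one 𝓕 hmono (fun j => (hD.measurable_history j).comap_le) H hHm
    Z hZm hind (hD.lintegral_exp_service_le hB hφ s)
  set Y : ℕ → Ω → ℝ≥0∞ := fun M ω =>
    ∏ j ∈ Finset.range M, ((H j).indicator (Z j) ω + (H j)ᶜ.indicator 1 ω) with hY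
  have hYm : ∀ M, Measurable (Y M) := by
    intro M
    refine Finset.measurable_fun_prod _ fun j _ => ?_
    have h1 : MeasurableSet (H j) := (hD.measurable_history j).comap_le _ (hHm j)
    have h2 : Measurable (Z j) := (hZm j).mono (hD.measurable_history _).comap_le le_rfl
    exact measurable_indicator_add h1 h2
  have hlim : ∀ᵐ ω ∂P, ENNReal.ofReal (Real.exp (s * D.serviceSum φ u (u + T) ω)) ≤
      ENNReal.ofReal (Real.exp (c * (n * T))) * liminf (fun M => Y M ω) atTop := by
    filter_upwards [hD.ae_isRegular hν hp] with ω hω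
    set J₀ := D.started u ω with hJ₀
    set J₁ := D.started (u + T) ω with hJ₁
    have hJ : J₀ ≤ J₁ := D.started_mono hn hω (by simp)
    have hJn : J₁ ≤ J₀ + n * T := hω.started_add_le hn hu T
    have hiff := fun t j => le_iff_lt_countLE (monotone_startTime (r := D.r ω)
      (s := fun i => D.service i ω) hn hω.monotone_arr) (tendsto_startTime hn hω.tendsto_arr) t j
    have hmem : ∀ j, ω ∈ H j ↔ j ∈ Finset.Ico J₀ J₁ := by
      intro j
      rw [Finset.mem_Ico, ← not_lt]
      change u < D.start ω j ∧ D.start ω j ≤ u + T ↔ _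
      rw [← not_le]
      exact and_congr (not_congr (hiff u j)) (hiff (u + T) j)
    -- Only the customers `J₀ ≤ j < J₁` contribute, so the product is eventually constant in `M`.
    have hconst : ∀ᶠ M in atTop, Y M ω =
        ENNReal.ofReal (Real.exp (s * D.serviceSum φ u (u + T) ω - c * (J₁ - J₀))) := by
      filter_upwards [eventually_ge_atTop J₁] with M hM
      have hsub : Finset.Ico J₀ J₁ ⊆ Finset.range M := fun j hj => by
        rw [Finset.mem_Ico] at hj; rw [Finset.mem_range]; omega
      rw [hY]
      dsimp only
      rw [← Finset.prod_subset hsub fun j _ hj => ?_]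
      · have h1 : ∀ j ∈ Finset.Ico J₀ J₁, ((H j).indicator (Z j) ω + (H j)ᶜ.indicator 1 ω) =
            ENNReal.ofReal (Real.exp (s * φ (D.service j ω) - c)) := by
          intro j hj
          have := (hmem j).2 hj
          simp [this, hZ]
        rw [Finset.prod_congr rfl h1, ← ENNReal.ofReal_prod_of_nonneg
          fun _ _ => (Real.exp_pos _).le, ← Real.exp_sum, Finset.sum_sub_distrib,
          ← Finset.mul_sum, Finset.sum_const, Nat.card_Ico, nsmul_eq_mul, Nat.cast_sub hJ]
        congr 2
        rw [Input.serviceSum]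
        ring
      · have := (hmem j).not.2 hj
        simp [this]
    rw [liminf_congr hconst, liminf_const, ← ENNReal.ofReal_mul (Real.exp_pos _).le, ← Real.exp_add]
    refine ENNReal.ofReal_le_ofReal (Real.exp_le_exp.2 ?_)
    have h1 : (J₁ : ℝ) ≤ J₀ + n * T := by exact_mod_cast hJn
    have := mul_le_mul_of_nonneg_left (sub_le_iff_le_add'.2 h1) hc0
    linarith
  calc _ ≤ ∫⁻ ω, ENNReal.ofReal (Real.exp (c * (n * T))) * liminf (fun M => Y M ω) atTop ∂P :=
        lintegral_mono_ae hlim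
    _ = ENNReal.ofReal (Real.exp (c * (n * T))) * ∫⁻ ω, liminf (fun M => Y M ω) atTop ∂P :=
        lintegral_const_mul' _ _ ENNReal.ofReal_ne_top
    _ ≤ ENNReal.ofReal (Real.exp (c * (n * T))) * liminf (fun M => ∫⁻ ω, Y M ω ∂P) atTop := by
        gcongr; exact lintegral_liminf_le hYm
    _ ≤ ENNReal.ofReal (Real.exp (c * (n * T))) * 1 := by
        gcongr
        exact (liminf_le_liminf (Eventually.of_forall hmart)).trans_eq (liminf_const _)
    _ = _ := mul_one _

end Queue

/-! ### The service law -/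

section ServiceLaw

variable {p : PMF ℕ} {K : ℕ}

lemma IsServiceLaw.integral_eq (hp : IsServiceLaw p K) (f : ℕ → ℝ) :
    ∫ k, f k ∂p.toMeasure = ∑ k ∈ Finset.range K, f (k + 1) * (p (k + 1)).toReal := by
  have hsupp : ∀ k, k ∉ Finset.range (K + 1) → p k = 0 := fun k hk =>
    hp.above k (by simpa using hk)
  have hint : Integrable f p.toMeasure := by
    refine Integrable.mono' (g := fun _ => ∑ i ∈ Finset.range (K + 1), |f i|)
      (integrable_const _) Measurable.of_discrete.aestronglyMeasurable ?_
    rw [ae_iff, PMF.toMeasure_apply_eq_zero_iff p MeasurableSet.of_discrete, Set.disjoint_left]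
    intro k hk hk'
    refine hk' ?_
    by_cases h : k ∈ Finset.range (K + 1)
    · exact Finset.single_le_sum (f := fun i => |f i|) (fun _ _ => abs_nonneg _) h
    · exact absurd (hsupp k h) ((PMF.mem_support_iff p k).1 hk)
  rw [PMF.integral_eq_tsum p f hint, tsum_eq_sum (s := Finset.range (K + 1)) fun k hk => by
    rw [hsupp k hk]; simp, Finset.sum_range_succ']
  simp [hp.zero, mul_comm]

lemma IsServiceLaw.latticeWeights (hp : IsServiceLaw p K) :
    LatticeWeights (fun k => (p k).toReal) K where
  nonneg _ := ENNReal.toReal_nonneg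
  zero := by simp [hp.zero]
  above k hk := by simp [hp.above k hk]
  sum_eq_one := by
    have := hp.integral_eq fun _ => 1
    simpa using this.symm
  gcd_eq_one d hd := hp.gcd_eq_one d fun i hi => hd i
    (ENNReal.toReal_ne_zero.2 ⟨hi, PMF.apply_ne_top p i⟩)

lemma IsServiceLaw.meanService_eq (hp : IsServiceLaw p K) :
    ∑ k ∈ Finset.range K, ((k : ℝ) + 1) * (p (k + 1)).toReal = meanService p := by
  rw [meanService, hp.integral_eq]
  simp

lemma IsServiceLaw.meanService_pos (hp : IsServiceLaw p K) : 0 < meanService p := by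
  have h : ∑ k ∈ Finset.range K, (p (k + 1)).toReal ≤ meanService p := by
    rw [← hp.meanService_eq]
    refine Finset.sum_le_sum fun k _ => le_mul_of_one_le_left ENNReal.toReal_nonneg ?_
    have : (0 : ℝ) ≤ k := Nat.cast_nonneg k
    linarith
  have h1 : ∑ k ∈ Finset.range K, (p (k + 1)).toReal = 1 := hp.latticeWeights.sum_eq_one
  linarith

/-- `P[S > k] / E S`: the fraction of the servers with residual service time in `(k, k + 1]` when
all servers are busy and in equilibrium. -/
noncomputable def occupancy (p : PMF ℕ) (K k : ℕ) : ℝ :=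
  (∑ i ∈ Finset.Ico k K, (p (i + 1)).toReal) / meanService p

lemma occupancy_eq_zero {k : ℕ} (hk : K ≤ k) : occupancy p K k = 0 := by
  rw [occupancy, Finset.Ico_eq_empty_of_le hk, Finset.sum_empty, zero_div]

lemma IsServiceLaw.occupancy_eq (hp : IsServiceLaw p K) (k : ℕ) :
    occupancy p K k = occupancy p K (k + 1) + (p (k + 1)).toReal / meanService p := by
  rcases lt_or_ge k K with hk | hk
  · rw [occupancy, occupancy, Finset.sum_eq_sum_Ico_succ_bot hk]
    ring
  · rw [occupancy_eq_zero hk, occupancy_eq_zero (by omega), hp.above _ (by omega)]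
    simp

lemma IsServiceLaw.sum_occupancy (hp : IsServiceLaw p K) :
    ∑ k ∈ Finset.range K, occupancy p K k = 1 := by
  have h : ∑ k ∈ Finset.range K, ∑ i ∈ Finset.Ico k K, (p (i + 1)).toReal = meanService p := by
    rw [← hp.meanService_eq, Finset.range_eq_Ico, Finset.sum_Ico_Ico_comm]
    refine Finset.sum_congr rfl fun k _ => ?_
    rw [Finset.sum_const, Nat.card_Ico, nsmul_eq_mul]
    push_cast
    ring
  simp only [occupancy, ← Finset.sum_div, h]
  exact div_self hp.meanService_pos.ne'

/-- The centered indicator of the service time `k + 1`. -/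
noncomputable def classDev (p : PMF ℕ) (k : ℕ) (s : ℕ) : ℝ :=
  (if s = k + 1 then 1 else 0) - (p (k + 1)).toReal

lemma abs_classDev_le (p : PMF ℕ) (k s : ℕ) : |classDev p k s| ≤ 1 := by
  have h0 : 0 ≤ (p (k + 1)).toReal := ENNReal.toReal_nonneg
  have h1 : (p (k + 1)).toReal ≤ 1 := ENNReal.toReal_le_of_le_ofReal one_pos.le
    (by simpa using PMF.coe_le_one p (k + 1))
  rw [classDev, abs_le]
  split_ifs <;> constructor <;> linarith

lemma IsServiceLaw.integral_classDev (hp : IsServiceLaw p K) (k : ℕ) :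
    ∫ s, classDev p k s ∂p.toMeasure = 0 := by
  rw [hp.integral_eq]
  have h1 : ∑ i ∈ Finset.range K, (p (i + 1)).toReal = 1 := hp.latticeWeights.sum_eq_one
  simp only [classDev, sub_mul, Finset.sum_sub_distrib, ← Finset.mul_sum, h1, add_left_inj,
    ite_mul, one_mul, zero_mul, Finset.sum_ite_eq', Finset.mem_range]
  split_ifs with h
  · ring
  · rw [hp.above _ (by omega)]; simp

/-- The centered service time, as a combination of the centered indicators. -/
noncomputable def workDev (p : PMF ℕ) (K : ℕ) (s : ℕ) : ℝ :=
  ∑ k ∈ Finset.range K, ((k : ℝ) + 1) * classDev p k s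

lemma abs_workDev_le (p : PMF ℕ) (K s : ℕ) : |workDev p K s| ≤ (K : ℝ) ^ 2 := by
  refine (Finset.abs_sum_le_sum_abs _ _).trans ?_
  have : ∀ k ∈ Finset.range K, |((k : ℝ) + 1) * classDev p k s| ≤ K := by
    intro k hk
    rw [abs_mul, abs_of_nonneg (by positivity)]
    have h1 : (k : ℝ) + 1 ≤ K := by exact_mod_cast Finset.mem_range.1 hk
    calc ((k : ℝ) + 1) * |classDev p k s| ≤ ((k : ℝ) + 1) * 1 := by
          gcongr; exact abs_classDev_le p k s
      _ ≤ K := by linarith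
  refine (Finset.sum_le_sum this).trans_eq ?_
  simp [sq]

lemma IsServiceLaw.integral_workDev (hp : IsServiceLaw p K) :
    ∫ s, workDev p K s ∂p.toMeasure = 0 := by
  rw [hp.integral_eq]
  simp only [workDev, Finset.sum_mul]
  rw [Finset.sum_comm]
  refine Finset.sum_eq_zero fun k _ => ?_
  have := hp.integral_classDev k
  rw [hp.integral_eq] at this
  simp only [mul_assoc, ← Finset.mul_sum, this, mul_zero]

end ServiceLaw

/-! ### The scaled path of the queue -/

namespace Input

variable {n : ℕ} {Ω : Type*}

/-- The scaled queue length at time `t`. -/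
noncomputable def scaledQueue (D : Input n Ω) (ω : Ω) (t : ℕ) : ℝ := D.queueLength t ω / √(n : ℝ)

/-- The centered and scaled service profile at time `t`. -/
noncomputable def scaledProfile (D : Input n Ω) (p : PMF ℕ) (K : ℕ) (ω : Ω) (t k : ℕ) : ℝ :=
  (D.inService t ω k - n * occupancy p K k) / √(n : ℝ)

/-- The centered and scaled number of arrivals in `(t, t + 1]`. -/
noncomputable def scaledArrivals (D : Input n Ω) (p : PMF ℕ) (ω : Ω) (t : ℕ) : ℝ :=
  scaledNetCount n (meanService p)
    (countLE (epoch (D.arrivals ω)) (t + 1) - countLE (epoch (D.arrivals ω)) t)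

/-- The centered and scaled number of customers that enter service in `(t, t + 1]`. -/
noncomputable def scaledEntries (D : Input n Ω) (p : PMF ℕ) (ω : Ω) (t : ℕ) : ℝ :=
  ((D.started (t + 1) ω : ℝ) - D.started t ω - n / meanService p) / √(n : ℝ)

/-- The scaled deviation of the number of customers with service time `k + 1` among those that
enter service in `(t, t + 1]`. -/
noncomputable def scaledNoise (D : Input n Ω) (p : PMF ℕ) (ω : Ω) (t k : ℕ) : ℝ :=
  D.serviceSum (classDev p k) t (t + 1) ω / √(n : ℝ)

variable {D : Input n Ω} {p : PMF ℕ} {K : ℕ} {ω : Ω}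

lemma IsRegular.scaledPath (h : D.IsRegular K ω) (hn : 0 < n) (hp : IsServiceLaw p K) :
    ScaledPath K (fun k => (p k).toReal) (D.scaledQueue ω) (D.scaledProfile p K ω)
      (D.scaledArrivals p ω) (D.scaledEntries p ω) (D.scaledNoise p ω) := by
  have hs : 0 < √(n : ℝ) := Real.sqrt_pos.2 (by exact_mod_cast hn)
  have hm := hp.meanService_pos
  have ht : ∀ t : ℕ, (0 : ℝ) ≤ t := fun t => Nat.cast_nonneg t
  have hsum : ∀ t, ∑ k ∈ Finset.range K, D.scaledProfile p K ω t k =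
      ((∑ k ∈ Finset.range K, D.inService t ω k : ℕ) - (n : ℝ)) / √(n : ℝ) := by
    intro t
    simp only [scaledProfile, ← Finset.sum_div, Finset.sum_sub_distrib, ← Finset.mul_sum,
      hp.sum_occupancy, mul_one]
    push_cast
    rfl
  have hle : ∀ t : ℕ, ∑ k ∈ Finset.range K, D.inService t ω k ≤ n := fun t =>
    sum_pathInService_le hn h.monotone_arr h.tendsto_arr h.residual_le h.service_le (ht t)
  have hmono : ∀ t : ℕ, D.started t ω ≤ D.started (t + 1) ω := fun t =>
    D.started_mono hn h (by linarith)
  refine ⟨fun t => by unfold scaledQueue; positivity, fun t => ?_, fun t => ?_, fun t => ?_,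
    fun t k => ?_, fun t k hk => ?_, fun t => ?_⟩
  · rw [hsum]
    refine div_nonpos_of_nonpos_of_nonneg (sub_nonpos.2 ?_) hs.le
    exact_mod_cast hle t
  · rcases Nat.eq_zero_or_pos (D.queueLength t ω) with h0 | h0
    · left; rw [scaledQueue, h0]; simp
    · right
      have : ∑ k ∈ Finset.range K, D.inService t ω k = n :=
        sum_pathInService_eq hn h.monotone_arr h.tendsto_arr h.residual_le h.service_le (ht t) h0
      rw [hsum, this]; simp
  · have e : ∀ u : ℝ, 0 ≤ u → (D.queueLength u ω : ℝ) + D.started u ω =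
        D.q₀ ω + countLE (epoch (D.arrivals ω)) u := by
      intro u hu
      have h1 : D.queueLength u ω + D.started u ω = countLE (D.arr ω) u :=
        pathQueue_add_started hn h.monotone_arr h.tendsto_arr u
      rw [h.countLE_arr hu] at h1
      exact_mod_cast h1
    have h1 := e t (ht t)
    have h2 := e (t + 1) (by positivity)
    have h3 : countLE (epoch (D.arrivals ω)) t ≤ countLE (epoch (D.arrivals ω)) (t + 1) :=
      countLE_mono h.path.2 (by linarith)
    simp only [scaledQueue, scaledArrivals, scaledEntries, scaledNetCount, Nat.cast_sub h3]
    rw [← add_div, ← sub_div]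
    congr 1
    push_cast
    linarith
  · have h1 : D.inService (t + 1) ω k = D.inService t ω (k + 1) +
        ((Finset.Ico (D.started t ω) (D.started (t + 1) ω)).filter fun j =>
          D.service j ω = k + 1).card :=
      pathInService_succ hn h.monotone_arr h.tendsto_arr t k
    have h2 : D.serviceSum (classDev p k) t (t + 1) ω =
        ((Finset.Ico (D.started t ω) (D.started (t + 1) ω)).filter fun j =>
          D.service j ω = k + 1).card -
          (p (k + 1)).toReal * ((D.started (t + 1) ω : ℝ) - D.started t ω) := by
      simp only [serviceSum, classDev, Finset.sum_sub_distrib, Finset.sum_const, Nat.card_Ico,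
        nsmul_eq_mul, Nat.cast_sub (hmono t), Finset.sum_boole]
      ring
    have h3 := hp.occupancy_eq k
    simp only [scaledProfile, scaledNoise, scaledEntries, h2]
    push_cast
    rw [h1, h3]
    push_cast
    field_simp
    ring
  · have : D.inService t ω k = 0 :=
      pathInService_eq_zero h.residual_le h.service_le (ht t) hk
    rw [scaledProfile, this, occupancy_eq_zero hk]
    simp
  · have hz : ∀ j, ∑ k ∈ Finset.range K, classDev p k (D.service j ω) = 0 := by
      intro j
      have h1 : ∑ i ∈ Finset.range K, (p (i + 1)).toReal = 1 := hp.latticeWeights.sum_eq_one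
      have h2 : ∑ k ∈ Finset.range K, (if D.service j ω = k + 1 then (1 : ℝ) else 0) = 1 := by
        have a1 := h.one_le_service j
        have a2 := h.service_le j
        rw [Finset.sum_eq_single_of_mem (D.service j ω - 1) (by rw [Finset.mem_range]; omega)]
        · rw [if_pos (by omega)]
        · exact fun b _ hb => if_neg (by omega)
      simp only [classDev, Finset.sum_sub_distrib, h1, h2, sub_self]
    simp only [scaledNoise, ← Finset.sum_div, serviceSum]
    rw [Finset.sum_comm]
    simp [hz]

/-- The arrivals' part of the net input over `[τ, τ + T)`. -/
lemma IsRegular.sum_scaledArrivals (h : D.IsRegular K ω) (τ T : ℕ) :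
    ∑ i ∈ Finset.Ico τ (τ + T), D.scaledArrivals p ω i =
      ((countLE (epoch (D.arrivals ω)) (τ + T) - countLE (epoch (D.arrivals ω)) τ : ℕ) -
        T * (n / meanService p)) / √(n : ℝ) := by
  have hmono := countLE_mono (f := epoch (D.arrivals ω)) h.path.2
  induction T with
  | zero => simp
  | succ T ih =>
    have h1 : countLE (epoch (D.arrivals ω)) τ ≤ countLE (epoch (D.arrivals ω)) (τ + T) :=
      hmono (by simp)
    have h2 : countLE (epoch (D.arrivals ω)) (τ + T) ≤
        countLE (epoch (D.arrivals ω)) (τ + T + 1) := hmono (by simp)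
    rw [← add_assoc, Finset.sum_Ico_succ_top (by omega), ih, scaledArrivals, scaledNetCount]
    push_cast
    rw [← add_assoc, Nat.cast_sub h1, Nat.cast_sub h2, Nat.cast_sub (h1.trans h2)]
    ring

/-- The services' part of the net input over `[τ, τ + T)`. -/
lemma IsRegular.sum_scaledNoise (h : D.IsRegular K ω) (hn : 0 < n) (τ T : ℕ) :
    ∑ i ∈ Finset.Ico τ (τ + T), ∑ k ∈ Finset.range K, ((k : ℝ) + 1) * D.scaledNoise p ω i k =
      D.serviceSum (workDev p K) τ (τ + T) ω / √(n : ℝ) := by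
  have h0 : ∀ i, ∑ k ∈ Finset.range K, ((k : ℝ) + 1) * D.scaledNoise p ω i k =
      D.serviceSum (workDev p K) i (i + 1) ω / √(n : ℝ) := by
    intro i
    simp only [scaledNoise, serviceSum, workDev]
    rw [Finset.sum_comm, Finset.sum_div]
    exact Finset.sum_congr rfl fun k _ => by rw [← Finset.mul_sum]; ring
  simp only [h0]
  induction T with
  | zero => simp [serviceSum]
  | succ T ih =>
    have h1 : D.started τ ω ≤ D.started (τ + T) ω := D.started_mono hn h (by simp)
    have h2 : D.started (τ + T) ω ≤ D.started (τ + T + 1) ω := D.started_mono hn h (by simp)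
    rw [← add_assoc, Finset.sum_Ico_succ_top (by omega), ih, ← add_div]
    congr 1
    push_cast
    rw [← add_assoc]
    exact Finset.sum_Ico_consecutive _ h1 h2

end Input

/-! ### Hölder's inequality for exponential moments -/

/-- `expMoment P X = E e^X`. -/
noncomputable def expMoment {Ω : Type*} [MeasurableSpace Ω] (P : Measure Ω) (X : Ω → ℝ) : ℝ≥0∞ :=
  ∫⁻ ω, ENNReal.ofReal (Real.exp (X ω)) ∂P

section Holder

variable {Ω : Type*} [MeasurableSpace Ω] {P : Measure Ω}

lemma AEMeasurable.ofReal_exp {X : Ω → ℝ} (hX : AEMeasurable X P) :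
    AEMeasurable (fun ω => ENNReal.ofReal (Real.exp (X ω))) P :=
  (Real.measurable_exp.comp_aemeasurable hX).ennreal_ofReal

lemma expMoment_mono {X Y : Ω → ℝ} (h : ∀ᵐ ω ∂P, X ω ≤ Y ω) : expMoment P X ≤ expMoment P Y :=
  lintegral_mono_ae (h.mono fun _ hω => ENNReal.ofReal_le_ofReal (Real.exp_le_exp.2 hω))

/-- Hölder's inequality with equal exponents. -/
lemma expMoment_sum_le [IsProbabilityMeasure P] {ι : Type*} (s : Finset ι) {X : ι → Ω → ℝ}
    (hX : ∀ i ∈ s, AEMeasurable (X i) P) {β : ι → ℝ}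
    (h : ∀ i ∈ s, expMoment P (fun ω => s.card * X i ω) ≤ ENNReal.ofReal (Real.exp (β i))) :
    expMoment P (fun ω => ∑ i ∈ s, X i ω) ≤
      ENNReal.ofReal (Real.exp ((∑ i ∈ s, β i) / s.card)) := by
  rcases s.eq_empty_or_nonempty with rfl | hs
  · simp [expMoment]
  have hc : (0 : ℝ) < s.card := by exact_mod_cast hs.card_pos
  have key : ∀ x : ℝ, ENNReal.ofReal (Real.exp (s.card * x)) ^ ((s.card : ℝ)⁻¹) =
      ENNReal.ofReal (Real.exp x) := by
    intro x
    rw [ENNReal.ofReal_rpow_of_pos (Real.exp_pos _), ← Real.exp_mul]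
    congr 2
    field_simp
  have h1 := ENNReal.lintegral_prod_norm_pow_le (μ := P) s
    (f := fun i ω => ENNReal.ofReal (Real.exp (s.card * X i ω)))
    (fun i hi => AEMeasurable.ofReal_exp ((hX i hi).const_mul _))
    (p := fun _ => (s.card : ℝ)⁻¹) (by simp [hc.ne']) (fun _ _ => by positivity)
  simp only [key] at h1
  calc expMoment P (fun ω => ∑ i ∈ s, X i ω)
      = ∫⁻ ω, ∏ i ∈ s, ENNReal.ofReal (Real.exp (X i ω)) ∂P := by
        refine lintegral_congr fun ω => ?_
        rw [Real.exp_sum, ENNReal.ofReal_prod_of_nonneg fun _ _ => (Real.exp_pos _).le]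
    _ ≤ ∏ i ∈ s, (∫⁻ ω, ENNReal.ofReal (Real.exp (s.card * X i ω)) ∂P) ^ ((s.card : ℝ)⁻¹) := h1
    _ ≤ ∏ i ∈ s, ENNReal.ofReal (Real.exp (β i)) ^ ((s.card : ℝ)⁻¹) := by
        refine Finset.prod_le_prod' fun i hi => ?_
        gcongr
        exact h i hi
    _ = _ := by
        rw [Finset.prod_congr rfl fun i _ => by
          rw [ENNReal.ofReal_rpow_of_pos (Real.exp_pos _), ← Real.exp_mul],
          ← ENNReal.ofReal_prod_of_nonneg fun _ _ => (Real.exp_pos _).le, ← Real.exp_sum,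
          ← Finset.sum_mul, div_eq_mul_inv]

/-- If the law of `X` is that of a variable `X'` bounded by `(1 - δ) X` up to noise, then `X`
inherits the exponential moments of the noise. -/
lemma expMoment_le_of_contraction {X X' Y : Ω → ℝ} (hX : AEMeasurable X P) (hY : AEMeasurable Y P)
    (hlaw : expMoment P X = expMoment P X') (hfin : expMoment P X ≠ ⊤) {δ : ℝ} (hδ : 0 < δ)
    (hδ1 : δ < 1) (hle : ∀ᵐ ω ∂P, X' ω ≤ (1 - δ) * X ω + δ * Y ω) :
    expMoment P X ≤ expMoment P Y := by
  rcases eq_or_ne (expMoment P X) 0 with h0 | h0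
  · rw [h0]; exact zero_le
  have key : ∀ x c : ℝ, ENNReal.ofReal (Real.exp (c * x)) = ENNReal.ofReal (Real.exp x) ^ c := by
    intro x c
    rw [ENNReal.ofReal_rpow_of_pos (Real.exp_pos _), ← Real.exp_mul, mul_comm]
  have h1 : expMoment P X ≤ expMoment P X ^ (1 - δ) * expMoment P Y ^ δ := by
    calc expMoment P X = expMoment P X' := hlaw
      _ ≤ expMoment P fun ω => (1 - δ) * X ω + δ * Y ω := expMoment_mono hle
      _ = ∫⁻ ω, ENNReal.ofReal (Real.exp (X ω)) ^ (1 - δ) *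
          ENNReal.ofReal (Real.exp (Y ω)) ^ δ ∂P := by
          refine lintegral_congr fun ω => ?_
          rw [← key, ← key, ← ENNReal.ofReal_mul (Real.exp_pos _).le, ← Real.exp_add]
      _ ≤ _ := ENNReal.lintegral_mul_norm_pow_le (AEMeasurable.ofReal_exp hX)
          (AEMeasurable.ofReal_exp hY) (by linarith) hδ.le (by ring)
  have h2 : expMoment P X = expMoment P X ^ (1 - δ) * expMoment P X ^ δ := by
    rw [← ENNReal.rpow_add _ _ h0 hfin, sub_add_cancel, ENNReal.rpow_one]
  have h3 : expMoment P X ^ δ ≤ expMoment P Y ^ δ := by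
    rw [h2] at h1
    have hne : expMoment P X ^ (1 - δ) ≠ 0 := by
      rw [Ne, ENNReal.rpow_eq_zero_iff]
      push Not
      exact ⟨fun h => absurd h h0, fun h => absurd h hfin⟩
    have hnt : expMoment P X ^ (1 - δ) ≠ ⊤ :=
      ENNReal.rpow_ne_top_of_nonneg (by linarith) hfin
    have h4 : expMoment P X ^ (1 - δ) * expMoment P X ^ δ ≤
        expMoment P X ^ (1 - δ) * expMoment P Y ^ δ := by
      rw [← h2] at h1 ⊢; exact h1
    exact (ENNReal.mul_le_mul_iff_right hne hnt).1 h4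
  exact (ENNReal.rpow_le_rpow_iff hδ).1 h3

end Holder

/-! ### Moments of the scaled queue -/

section Queue

variable {n : ℕ} {Ω : Type*} [MeasurableSpace Ω] {P : Measure Ω} [IsProbabilityMeasure P]
  {ν : Measure ℝ} [IsProbabilityMeasure ν] {p : PMF ℕ} {K : ℕ} {D : Input n Ω}

omit [IsProbabilityMeasure P] [IsProbabilityMeasure ν] in
lemma IsStationaryQueue.measurable_scaledArrivals (hD : IsStationaryQueue P ν p K D) (t : ℕ) :
    Measurable fun ω => D.scaledArrivals p ω t := by
  have h : ∀ u : ℝ, Measurable fun ω => countLE (epoch (D.arrivals ω)) u := fun u =>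
    (measurable_countLE measurable_epoch u).comp hD.measurable_arrivals
  exact (Measurable.of_discrete (f := scaledNetCount n (meanService p))).comp
    ((h (t + 1)).sub (h t))

omit [IsProbabilityMeasure P] [IsProbabilityMeasure ν] in
lemma IsStationaryQueue.measurable_scaledNoise (hD : IsStationaryQueue P ν p K D) (hn : 0 < n)
    (t k : ℕ) : Measurable fun ω => D.scaledNoise p ω t k :=
  (hD.measurable_serviceSum hn _ _ _).div_const _

/-- The norm of the scaled service profile as a function of the state of the queue. -/
noncomputable def profileNorm (n : ℕ) (p : PMF ℕ) (K : ℕ) (x : ℕ × (Fin K → ℕ)) : ℝ :=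
  ∑ k : Fin K, |((x.2 k : ℝ) - n * occupancy p K k) / √(n : ℝ)|

omit [MeasurableSpace Ω] in
lemma Input.l1_scaledProfile (D : Input n Ω) (ω : Ω) (t : ℕ) :
    l1 K (D.scaledProfile p K ω t) = profileNorm n p K (D.state K t ω) := by
  rw [l1, Finset.sum_range]
  rfl

omit [IsProbabilityMeasure P] [IsProbabilityMeasure ν] in
lemma IsStationaryQueue.aemeasurable_state (hD : IsStationaryQueue P ν p K D) (t : ℕ) {α : Type*}
    [MeasurableSpace α] (f : ℕ × (Fin K → ℕ) → α) : AEMeasurable (fun ω => f (D.state K t ω)) P :=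
  (Measurable.of_discrete (f := f)).comp_aemeasurable
    (hD.stationary t (Nat.cast_nonneg t)).aemeasurable_fst

omit [IsProbabilityMeasure P] [IsProbabilityMeasure ν] in
lemma IsStationaryQueue.lintegral_state (hD : IsStationaryQueue P ν p K D) (t : ℕ)
    (f : ℕ × (Fin K → ℕ) → ℝ≥0∞) :
    ∫⁻ ω, f (D.state K t ω) ∂P = ∫⁻ ω, f (D.state K 0 ω) ∂P :=
  ((hD.stationary t (Nat.cast_nonneg t)).comp (Measurable.of_discrete (f := f))).lintegral_eq

omit [IsProbabilityMeasure P] [IsProbabilityMeasure ν] in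
lemma IsStationaryQueue.aemeasurable_l1 (hD : IsStationaryQueue P ν p K D) (t : ℕ) :
    AEMeasurable (fun ω => l1 K (D.scaledProfile p K ω t)) P := by
  simp only [Input.l1_scaledProfile]
  exact hD.aemeasurable_state t _

lemma IsStationaryQueue.expMoment_scaledArrivals_le (hD : IsStationaryQueue P ν p K D)
    (hν : IsInterarrivalLaw ν) {θ : ℝ} {c : ℝ≥0∞}
    (hc : ∀ a ∈ ages ν, ∫⁻ w, ENNReal.ofReal
      (Real.exp (θ * |scaledNetCount n (meanService p) (unitCount w)|)) ∂(futureLaw ν a) ≤ c)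
    (t : ℕ) : expMoment P (fun ω => θ * |D.scaledArrivals p ω t|) ≤ c :=
  hD.lintegral_count_le hν
    (fun k => ENNReal.ofReal (Real.exp (θ * |scaledNetCount n (meanService p) k|))) 1 hc
    (Nat.cast_nonneg t)

lemma IsStationaryQueue.expMoment_scaledNoise_le (hD : IsStationaryQueue P ν p K D)
    (hν : IsInterarrivalLaw ν) (hp : IsServiceLaw p K) (hn : 0 < n) (θ : ℝ) (t k : ℕ) :
    expMoment P (fun ω => θ * |D.scaledNoise p ω t k|) ≤
      ENNReal.ofReal (2 * Real.exp (θ ^ 2 / 2)) := by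
  have hn' : (0 : ℝ) < n := by exact_mod_cast hn
  have h1 : ∀ θ : ℝ, ∫⁻ ω, ENNReal.ofReal (Real.exp (θ * D.scaledNoise p ω t k)) ∂P ≤
      ENNReal.ofReal (Real.exp (θ ^ 2 / 2)) := by
    intro θ
    have h := hD.lintegral_exp_serviceSum_le hν hp hn (abs_classDev_le p k)
      (hp.integral_classDev k) (θ / √(n : ℝ)) (Nat.cast_nonneg t) 1
    have e : (1 : ℝ) ^ 2 * (θ / √(n : ℝ)) ^ 2 / 2 * (n * (1 : ℕ)) = θ ^ 2 / 2 := by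
      rw [div_pow, Real.sq_sqrt hn'.le]; push_cast; field_simp
    rw [e] at h
    refine le_trans (le_of_eq (lintegral_congr fun ω => ?_)) h
    congr 2
    rw [Input.scaledNoise]
    push_cast
    ring
  have hm : Measurable fun ω => ENNReal.ofReal (Real.exp (θ * D.scaledNoise p ω t k)) := by
    have := hD.measurable_scaledNoise hn t k
    fun_prop
  calc _ ≤ ∫⁻ ω, (ENNReal.ofReal (Real.exp (θ * D.scaledNoise p ω t k)) +
        ENNReal.ofReal (Real.exp (-θ * D.scaledNoise p ω t k))) ∂P := by
        refine lintegral_mono fun ω => ?_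
        rw [← ENNReal.ofReal_add (Real.exp_pos _).le (Real.exp_pos _).le]
        refine ENNReal.ofReal_le_ofReal ?_
        have a1 := Real.exp_pos (θ * D.scaledNoise p ω t k)
        have a2 := Real.exp_pos (-θ * D.scaledNoise p ω t k)
        beta_reduce
        rcases abs_cases (D.scaledNoise p ω t k) with ⟨h, _⟩ | ⟨h, _⟩
        · rw [h]; linarith
        · rw [h, mul_neg, ← neg_mul]; linarith
    _ = ∫⁻ ω, ENNReal.ofReal (Real.exp (θ * D.scaledNoise p ω t k)) ∂P +
        ∫⁻ ω, ENNReal.ofReal (Real.exp (-θ * D.scaledNoise p ω t k)) ∂P :=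
        lintegral_add_left hm _
    _ ≤ ENNReal.ofReal (Real.exp (θ ^ 2 / 2)) + ENNReal.ofReal (Real.exp (θ ^ 2 / 2)) := by
        gcongr
        · exact h1 θ
        · simpa using h1 (-θ)
    _ = _ := by rw [← ENNReal.ofReal_add (Real.exp_pos _).le (Real.exp_pos _).le, two_mul]

/-- The noise accumulated over `N` units of time has exponential moments. -/
lemma IsStationaryQueue.expMoment_err_le (hD : IsStationaryQueue P ν p K D)
    (hν : IsInterarrivalLaw ν) (hp : IsServiceLaw p K) (hn : 0 < n) (N : ℕ) {κ : ℝ}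
    {β : ℝ} (hβ0 : 0 ≤ β)
    (hβ : ∀ a ∈ ages ν, ∫⁻ w, ENNReal.ofReal (Real.exp ((N * (K + 1) : ℕ) * κ *
      |scaledNetCount n (meanService p) (unitCount w)|)) ∂(futureLaw ν a)
        ≤ ENNReal.ofReal (Real.exp β))
    (hβ' : 2 * Real.exp (((N * (K + 1) : ℕ) * κ) ^ 2 / 2) ≤ Real.exp β) :
    expMoment P (fun ω => κ * ∑ i ∈ Finset.range N,
      ScaledPath.err K (D.scaledArrivals p ω) (D.scaledNoise p ω) i) ≤
        ENNReal.ofReal (Real.exp β) := by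
  -- The index `(i, 0)` stands for the arrivals of step `i`, and `(i, k + 1)` for service class `k`.
  set s : Finset (ℕ × ℕ) := Finset.range N ×ˢ Finset.range (K + 1) with hs
  have hcard : s.card = N * (K + 1) := by simp [hs]
  set X : ℕ × ℕ → Ω → ℝ := fun i ω => κ * (if i.2 = 0 then |D.scaledArrivals p ω i.1| else
    |D.scaledNoise p ω i.1 (i.2 - 1)|) with hX
  have hXm : ∀ i ∈ s, AEMeasurable (X i) P := by
    intro i _
    have h1 := hD.measurable_scaledArrivals i.1
    have h2 := hD.measurable_scaledNoise hn i.1 (i.2 - 1)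
    by_cases h : i.2 = 0
    · simp only [hX, h, if_true]
      exact (h1.abs.const_mul κ).aemeasurable
    · simp only [hX, h, if_false]
      exact (h2.abs.const_mul κ).aemeasurable
  have hsum : ∀ ω, κ * ∑ i ∈ Finset.range N,
      ScaledPath.err K (D.scaledArrivals p ω) (D.scaledNoise p ω) i = ∑ i ∈ s, X i ω := by
    intro ω
    rw [hs, Finset.sum_product, Finset.mul_sum]
    refine Finset.sum_congr rfl fun i _ => ?_
    simp only [hX, Finset.sum_range_succ', ScaledPath.err, l1, mul_add, Finset.mul_sum]
    simp
    ring
  simp only [hsum]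
  have h := expMoment_sum_le (P := P) s hXm (β := fun _ => β) fun i _ => by
    by_cases h : i.2 = 0
    · simp only [hX, h, if_true, ← mul_assoc, hcard]
      exact hD.expMoment_scaledArrivals_le hν hβ i.1
    · simp only [hX, h, if_false, ← mul_assoc, hcard]
      exact (hD.expMoment_scaledNoise_le hν hp hn _ _ _).trans
        (ENNReal.ofReal_le_ofReal hβ')
  refine h.trans (ENNReal.ofReal_le_ofReal (Real.exp_le_exp.2 ?_))
  rw [Finset.sum_const, nsmul_eq_mul]
  rcases eq_or_ne (s.card : ℝ) 0 with h0 | h0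
  · rw [h0]; simpa using hβ0
  · rw [mul_div_cancel_left₀ _ h0]

/-- Stationarity and contraction bound the exponential moments of the service profile. They are
finite to begin with, since at most `n` customers are in service. -/
lemma IsStationaryQueue.expMoment_l1_le (hD : IsStationaryQueue P ν p K D)
    (hν : IsInterarrivalLaw ν) (hp : IsServiceLaw p K) (hn : 0 < n) {N : ℕ} {δ : ℝ} (hδ : 0 < δ)
    (hδ1 : δ < 1)
    (hcontr : ∀ {q : ℕ → ℝ} {l : ℕ → ℕ → ℝ} {a b : ℕ → ℝ} {ξ : ℕ → ℕ → ℝ},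
      ScaledPath K (fun k => (p k).toReal) q l a b ξ → ∀ t, l1 K (l (t + N)) ≤
        (1 - δ) * l1 K (l t) + 2 * ∑ i ∈ Finset.range N, ScaledPath.err K a ξ (t + i))
    {η : ℝ} (hη : 0 ≤ η) {β : ℝ}
    (herr : expMoment P (fun ω => 2 * η / δ * ∑ i ∈ Finset.range N,
      ScaledPath.err K (D.scaledArrivals p ω) (D.scaledNoise p ω) i) ≤
        ENNReal.ofReal (Real.exp β)) (t : ℕ) :
    expMoment P (fun ω => η * l1 K (D.scaledProfile p K ω t)) ≤ ENNReal.ofReal (Real.exp β) := by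
  have hstat : ∀ t, expMoment P (fun ω => η * l1 K (D.scaledProfile p K ω t)) =
      expMoment P (fun ω => η * l1 K (D.scaledProfile p K ω 0)) := by
    intro t
    simp only [Input.l1_scaledProfile, expMoment]
    simpa using hD.lintegral_state t
      fun x => ENNReal.ofReal (Real.exp (η * profileNorm n p K x))
  rw [hstat]
  have hfin : expMoment P (fun ω => η * l1 K (D.scaledProfile p K ω 0)) ≠ ⊤ := by
    set C : ℝ := ∑ k ∈ Finset.range K, ((n : ℝ) + |n * occupancy p K k|) / √(n : ℝ)
    have hle : ∀ᵐ ω ∂P, η * l1 K (D.scaledProfile p K ω 0) ≤ η * C := by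
      filter_upwards [hD.ae_isRegular hν hp] with ω hω
      refine mul_le_mul_of_nonneg_left (Finset.sum_le_sum fun k hk => ?_) hη
      rw [Input.scaledProfile, abs_div, abs_of_nonneg (Real.sqrt_nonneg _)]
      gcongr
      refine (abs_sub _ _).trans (add_le_add ?_ le_rfl)
      rw [abs_of_nonneg (Nat.cast_nonneg _)]
      have h1 := sum_pathInService_le hn hω.monotone_arr hω.tendsto_arr hω.residual_le
        hω.service_le (t := ((0 : ℕ) : ℝ)) (by simp)
      have h2 : D.inService ((0 : ℕ) : ℝ) ω k ≤ n :=
        (Finset.single_le_sum (f := fun k => D.inService ((0 : ℕ) : ℝ) ω k)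
          (fun _ _ => Nat.zero_le _) hk).trans h1
      exact_mod_cast h2
    refine ((expMoment_mono hle).trans_lt ?_).ne
    simp [expMoment]
  have herrm : AEMeasurable (fun ω => 2 * η / δ * ∑ i ∈ Finset.range N,
      ScaledPath.err K (D.scaledArrivals p ω) (D.scaledNoise p ω) i) P := by
    refine (Finset.measurable_fun_sum _ fun i _ => ?_).const_mul _ |>.aemeasurable
    exact (hD.measurable_scaledArrivals i).abs.add
      (Finset.measurable_fun_sum _ fun k _ => (hD.measurable_scaledNoise hn i k).abs)
  refine (expMoment_le_of_contraction ((hD.aemeasurable_l1 0).const_mul η) herrm (hstat N).symm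
    hfin hδ hδ1 ?_).trans herr
  filter_upwards [hD.ae_isRegular hν hp] with ω hω
  have := mul_le_mul_of_nonneg_left (hcontr (hω.scaledPath hn hp) 0) hη
  simp only [zero_add] at this
  refine this.trans_eq ?_
  field_simp

/-- The net input over `T` units of time has a moment generating function that decays
geometrically. -/
lemma IsStationaryQueue.expMoment_sum_scaledArrivals_le (hD : IsStationaryQueue P ν p K D)
    (hν : IsInterarrivalLaw ν) (hp : IsServiceLaw p K) {θ g : ℝ}
    (hg : ∀ a ∈ ages ν, ∫⁻ w, ENNReal.ofReal
      (Real.exp (θ * scaledNetCount n (meanService p) (unitCount w))) ∂(futureLaw ν a) ≤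
        ENNReal.ofReal (Real.exp g)) (τ T : ℕ) :
    expMoment P (fun ω => θ * ∑ i ∈ Finset.Ico τ (τ + T), D.scaledArrivals p ω i) ≤
      ENNReal.ofReal (Real.exp (g * T)) := by
  have e : ∀ x : ℝ, θ * (x / √(n : ℝ)) = θ / √(n : ℝ) * x := fun x => by ring
  have h1 := fun a (ha : a ∈ ages ν) => lintegral_exp_count_le_pow hν (θ / √(n : ℝ))
    (n / meanService p) (c := ENNReal.ofReal (Real.exp g))
    (by simpa only [scaledNetCount, e] using hg) T ha
  have h2 := hD.lintegral_count_le hν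
    (fun k => ENNReal.ofReal (Real.exp (θ / √(n : ℝ) * (k - T * (n / meanService p))))) T h1
    (Nat.cast_nonneg τ)
  rw [← ENNReal.ofReal_pow (Real.exp_pos _).le, ← Real.exp_nat_mul, mul_comm (T : ℝ) g] at h2
  refine le_trans (lintegral_mono_ae ?_) h2
  filter_upwards [hD.ae_isRegular hν hp] with ω hω
  rw [hω.sum_scaledArrivals, e]

lemma IsStationaryQueue.expMoment_sum_scaledNoise_le (hD : IsStationaryQueue P ν p K D)
    (hν : IsInterarrivalLaw ν) (hp : IsServiceLaw p K) (hn : 0 < n) (θ : ℝ) (τ T : ℕ) :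
    expMoment P (fun ω => θ * ∑ i ∈ Finset.Ico τ (τ + T), ∑ k ∈ Finset.range K,
      ((k : ℝ) + 1) * D.scaledNoise p ω i k) ≤
      ENNReal.ofReal (Real.exp ((K : ℝ) ^ 4 * θ ^ 2 / 2 * T)) := by
  have hn' : (0 : ℝ) < n := by exact_mod_cast hn
  have h := hD.lintegral_exp_serviceSum_le hν hp hn (abs_workDev_le p K) hp.integral_workDev
    (θ / √(n : ℝ)) (Nat.cast_nonneg τ) T
  have e : ((K : ℝ) ^ 2) ^ 2 * (θ / √(n : ℝ)) ^ 2 / 2 * (n * T) = (K : ℝ) ^ 4 * θ ^ 2 / 2 * T := by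
    rw [div_pow, Real.sq_sqrt hn'.le]; field_simp
  rw [e] at h
  refine le_trans (lintegral_mono_ae ?_) h
  filter_upwards [hD.ae_isRegular hν hp] with ω hω
  rw [hω.sum_scaledNoise hn]
  refine le_of_eq ?_
  congr 2
  ring

/-- The exponent in the workload bound that belongs to the time `τ`. -/
noncomputable def Input.workBound (D : Input n Ω) (p : PMF ℕ) (K : ℕ) (τ t : ℕ) (ω : Ω) : ℝ :=
  (K + 1) * l1 K (D.scaledProfile p K ω τ) + K * l1 K (D.scaledProfile p K ω t) +
    ScaledPath.netInput K (meanService p) (D.scaledArrivals p ω) (D.scaledNoise p ω) τ t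

omit [IsProbabilityMeasure P] [IsProbabilityMeasure ν] in
lemma IsStationaryQueue.aemeasurable_workBound (hD : IsStationaryQueue P ν p K D) (hn : 0 < n)
    (τ t : ℕ) : AEMeasurable (D.workBound p K τ t) P := by
  refine (((hD.aemeasurable_l1 τ).const_mul _).add ((hD.aemeasurable_l1 t).const_mul _)).add ?_
  refine (Finset.measurable_fun_sum _ fun i _ => ?_).aemeasurable
  exact ((hD.measurable_scaledArrivals i).const_mul _).add
    (Finset.measurable_fun_sum _ fun k _ => (hD.measurable_scaledNoise hn i k).const_mul _)

/-- Hölder's inequality separates the service profiles, the arrivals and the service times in the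
workload bound. -/
lemma IsStationaryQueue.expMoment_workBound_le (hD : IsStationaryQueue P ν p K D)
    (hν : IsInterarrivalLaw ν) (hp : IsServiceLaw p K) (hn : 0 < n) {θ : ℝ} (hθ : 0 ≤ θ) {β g : ℝ}
    (hl : ∀ t, expMoment P (fun ω => 4 * θ * (K + 1) * l1 K (D.scaledProfile p K ω t)) ≤
      ENNReal.ofReal (Real.exp β))
    (hg : ∀ a ∈ ages ν, ∫⁻ w, ENNReal.ofReal (Real.exp (4 * θ * meanService p *
      scaledNetCount n (meanService p) (unitCount w))) ∂(futureLaw ν a) ≤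
        ENNReal.ofReal (Real.exp g)) (τ T : ℕ) :
    expMoment P (fun ω => θ * D.workBound p K τ (τ + T) ω) ≤ ENNReal.ofReal (Real.exp (β / 2)) *
      ENNReal.ofReal (Real.exp ((g + (K : ℝ) ^ 4 * (4 * θ) ^ 2 / 2) / 4)) ^ T := by
  set m := meanService p
  set X : Fin 4 → Ω → ℝ := ![fun ω => θ * ((K + 1) * l1 K (D.scaledProfile p K ω τ)),
    fun ω => θ * (K * l1 K (D.scaledProfile p K ω (τ + T))),
    fun ω => θ * m * ∑ i ∈ Finset.Ico τ (τ + T), D.scaledArrivals p ω i,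
    fun ω => θ * ∑ i ∈ Finset.Ico τ (τ + T), ∑ k ∈ Finset.range K,
      ((k : ℝ) + 1) * D.scaledNoise p ω i k] with hX
  have hXm : ∀ i ∈ (Finset.univ : Finset (Fin 4)), AEMeasurable (X i) P := by
    intro i _
    fin_cases i
    · exact ((hD.aemeasurable_l1 τ).const_mul _).const_mul _
    · exact ((hD.aemeasurable_l1 (τ + T)).const_mul _).const_mul _
    · exact ((Finset.measurable_fun_sum _ fun i _ =>
        hD.measurable_scaledArrivals i).const_mul _).aemeasurable
    · exact ((Finset.measurable_fun_sum _ fun i _ => Finset.measurable_fun_sum _ fun k _ =>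
        (hD.measurable_scaledNoise hn i k).const_mul _).const_mul _).aemeasurable
  have h := expMoment_sum_le (P := P) Finset.univ hXm
    (β := ![β, β, g * T, (K : ℝ) ^ 4 * (4 * θ) ^ 2 / 2 * T]) fun i _ => by
      rw [Finset.card_univ, Fintype.card_fin]
      fin_cases i
      · refine le_trans (le_of_eq (lintegral_congr fun ω => ?_)) (hl τ)
        simp only [hX]; congr 2; simp; ring
      · refine le_trans (expMoment_mono (ae_of_all _ fun ω => ?_)) (hl (τ + T))
        have h0 := l1_nonneg K (D.scaledProfile p K ω (τ + T))
        have h1 := mul_nonneg hθ h0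
        simp only [hX]; simp
        linarith
      · refine le_trans (le_of_eq (lintegral_congr fun ω => ?_))
          (hD.expMoment_sum_scaledArrivals_le hν hp hg τ T)
        simp only [hX]; congr 2; simp; ring
      · refine le_trans (le_of_eq (lintegral_congr fun ω => ?_))
          (hD.expMoment_sum_scaledNoise_le hν hp hn (4 * θ) τ T)
        simp only [hX]; congr 2; simp; ring
  rw [← ENNReal.ofReal_pow (Real.exp_pos _).le, ← Real.exp_nat_mul,
    ← ENNReal.ofReal_mul (Real.exp_pos _).le, ← Real.exp_add]
  refine le_trans (le_of_eq (lintegral_congr fun ω => ?_)) (h.trans (le_of_eq ?_))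
  · congr 2
    beta_reduce
    rw [Fin.sum_univ_four]
    simp only [hX, Input.workBound, ScaledPath.netInput, Finset.sum_add_distrib, ← Finset.mul_sum]
    simp
    ring
  · congr 2
    rw [Fin.sum_univ_four, Finset.card_univ, Fintype.card_fin]
    simp
    ring

/-- The stationary queue length has an exponential moment. Stationarity replaces a truncated moment
at time `0` by one at time `t`, at which the initial queue length has been forgotten up to a term
that vanishes as `t → ∞`. -/
lemma IsStationaryQueue.expMoment_queue_le (hD : IsStationaryQueue P ν p K D)
    (hν : IsInterarrivalLaw ν) (hp : IsServiceLaw p K) (hn : 0 < n) {θ : ℝ} (hθ : 0 ≤ θ)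
    {c r : ℝ≥0∞} (hc : c ≠ ⊤) (hr : r < 1)
    (hwork : ∀ τ T, expMoment P (fun ω => θ * D.workBound p K τ (τ + T) ω) ≤ c * r ^ T) :
    expMoment P (fun ω => θ * (meanService p * D.scaledQueue ω 0)) ≤ c * (1 - r)⁻¹ := by
  set m := meanService p
  set G : ℕ × (Fin K → ℕ) → ℝ := fun x => m * (x.1 / √(n : ℝ)) with hG
  have hGq : ∀ t ω, m * D.scaledQueue ω t = G (D.state K t ω) := fun t ω => rfl
  set E : ℕ → ℕ → Ω → ℝ≥0∞ := fun τ t ω => ENNReal.ofReal (Real.exp (θ * D.workBound p K τ t ω))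
    with hE
  have hEm : ∀ τ t, AEMeasurable (E τ t) P := fun τ t =>
    AEMeasurable.ofReal_exp ((hD.aemeasurable_workBound hn τ t).const_mul θ)
  have hEint : ∀ τ t, τ ≤ t → ∫⁻ ω, E τ t ω ∂P ≤ c * r ^ (t - τ) := by
    intro τ t h
    obtain ⟨T, rfl⟩ := Nat.exists_eq_add_of_le h
    rw [Nat.add_sub_cancel_left]
    exact hwork τ T
  have hind : ∀ N : ℕ, AEMeasurable
      (fun ω => if (N : ℝ) < G (D.state K 0 ω) then (1 : ℝ≥0∞) else 0) P := fun N => by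
    simpa using hD.aemeasurable_state 0 fun x => if (N : ℝ) < G x then (1 : ℝ≥0∞) else 0
  -- The truncated moment at time `t`, on whether the initial queue is at most `N`.
  have hbound : ∀ Y N t : ℕ,
      ∫⁻ ω, min (ENNReal.ofReal (Real.exp (θ * G (D.state K 0 ω)))) Y ∂P ≤
        c * (1 - r)⁻¹ + ENNReal.ofReal (Real.exp (θ * N)) * (c * r ^ t) +
          Y * ∫⁻ ω, (if (N : ℝ) < G (D.state K 0 ω) then 1 else 0) ∂P := by
    intro Y N t
    have hstat := hD.lintegral_state t fun x => min (ENNReal.ofReal (Real.exp (θ * G x))) (Y : ℝ≥0∞)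
    rw [← hstat]
    have hpt : ∀ᵐ ω ∂P, min (ENNReal.ofReal (Real.exp (θ * G (D.state K t ω)))) (Y : ℝ≥0∞) ≤
        ∑ τ ∈ Finset.range (t + 1), E τ t ω + ENNReal.ofReal (Real.exp (θ * N)) * E 0 t ω +
          Y * (if (N : ℝ) < G (D.state K 0 ω) then 1 else 0) := by
      filter_upwards [hD.ae_isRegular hν hp] with ω hω
      rcases (hω.scaledPath hn hp).exists_queue_le hp.meanService_eq t with ⟨τ, hτ, h⟩ | h
      · rw [hGq] at h
        refine (min_le_left _ _).trans (le_trans ?_ (le_self_add.trans le_self_add))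
        refine le_trans ?_ (Finset.single_le_sum (f := fun τ => E τ t ω) (fun _ _ => zero_le)
          (Finset.mem_range.2 (Nat.lt_succ_of_le hτ)))
        exact ENNReal.ofReal_le_ofReal (Real.exp_le_exp.2 (mul_le_mul_of_nonneg_left h hθ))
      · rw [hGq, hGq] at h
        split_ifs with hN
        · exact (min_le_right _ _).trans (by rw [mul_one]; exact le_add_self)
        · refine (min_le_left _ _).trans (le_trans ?_ (le_add_self.trans le_self_add))
          rw [hE, ← ENNReal.ofReal_mul (Real.exp_pos _).le, ← Real.exp_add, ← mul_add]
          refine ENNReal.ofReal_le_ofReal (Real.exp_le_exp.2 (mul_le_mul_of_nonneg_left ?_ hθ))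
          refine h.trans ?_
          rw [Input.workBound]
          simp only [Nat.cast_zero] at hN ⊢
          linarith [not_lt.1 hN]
    refine (lintegral_mono_ae hpt).trans ?_
    rw [lintegral_add_right' _ ((hind N).const_mul _),
      lintegral_add_right' _ ((hEm 0 t).const_mul _),
      lintegral_finsetSum' _ fun τ _ => hEm τ t, lintegral_const_mul' _ _ ENNReal.ofReal_ne_top,
      lintegral_const_mul' _ _ (ENNReal.natCast_ne_top Y)]
    gcongr
    · calc ∑ τ ∈ Finset.range (t + 1), ∫⁻ ω, E τ t ω ∂P
          ≤ ∑ τ ∈ Finset.range (t + 1), c * r ^ (t - τ) :=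
            Finset.sum_le_sum fun τ hτ => hEint τ t (Nat.lt_succ_iff.1 (Finset.mem_range.1 hτ))
        _ = c * ∑ τ ∈ Finset.range (t + 1), r ^ τ := by
            rw [← Finset.mul_sum]
            congr 1
            have := Finset.sum_range_reflect (fun τ => r ^ τ) (t + 1)
            simpa using this
        _ ≤ c * (1 - r)⁻¹ := by
            gcongr
            rw [← ENNReal.tsum_geometric]
            exact ENNReal.sum_le_tsum _
    · exact hEint 0 t (Nat.zero_le t)
  -- Let `t → ∞`.
  have hbound2 : ∀ Y N : ℕ,
      ∫⁻ ω, min (ENNReal.ofReal (Real.exp (θ * G (D.state K 0 ω)))) Y ∂P ≤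
        c * (1 - r)⁻¹ + Y * ∫⁻ ω, (if (N : ℝ) < G (D.state K 0 ω) then 1 else 0) ∂P := by
    intro Y N
    have hpow : Tendsto (fun t : ℕ => r ^ t) atTop (𝓝 0) :=
      ENNReal.tendsto_pow_atTop_nhds_zero_of_lt_one hr
    have h1 : Tendsto (fun t : ℕ => ENNReal.ofReal (Real.exp (θ * N)) * (c * r ^ t)) atTop (𝓝 0) := by
      have := ENNReal.Tendsto.const_mul (a := ENNReal.ofReal (Real.exp (θ * N)))
        (ENNReal.Tendsto.const_mul (a := c) hpow (Or.inr hc)) (Or.inr ENNReal.ofReal_ne_top)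
      simpa using this
    have h2 := (tendsto_const_nhds (x := c * (1 - r)⁻¹)).add h1 |>.add
      (tendsto_const_nhds (x := Y * ∫⁻ ω, (if (N : ℝ) < G (D.state K 0 ω) then 1 else 0) ∂P))
    rw [add_zero] at h2
    exact ge_of_tendsto' h2 (hbound Y N)
  -- Let `N → ∞`.
  have hbound3 : ∀ Y : ℕ,
      ∫⁻ ω, min (ENNReal.ofReal (Real.exp (θ * G (D.state K 0 ω)))) Y ∂P ≤ c * (1 - r)⁻¹ := by
    intro Y
    have h1 : Tendsto (fun N : ℕ => ∫⁻ ω, (if (N : ℝ) < G (D.state K 0 ω) then (1 : ℝ≥0∞) else 0) ∂P)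
        atTop (𝓝 (∫⁻ _, 0 ∂P)) := by
      refine tendsto_lintegral_of_dominated_convergence' (fun _ => 1) hind
        (fun N => ae_of_all _ fun ω => by beta_reduce; split_ifs <;> simp) (by simp)
        (ae_of_all _ fun ω => ?_)
      refine tendsto_const_nhds.congr' ?_
      filter_upwards [tendsto_natCast_atTop_atTop.eventually_ge_atTop (G (D.state K 0 ω))]
        with N hN
      rw [if_neg (not_lt.2 hN)]
    rw [lintegral_zero] at h1
    have h2 := (tendsto_const_nhds (x := c * (1 - r)⁻¹)).add
      (ENNReal.Tendsto.const_mul (a := (Y : ℝ≥0∞)) h1 (Or.inr (ENNReal.natCast_ne_top Y)))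
    rw [mul_zero, add_zero] at h2
    exact ge_of_tendsto' h2 (hbound2 Y)
  -- Remove the truncation `Y`, by Fatou's lemma.
  have hlim : ∀ ω, Tendsto (fun Y : ℕ => min (ENNReal.ofReal (Real.exp (θ * G (D.state K 0 ω))))
      (Y : ℝ≥0∞)) atTop (𝓝 (ENNReal.ofReal (Real.exp (θ * G (D.state K 0 ω))))) := by
    intro ω
    refine tendsto_const_nhds.congr' ?_
    obtain ⟨Y₀, hY₀⟩ := ENNReal.exists_nat_gt
      (r := ENNReal.ofReal (Real.exp (θ * G (D.state K 0 ω)))) ENNReal.ofReal_ne_top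
    filter_upwards [eventually_ge_atTop Y₀] with Y hY
    exact (min_eq_left (hY₀.le.trans (by exact_mod_cast hY))).symm
  calc expMoment P (fun ω => θ * (m * D.scaledQueue ω 0))
      = ∫⁻ ω, liminf (fun Y : ℕ => min (ENNReal.ofReal (Real.exp (θ * G (D.state K 0 ω))))
          (Y : ℝ≥0∞)) atTop ∂P := by
        refine lintegral_congr fun ω => ?_
        rw [(hlim ω).liminf_eq]
        beta_reduce
        rw [hGq]
        simp
    _ ≤ liminf (fun Y : ℕ => ∫⁻ ω, min (ENNReal.ofReal (Real.exp (θ * G (D.state K 0 ω))))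
          (Y : ℝ≥0∞) ∂P) atTop := by
        refine lintegral_liminf_le' fun Y => ?_
        simpa using hD.aemeasurable_state 0
          fun x => min (ENNReal.ofReal (Real.exp (θ * G x))) (Y : ℝ≥0∞)
    _ ≤ c * (1 - r)⁻¹ :=
        (liminf_le_liminf (Eventually.of_forall hbound3)).trans_eq (liminf_const _)

end Queue

end QEDQueue

theorem theorem3
    (K : ℕ) (p : PMF ℕ) (hp : QEDQueue.IsServiceLaw p K)
    (ν : ℕ → Measure ℝ) [∀ n, IsProbabilityMeasure (ν n)]
    (hν : ∀ n, 1 ≤ n → QEDQueue.IsInterarrivalLaw (ν n))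
    (ca : ℝ≥0) (hA : QEDQueue.ArrivalConditions ν ca)
    (β : ℝ) (hβ : 0 < β)
    (hHW : Tendsto (fun n : ℕ => √(n : ℝ) *
      (1 - QEDQueue.rate (ν n) * QEDQueue.meanService p / n)) atTop (𝓝 β))
    (Ω : ℕ → Type*) [∀ n, MeasurableSpace (Ω n)]
    (P : ∀ n, Measure (Ω n)) [∀ n, IsProbabilityMeasure (P n)]
    (D : ∀ n, QEDQueue.Input n (Ω n))
    (hD : ∀ᶠ n in atTop, QEDQueue.IsStationaryQueue (P n) (ν n) p K (D n))
    (hexp : QEDQueue.ArrivalExpMoments ν) :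
    ∃ θ : ℝ, 0 < θ ∧
      limsup (fun n : ℕ => ∫⁻ ω, ENNReal.ofReal
        (Real.exp (θ * (((D n).queueLength 0 ω : ℝ) / √(n : ℝ)))) ∂(P n)) atTop < ∞ := by
  open QEDQueue in
  have hm := hp.meanService_pos
  set m := meanService p with hmdef
  obtain ⟨γ, hγ, M, hM0, hmgf⟩ := hA.exists_mgf_bound hexp hm hβ hHW
  obtain ⟨N, δ, hδ, hδ1, hcontr⟩ := ScaledPath.exists_contraction hp.latticeWeights
  -- The quadratic terms of arrivals and services are dominated by the drift `-γ m s`.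
  set C : ℝ := M * m ^ 2 + (K : ℝ) ^ 4 / 2 with hC
  have hC0 : 0 ≤ C := by positivity
  set s : ℝ := min (1 / m) (γ * m / (2 * C + 1)) with hs
  have hs0 : 0 < s := lt_min (by positivity) (by positivity)
  have hsm : s * m ≤ 1 := by
    have := mul_le_mul_of_nonneg_right (min_le_left (1 / m) (γ * m / (2 * C + 1))) hm.le
    rwa [div_mul_cancel₀ _ hm.ne'] at this
  have hdrift : -γ * (s * m) + M * (s * m) ^ 2 + (K : ℝ) ^ 4 * s ^ 2 / 2 < 0 := by
    have h1 : s * (2 * C + 1) ≤ γ * m := by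
      rw [← le_div_iff₀ (by positivity)]; exact min_le_right _ _
    have h2 : s * (s * (2 * C + 1)) ≤ s * (γ * m) := mul_le_mul_of_nonneg_left h1 hs0.le
    have h3 : 0 < s * s := mul_pos hs0 hs0
    have h4 : 0 ≤ C * (s * s) := mul_nonneg hC0 h3.le
    have h5 : M * (s * m) ^ 2 + (K : ℝ) ^ 4 * s ^ 2 / 2 = C * (s * s) := by rw [hC]; ring
    linarith
  set g : ℝ := -γ * (s * m) + M * (s * m) ^ 2 with hg
  -- `η` is the exponent at which the profile enters the workload bound, and `d` the exponent at
  -- which each noise term enters after Hölder's inequality over `N (K + 1)` terms.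
  set η : ℝ := s * (K + 1) with hη
  have hη0 : 0 < η := by positivity
  set κ : ℝ := 2 * η / δ with hκ
  have hκ0 : 0 < κ := by positivity
  set d : ℝ := (N * (K + 1) : ℕ) * κ with hd
  have hd0 : 0 ≤ d := by positivity
  obtain ⟨Ma, hMa⟩ := hexp.exists_abs_bound hm hβ hHW (θ := d + 1) (by positivity)
  -- `exp b` dominates both the arrival bound `Ma` and the service bound `2 exp (d ^ 2 / 2)`.
  set b : ℝ := Ma + Real.log 2 + d ^ 2 / 2 with hb
  have hb0 : 0 ≤ b := by
    have := Real.log_nonneg one_le_two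
    positivity
  set c : ℝ≥0∞ := ENNReal.ofReal (Real.exp (b / 2)) with hc
  set r : ℝ≥0∞ := ENNReal.ofReal (Real.exp ((g + (K : ℝ) ^ 4 * s ^ 2 / 2) / 4)) with hr
  have hr1 : r < 1 := by
    rw [hr, ENNReal.ofReal_lt_one, Real.exp_lt_one_iff]
    linarith
  refine ⟨s / 4 * m, by positivity, ?_⟩
  have hfin : c * (1 - r)⁻¹ < ⊤ :=
    ENNReal.mul_lt_top ENNReal.ofReal_lt_top
      (ENNReal.inv_lt_top.2 (tsub_pos_of_lt hr1))
  refine lt_of_le_of_lt (limsup_le_of_le (h := ?_)) hfin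
  filter_upwards [hD, hmgf (s * m) (by positivity) hsm, hMa, eventually_ge_atTop 1]
    with n hDn hmgfn hMan hn1
  have hn : 0 < n := hn1
  have hνn := hν n hn1
  have hb1 : ∀ a ∈ ages (ν n), ∫⁻ w, ENNReal.ofReal (Real.exp ((N * (K + 1) : ℕ) * κ *
      |scaledNetCount n m (unitCount w)|)) ∂(futureLaw (ν n) a) ≤ ENNReal.ofReal (Real.exp b) := by
    intro a ha
    refine le_trans (lintegral_mono fun w => ENNReal.ofReal_le_ofReal (Real.exp_le_exp.2 ?_))
      ((hMan a ha).trans ?_)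
    · exact mul_le_mul_of_nonneg_right (by linarith) (abs_nonneg _)
    · rw [← ENNReal.ofReal_coe_nnreal]
      refine ENNReal.ofReal_le_ofReal ?_
      have h1 := Real.add_one_le_exp b
      have h2 := Real.log_nonneg one_le_two
      have h3 : 0 ≤ d ^ 2 / 2 := by positivity
      linarith
  have hb2 : 2 * Real.exp (((N * (K + 1) : ℕ) * κ) ^ 2 / 2) ≤ Real.exp b := by
    rw [← hd]
    calc 2 * Real.exp (d ^ 2 / 2) = Real.exp (Real.log 2 + d ^ 2 / 2) := by
          rw [Real.exp_add, Real.exp_log two_pos]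
      _ ≤ Real.exp b := Real.exp_le_exp.2 (by linarith [Ma.coe_nonneg])
  have hl := hDn.expMoment_l1_le hνn hp hn hδ hδ1 hcontr hη0.le
    (hDn.expMoment_err_le hνn hp hn N hb0 hb1 hb2)
  have hwork := hDn.expMoment_workBound_le hνn hp hn (θ := s / 4) (by positivity) (β := b) (g := g)
    (fun t => by
      have e : 4 * (s / 4) * ((K : ℝ) + 1) = η := by rw [hη]; ring
      rw [e]; exact hl t)
    (fun a ha => by
      have e : 4 * (s / 4) * meanService p = s * m := by rw [hmdef]; ring
      rw [e]; exact hmgfn a ha)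
  have e4 : (4 * (s / 4)) = s := by ring
  rw [e4] at hwork
  have := hDn.expMoment_queue_le hνn hp hn (θ := s / 4) (by positivity) (c := c) (r := r)
    ENNReal.ofReal_ne_top hr1 hwork
  refine le_trans (le_of_eq (lintegral_congr fun ω => ?_)) this
  congr 2
  beta_reduce
  rw [Input.scaledQueue, Nat.cast_zero]
  ring
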